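/- **Setting.** Let $\Omega\subset\mathbb R^2$ be a polygonal domain (open, connected, with $\Omega=\operatorname{int}\overline\Omega$). Let $\mathcal T_u$ be a finite mesh of $\overline\Omega$ by closed polygons with disjoint interiors that meet edge to edge (hanging nodes count as vertices of every polygon containing them). Each polygon $S=S(\nu)$ carries an interior point $\nu$, and joining $\nu$ to all vertices of $S$ cuts $S$ into non-degenerate closed triangles with disjoint interiors; $\mathcal T_h$ is the resulting conforming triangulation of $\overline\Omega$. Let $\mathcal F_u$ be the set of edges of the polygons, $\mathcal F_u^0$ the set of those not lying on $\partial\Omega$, and $\mathcal F_p$ the set of the edges joining the points $\nu$ to the vertices of their polygons. Write $h_e$ for the length of an edge $e$ and $h_S$ for the diameter of $S$. The mesh is called $(\rho,c)$-regular if every $S(\nu)\in\mathcal T_u$ is star-shaped with respect to the ball of radius $\rho h_{S}$ about $\nu$, and every edge $e$ of $S(\nu)$ satisfies $h_e\ge c\,h_{S}$. On each edge $e$ fix a unit normal $\bm n$ (pointing out of $\Omega$ if $e\subset\partial\Omega$) and the corresponding unit tangent $\bm t$. For a quantity $\phi$ defined triangle by triangle, the jump on $e$ is $[\phi]=\sum_{\tau\in\mathcal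 T_h,\,e\subset\partial\tau}\delta_\tau\,\phi|_\tau$, where $\delta_\tau=\bm n_\tau\cdot\bm n=\pm1$ and $\bm n_\tau$ is the outward unit normal of $\tau$ on $e$ (on a boundary edge the sum has one term). Let $k\ge0$, let $P^k$ denote polynomials of degree at most $k$, and let $\nabla_h$ be the elementwise gradient. Define $$U^h=\{\bm v:\ \bm v|_\tau\in P^k(\tau)^2\ \forall\tau\in\mathcal T_h,\ \bm v\cdot\bm n\text{ is continuous over every }e\in\mathcal F_p\},$$ $$W^h=\{G:\ G|_\tau\in P^k(\tau)^{2\times2}\ \forall\tau\in\mathcal T_h,\ G\bm n\text{ is continuous over every }e\in\mathcal F_u^0\},$$ $$\widehat W^h=\Big\{G\in W^h:\ \int_e[G\bm n]\cdot\widehat{\bm v}\,ds=0\ \ \forall e\in\mathcal F_p,\ \forall\,\widehat{\bm v}\in P^k(e)^2\text{ with }\widehat{\bm v}\cdot\bm n=0\text{ on }e\Big\}.$$ (For $G\in\widehat W^h$, $G\bm n$ is single-valued on $\mathcal F_u$ and $(G\bm n)\cdot\bm t$ is single-valued on $\mathcal F_p$.) For $G\in\widehat W^h$ and $\bm v\in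 U^h$ put $$B_h(G,\bm v)=\int_\Omega G:\nabla_h\bm v\,dx-\sum_{e\in\mathcal F_u}\int_e[\bm v]\cdot(G\bm n)\,ds-\sum_{e\in\mathcal F_p}\int_e[(\bm v\cdot\bm t)\,\bm t\cdot(G\bm n)]\,ds,$$ $$\|\bm v\|_{Z_2}^2=\|\nabla_h\bm v\|_{L^2(\Omega)}^2+\sum_{e\in\mathcal F_u}h_e^{-1}\|[\bm v]\|_{L^2(e)}^2+\sum_{e\in\mathcal F_p}h_e^{-1}\|[(\bm v\cdot\bm t)\bm t]\|_{L^2(e)}^2,$$ $$\|G\|_{X'}^2=\|G\|_{L^2(\Omega)}^2+\sum_{e\in\mathcal F_u}h_e\|G\bm n\|_{L^2(e)}^2+\sum_{e\in\mathcal F_p}h_e\|(G\bm n)\cdot\bm t\|_{L^2(e)}^2.$$ **Theorem.** For all $k\ge0$, $\rho>0$ and $c>0$ there is a constant $C>0$, depending only on $k$, $\rho$ and $c$, such that for every polygonal domain $\Omega$ and every $(\rho,c)$-regular mesh of $\Omega$ as above, $$\inf_{0\ne\bm v\in U^h}\ \sup_{0\ne G\in\widehat W^h}\ \frac{B_h(G,\bm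 v)}{\|G\|_{X'}\,\|\bm v\|_{Z_2}}\ \ge\ C.$$ -/

import Mathlib

open scoped Matrix

noncomputable section

namespace SDG

/-- The Euclidean plane. -/
abbrev Pt : Type := EuclideanSpace ℝ (Fin 2)

/-! ### Edges: unordered pairs of endpoints -/

/-- The closed segment with endpoints `e`. -/
def edgeSet (e : Sym2 Pt) : Set Pt := convexHull ℝ {x | x ∈ e}

/-- The length `h_e`. -/
def edgeLength (e : Sym2 Pt) : ℝ := Sym2.lift ⟨fun a b => dist a b, dist_comm⟩ e

/-- The arc-length integral `∫_e f ds`, computed by the affine parametrization of the segment. -/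
def edgeIntegral (f : Pt → ℝ) (e : Sym2 Pt) : ℝ :=
  Sym2.lift ⟨fun a b => dist a b * ∫ s in (0 : ℝ)..1, f (AffineMap.lineMap a b s), by
    intro a b
    have h := intervalIntegral.integral_comp_sub_left
      (fun s : ℝ => f (AffineMap.lineMap b a s)) (a := 0) (b := 1) 1
    simp only [AffineMap.lineMap_apply_one_sub, sub_self, sub_zero] at h
    simp only [dist_comm a b, h]⟩ e

/-! ### Polynomials -/

/-- `P^k`: real polynomials in two variables of total degree at most `k`. -/
def P (k : ℕ) : Submodule ℝ (MvPolynomial (Fin 2) ℝ) :=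
  MvPolynomial.restrictTotalDegree (Fin 2) ℝ k

/-- Value of a polynomial at a point of the plane. -/
def pval (p : MvPolynomial (Fin 2) ℝ) (x : Pt) : ℝ := MvPolynomial.eval (fun j => x j) p

/-- Value of a polynomial vector field. -/
def vval (p : Fin 2 → MvPolynomial (Fin 2) ℝ) (x : Pt) : Fin 2 → ℝ := fun i => pval (p i) x

/-- Value of a polynomial matrix field. -/
def mval (p : Matrix (Fin 2) (Fin 2) (MvPolynomial (Fin 2) ℝ)) (x : Pt) :
    Matrix (Fin 2) (Fin 2) ℝ := Matrix.of fun i j => pval (p i j) x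

/-- The gradient `(∇ v)_{ij} = ∂_j v_i`. -/
def grad (p : Fin 2 → MvPolynomial (Fin 2) ℝ) :
    Matrix (Fin 2) (Fin 2) (MvPolynomial (Fin 2) ℝ) :=
  Matrix.of fun i j => MvPolynomial.pderiv j (p i)

/-- The Frobenius product `A : B`. -/
def frob (A B : Matrix (Fin 2) (Fin 2) ℝ) : ℝ := ∑ i, ∑ j, A i j * B i j

/-! ### Meshes -/

/-- The data of a polygonal primal mesh with its triangular submesh: finitely many cells, each with
its vertices in cyclic order and an interior point `ν`; and a vector for every edge, which
will be its fixed unit normal (values at pairs that are not edges are irrelevant). -/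
structure MeshData where
  numCells : ℕ
  numVert : Fin numCells → ℕ
  ν : Fin numCells → Pt
  vertex : (S : Fin numCells) → Fin (numVert S) → Pt
  normal : Sym2 Pt → Fin 2 → ℝ

namespace MeshData

variable (M : MeshData)

/-- Indices of the triangles of `𝒯_h`: a cell `S` and one of its sides, from the vertex number `i`
to the next vertex in cyclic order. -/
abbrev Tri : Type := (S : Fin M.numCells) × Fin (M.numVert S)

/-- First vertex of the side of the cell that belongs to the triangle. -/
def va (τ : M.Tri) : Pt := M.vertex τ.1 τ.2

/-- Second vertex of that side (`finRotate` is the cyclic successor). -/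
def vb (τ : M.Tri) : Pt := M.vertex τ.1 (finRotate _ τ.2)

/-- The interior point of the cell that contains the triangle. -/
def vc (τ : M.Tri) : Pt := M.ν τ.1

def triVerts (τ : M.Tri) : Set Pt := {M.vc τ, M.va τ, M.vb τ}

/-- The closed triangle. -/
def triSet (τ : M.Tri) : Set Pt := convexHull ℝ (M.triVerts τ)

/-- The primal cell `S(ν)`, the union of its triangles. -/
def cellSet (S : Fin M.numCells) : Set Pt := ⋃ i : Fin (M.numVert S), M.triSet ⟨S, i⟩

open Classical in
/-- The three edges of a triangle. -/
def triEdges (τ : M.Tri) : Finset (Sym2 Pt) :=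
  {s(M.va τ, M.vb τ), s(M.vc τ, M.va τ), s(M.vc τ, M.vb τ)}

open Classical in
/-- The primal edges `ℱ_u`. -/
def Fu : Finset (Sym2 Pt) := Finset.univ.image fun τ : M.Tri => s(M.va τ, M.vb τ)

open Classical in
/-- The dual edges `ℱ_p`: they join the interior point of a cell to its vertices. -/
def Fp : Finset (Sym2 Pt) := Finset.univ.image fun τ : M.Tri => s(M.vc τ, M.va τ)

open Classical in
/-- The triangles that have `e` as an edge. -/
def adj (e : Sym2 Pt) : Finset M.Tri := Finset.univ.filter fun τ => e ∈ M.triEdges τ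

/-- The fixed normal of the edge `e` points to the outside of the triangle `τ`. -/
def IsOutward (τ : M.Tri) (e : Sym2 Pt) : Prop :=
  ∀ x ∈ M.triVerts τ, ∀ y ∈ e, M.normal e ⬝ᵥ (x - y).ofLp ≤ 0

/-- The unit tangent vector that corresponds to the unit normal. -/
def tangent (e : Sym2 Pt) : Fin 2 → ℝ := ![-M.normal e 1, M.normal e 0]

open Classical in
/-- The sign `δ = n_τ ⬝ n_e`. -/
def sgn (τ : M.Tri) (e : Sym2 Pt) : ℝ := if M.IsOutward τ e then 1 else -1

/-- `M` is a mesh of the domain `Ω`: the triangles of the submesh are non-degenerate, have disjoint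
interiors, fit together edge to edge (so hanging nodes count as vertices of all the cells that
contain them), and fill the closure of `Ω`; the edge normals are unit normals, and point
outwards on `∂Ω`. -/
structure IsMeshOf (Ω : Set Pt) : Prop where
  three_le : ∀ S, 3 ≤ M.numVert S
  nondegenerate : ∀ τ : M.Tri, AffineIndependent ℝ ![M.vc τ, M.va τ, M.vb τ]
  disjoint : ∀ τ τ' : M.Tri, τ ≠ τ' → Disjoint (interior (M.triSet τ)) (interior (M.triSet τ'))
  conforming : ∀ τ τ' : M.Tri,
    M.triSet τ ∩ M.triSet τ' ⊆ convexHull ℝ (M.triVerts τ ∩ M.triVerts τ')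
  cover : ⋃ S, M.cellSet S = closure Ω
  normal_unit : ∀ τ : M.Tri, ∀ e ∈ M.triEdges τ, M.normal e ⬝ᵥ M.normal e = 1
  normal_orth : ∀ τ : M.Tri, ∀ e ∈ M.triEdges τ, ∀ x ∈ e, ∀ y ∈ e,
    M.normal e ⬝ᵥ (x - y).ofLp = 0
  normal_boundary : ∀ e ∈ M.Fu, edgeSet e ⊆ frontier Ω → ∀ τ ∈ M.adj e, M.IsOutward τ e

/-- Mesh regularity: with `h_S` the diameter of the cell `S = S(ν)`, the cell is star-shaped with
respect to the ball of radius `ρ h_S` about `ν`, and its sides have length at least `c h_S`. -/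
structure IsRegular (ρ c : ℝ) : Prop where
  star : ∀ S, ∀ y ∈ Metric.ball (M.ν S) (ρ * Metric.diam (M.cellSet S)),
    StarConvex ℝ y (M.cellSet S)
  side : ∀ τ : M.Tri, c * Metric.diam (M.cellSet τ.1) ≤ dist (M.va τ) (M.vb τ)

/-! ### Piecewise polynomial fields

A piecewise polynomial field is the family of its restrictions to the triangles. -/

/-- Piecewise polynomial vector fields. -/
abbrev VField : Type := M.Tri → Fin 2 → MvPolynomial (Fin 2) ℝ

/-- Piecewise polynomial matrix fields. -/
abbrev MField : Type := M.Tri → Matrix (Fin 2) (Fin 2) (MvPolynomial (Fin 2) ℝ)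

/-- The jump `[v]` on `e`; on a boundary edge it is the trace. -/
def jump (v : M.VField) (e : Sym2 Pt) (x : Pt) : Fin 2 → ℝ :=
  ∑ τ ∈ M.adj e, M.sgn τ e • vval (v τ) x

/-- The jump `[(v ⬝ t) t]` on `e`. -/
def jumpTan (v : M.VField) (e : Sym2 Pt) (x : Pt) : Fin 2 → ℝ :=
  ∑ τ ∈ M.adj e, M.sgn τ e • ((vval (v τ) x ⬝ᵥ M.tangent e) • M.tangent e)

/-- The jump `[G n]` on `e`. -/
def jumpNormal (G : M.MField) (e : Sym2 Pt) (x : Pt) : Fin 2 → ℝ :=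
  ∑ τ ∈ M.adj e, M.sgn τ e • (mval (G τ) x *ᵥ M.normal e)

/-- The jump `[(v ⬝ t) t ⬝ (G n)]` on `e`. -/
def jumpMixed (G : M.MField) (v : M.VField) (e : Sym2 Pt) (x : Pt) : ℝ :=
  ∑ τ ∈ M.adj e, M.sgn τ e *
    (((vval (v τ) x ⬝ᵥ M.tangent e) • M.tangent e) ⬝ᵥ (mval (G τ) x *ᵥ M.normal e))

/-- The trace `G n` on `e`. It is used where it (or the component of it that is used) takes
the same value from all the triangles at `e`; the average is then that common value. -/
def normalTrace (G : M.MField) (e : Sym2 Pt) (x : Pt) : Fin 2 → ℝ :=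
  ((M.adj e).card : ℝ)⁻¹ • ∑ τ ∈ M.adj e, mval (G τ) x *ᵥ M.normal e

/-- `U^h`. -/
def U (k : ℕ) : Set M.VField :=
  {v | (∀ τ i, v τ i ∈ P k) ∧
    ∀ e ∈ M.Fp, ∀ τ ∈ M.adj e, ∀ τ' ∈ M.adj e, ∀ x ∈ edgeSet e,
      vval (v τ) x ⬝ᵥ M.normal e = vval (v τ') x ⬝ᵥ M.normal e}

/-- `W^h`; the interior primal edges are those that do not lie on `∂Ω`. -/
def W (Ω : Set Pt) (k : ℕ) : Set M.MField :=
  {G | (∀ τ i j, G τ i j ∈ P k) ∧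
    ∀ e ∈ M.Fu, ¬ edgeSet e ⊆ frontier Ω → ∀ τ ∈ M.adj e, ∀ τ' ∈ M.adj e, ∀ x ∈ edgeSet e,
      mval (G τ) x *ᵥ M.normal e = mval (G τ') x *ᵥ M.normal e}

/-- `Û^h`: polynomial vector fields of degree at most `k` on each dual edge, with vanishing
normal component. -/
def UHat (k : ℕ) : Set (Sym2 Pt → Fin 2 → MvPolynomial (Fin 2) ℝ) :=
  {w | ∀ e ∈ M.Fp, (∀ i, w e i ∈ P k) ∧ ∀ x ∈ edgeSet e, vval (w e) x ⬝ᵥ M.normal e = 0}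

/-- `Ŵ^h`. -/
def WHat (Ω : Set Pt) (k : ℕ) : Set M.MField :=
  {G | G ∈ M.W Ω k ∧ ∀ w ∈ M.UHat k, ∀ e ∈ M.Fp,
    edgeIntegral (fun x => M.jumpNormal G e x ⬝ᵥ vval (w e) x) e = 0}

/-- The bilinear form `B_h(G, v)`. -/
def B (G : M.MField) (v : M.VField) : ℝ :=
  (∑ τ, ∫ x in M.triSet τ, frob (mval (G τ) x) (mval (grad (v τ)) x))
  - (∑ e ∈ M.Fu, edgeIntegral (fun x => M.jump v e x ⬝ᵥ M.normalTrace G e x) e)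
  - ∑ e ∈ M.Fp, edgeIntegral (fun x => M.jumpMixed G v e x) e

/-- The norm `‖v‖_{Z_2}`. -/
def normZ2 (v : M.VField) : ℝ :=
  √((∑ τ, ∫ x in M.triSet τ, frob (mval (grad (v τ)) x) (mval (grad (v τ)) x))
    + (∑ e ∈ M.Fu, (edgeLength e)⁻¹ * edgeIntegral (fun x => M.jump v e x ⬝ᵥ M.jump v e x) e)
    + ∑ e ∈ M.Fp, (edgeLength e)⁻¹ *
        edgeIntegral (fun x => M.jumpTan v e x ⬝ᵥ M.jumpTan v e x) e)

/-- The norm `‖G‖_{X'}`. -/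
def normX' (G : M.MField) : ℝ :=
  √((∑ τ, ∫ x in M.triSet τ, frob (mval (G τ) x) (mval (G τ) x))
    + (∑ e ∈ M.Fu, edgeLength e *
        edgeIntegral (fun x => M.normalTrace G e x ⬝ᵥ M.normalTrace G e x) e)
    + ∑ e ∈ M.Fp, edgeLength e *
        edgeIntegral (fun x => (M.normalTrace G e x ⬝ᵥ M.tangent e) ^ 2) e)

end MeshData

end SDG

end

namespace SDG

open MvPolynomial MeasureTheory

/-! ### Polynomial calculus -/

/-! For each `v` a test field `G` is written down with `‖v‖² ≤ 2 B(G, v)` and `‖G‖ ≤ K ‖v‖`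
(`exists_testField`); this gives the constant `(2K)⁻¹`.

On one triangle a constant matrix is determined by four numbers: its normal trace on the side of the
cell, and the tangential parts of its normal traces on the two dual edges. `Shape.exists_dual`
provides the dual basis `Λ_m`, with bounds that depend only on the shape. So `G = ∑ g_m Λ_m` has
four free scalar polynomials, and the component of the trace that belongs to index `m` sees `g_m`
alone. Take `g_m = -h_e⁻¹ E_m(jump) + θ λ_m (Λ_m : ∇v)`, where `E_m` extends from the edge and `λ_m`
is the barycentric coordinate vanishing on it.

The first summand makes the traces agree from both sides, so that `G` lies in `Ŵ^h`, and turns the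
edge terms of `B` into the jump part of `‖v‖²` (`B_testField`). The second is invisible on the edge,
stays in `P^k` because the gradient has lost a degree, and contributes `θ ∫ λ_m (Λ_m : ∇v)²`. On the
reference triangle this dominates `∫ (Λ_m : ∇v)²` by equivalence of norms on `P^k`
(`exists_bubble_bound`), hence it controls `∇v`. The cross term is absorbed by Young's inequality
for `θ` large.

The shape bounds come from `height_side`: star-shapedness keeps `ν` at distance `ρ h_S` from the
line of every side. The quotients are meaningful because both norms are definite; for `v` this is a
discrete divergence theorem (`eq_zero_of_sum_sgn`). -/

@[simp] lemma pval_zero (x : Pt) : pval 0 x = 0 := by simp [pval]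
@[simp] lemma pval_add (p q : MvPolynomial (Fin 2) ℝ) (x : Pt) :
    pval (p + q) x = pval p x + pval q x := by simp [pval]
@[simp] lemma pval_mul (p q : MvPolynomial (Fin 2) ℝ) (x : Pt) :
    pval (p * q) x = pval p x * pval q x := by simp [pval]
@[simp] lemma pval_C (a : ℝ) (x : Pt) : pval (C a) x = a := by simp [pval]
@[simp] lemma pval_X (i : Fin 2) (x : Pt) : pval (X i) x = x i := by simp [pval]
@[simp] lemma pval_sum {ι : Type*} (s : Finset ι) (p : ι → MvPolynomial (Fin 2) ℝ) (x : Pt) :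
    pval (∑ i ∈ s, p i) x = ∑ i ∈ s, pval (p i) x := by simp [pval]

@[fun_prop]
lemma continuous_pval (p : MvPolynomial (Fin 2) ℝ) : Continuous (pval p) := by
  unfold pval
  exact (MvPolynomial.continuous_eval p).comp (by fun_prop)

lemma mem_P {k : ℕ} {p : MvPolynomial (Fin 2) ℝ} : p ∈ P k ↔ p.totalDegree ≤ k :=
  MvPolynomial.mem_restrictTotalDegree _ _ _

lemma C_mul_mem_P {k : ℕ} {p : MvPolynomial (Fin 2) ℝ} (hp : p ∈ P k) (a : ℝ) : C a * p ∈ P k := by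
  rw [MvPolynomial.C_mul']
  exact (P k).smul_mem a hp

/-- The affine polynomial `c + n ⬝ x`. -/
noncomputable def affinePoly (c : ℝ) (n : Fin 2 → ℝ) : MvPolynomial (Fin 2) ℝ :=
  C c + C (n 0) * X 0 + C (n 1) * X 1

lemma pval_affinePoly (c : ℝ) (n : Fin 2 → ℝ) (x : Pt) :
    pval (affinePoly c n) x = c + n ⬝ᵥ x.ofLp := by
  simp [affinePoly, dotProduct, Fin.sum_univ_two, add_assoc]

lemma affinePoly_mem (c : ℝ) (n : Fin 2 → ℝ) : affinePoly c n ∈ P 1 := by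
  have hX : ∀ i : Fin 2, (X i : MvPolynomial (Fin 2) ℝ) ∈ P 1 := fun i =>
    mem_P.2 (MvPolynomial.totalDegree_X i).le
  have hC : (C c : MvPolynomial (Fin 2) ℝ) ∈ P 1 := mem_P.2 (by simp)
  exact (P 1).add_mem ((P 1).add_mem hC (C_mul_mem_P (hX 0) _)) (C_mul_mem_P (hX 1) _)

/-- Differentiation loses the degree that the affine factor restores. This keeps `λ_m (Λ_m : ∇v)` in
`P^k`, also for `k = 0`. -/
lemma affine_mul_pderiv_mem {k : ℕ} {l p : MvPolynomial (Fin 2) ℝ} (hl : l ∈ P 1) (hp : p ∈ P k)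
    (j : Fin 2) : l * pderiv j p ∈ P k := by
  rw [p.as_sum, map_sum, Finset.mul_sum]
  refine (P k).sum_mem fun s hs => ?_
  rw [pderiv_monomial]
  -- The subtraction `s - single j 1` truncates at `s j = 0`, but there the coefficient `s j` of the
  -- derivative vanishes.
  by_cases h : s j = 0
  · simp [h]
  · have h1 : (s.sum fun _ e => e) ≤ k := (MvPolynomial.le_totalDegree hs).trans (mem_P.1 hp)
    refine mem_P.2 ((totalDegree_mul _ _).trans ?_)
    have h2 : (monomial (s - Finsupp.single j 1) (coeff s p * (s j : ℝ))).totalDegree ≤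
        (s - Finsupp.single j 1).sum fun _ e => e := totalDegree_monomial_le _ _
    have h3 : ((s - Finsupp.single j 1).sum fun _ e => e) + 1 = s.sum fun _ e => e := by
      have e1 : s = (s - Finsupp.single j 1) + Finsupp.single j 1 := by
        ext i
        by_cases hij : j = i
        · subst hij; simp; omega
        · simp [hij]
      conv_rhs => rw [e1]
      rw [Finsupp.sum_add_index' (by simp) (by simp)]
      simp
    have h4 := mem_P.1 hl
    omega

lemma bind₁_mem {k : ℕ} {p : MvPolynomial (Fin 2) ℝ} (hp : p ∈ P k)
    {f : Fin 2 → MvPolynomial (Fin 2) ℝ} (hf : ∀ i, f i ∈ P 1) : bind₁ f p ∈ P k := by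
  rw [p.as_sum, map_sum]
  refine (P k).sum_mem fun s hs => ?_
  rw [bind₁_monomial]
  refine C_mul_mem_P (mem_P.2 ?_) _
  refine (totalDegree_finsetProd _ _).trans ?_
  refine le_trans ?_ ((MvPolynomial.le_totalDegree hs).trans (mem_P.1 hp))
  refine Finset.sum_le_sum fun i _ => (totalDegree_pow _ _).trans ?_
  simpa using Nat.mul_le_mul_left (s i) (mem_P.1 (hf i))

lemma pval_bind₁ (f : Fin 2 → MvPolynomial (Fin 2) ℝ) (p : MvPolynomial (Fin 2) ℝ) (x y : Pt)
    (h : ∀ i, pval (f i) x = y i) : pval (bind₁ f p) x = pval p y := by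
  unfold pval at *
  rw [← MvPolynomial.aeval_eq_eval, MvPolynomial.aeval_bind₁]
  simp [MvPolynomial.aeval_eq_eval, h]

/-- The coefficient of a nonconstant monomial reappears, times a positive integer, in the derivative
along any variable that divides it. -/
lemma eq_C_of_pderiv_eq_zero {p : MvPolynomial (Fin 2) ℝ} (h : ∀ j, pderiv j p = 0) :
    p = C (coeff 0 p) := by
  ext s
  by_cases hs : s = 0
  · simp [hs]
  obtain ⟨j, hj⟩ : ∃ j, s j ≠ 0 := by
    by_contra! h'
    exact hs (Finsupp.ext h')
  rw [coeff_C, if_neg (Ne.symm hs)]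
  have h2 : coeff (s - Finsupp.single j 1) (pderiv j p) = 0 := by rw [h j]; simp
  have e1 : (s - Finsupp.single j 1) + Finsupp.single j 1 = s := by
    ext i
    by_cases hij : j = i
    · subst hij; simp; omega
    · simp [hij]
  rw [coeff_pderiv, e1] at h2
  rcases mul_eq_zero.1 h2 with h3 | h3
  · exact h3
  · exfalso
    exact absurd h3 (by positivity)

/-! ### Comparison of bilinear forms in finite dimension -/

lemma exists_bilin_le_sq_norm {V : Type*} [NormedAddCommGroup V] [NormedSpace ℝ V]
    [FiniteDimensional ℝ V] (B : V →ₗ[ℝ] V →ₗ[ℝ] ℝ) :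
    ∃ C : ℝ, 0 < C ∧ ∀ x, B x x ≤ C * (‖x‖ * ‖x‖) := by
  let L := LinearMap.toContinuousBilinearMap B
  refine ⟨‖L‖ + 1, by positivity, fun x => ?_⟩
  have h1 : B x x ≤ ‖L‖ * ‖x‖ * ‖x‖ := (le_abs_self _).trans (L.le_opNorm₂ x x)
  nlinarith [mul_self_nonneg ‖x‖]

/-- On a finite-dimensional space every bilinear form is dominated by a positive definite one. -/
lemma exists_le_of_posDef {V : Type*} [AddCommGroup V] [Module ℝ V] [hV : FiniteDimensional ℝ V]
    (B₁ B₂ : V →ₗ[ℝ] V →ₗ[ℝ] ℝ) (hs : ∀ x y, B₁ x y = B₁ y x) (hn : ∀ x, 0 ≤ B₁ x x)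
    (hd : ∀ x, B₁ x x = 0 → x = 0) : ∃ C : ℝ, 0 < C ∧ ∀ x, B₂ x x ≤ C * B₁ x x := by
  -- `B₁` itself becomes the inner product, so the claim is the boundedness of `B₂` in the norm of
  -- `B₁`.
  let core : InnerProductSpace.Core ℝ V :=
    { inner := fun x y => B₁ x y
      conj_inner_symm := fun x y => by simpa using hs y x
      re_inner_nonneg := fun x => by simpa using hn x
      add_left := fun x y z => by simp
      smul_left := fun x y r => by simp
      definite := hd }
  let N : NormedAddCommGroup V := core.toNormedAddCommGroup
  let I : InnerProductSpace ℝ V := InnerProductSpace.ofCore core.toCore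
  obtain ⟨C, hC, h⟩ := @exists_bilin_le_sq_norm V N I.toNormedSpace hV B₂
  refine ⟨C, hC, fun x => (h x).trans_eq ?_⟩
  rw [← real_inner_self_eq_norm_mul_norm]
  rfl

/-! ### The reference triangle -/

/-- The closed reference triangle. -/
def refTri : Set Pt := {x | 0 ≤ x 0 ∧ 0 ≤ x 1 ∧ x 0 + x 1 ≤ 1}

lemma isClosed_refTri : IsClosed refTri := by
  have h : ∀ i : Fin 2, Continuous fun x : Pt => x i := fun i => by fun_prop
  exact (isClosed_le continuous_const (h 0)).inter ((isClosed_le continuous_const (h 1)).inter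
    (isClosed_le ((h 0).add (h 1)) continuous_const))

lemma isCompact_refTri : IsCompact refTri := by
  refine Metric.isCompact_of_isClosed_isBounded isClosed_refTri ?_
  refine (Metric.isBounded_closedBall (x := (0 : Pt)) (r := 2)).subset fun x hx => ?_
  obtain ⟨h0, h1, h2⟩ := hx
  rw [mem_closedBall_zero_iff, EuclideanSpace.norm_eq]
  refine Real.sqrt_le_iff.2 ⟨by norm_num, ?_⟩
  simp only [Real.norm_eq_abs, sq_abs, Fin.sum_univ_two]
  nlinarith

lemma integrableOn_refTri {f : Pt → ℝ} (hf : Continuous f) : IntegrableOn f refTri :=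
  hf.continuousOn.integrableOn_compact isCompact_refTri

/-! ### Weighted norms of polynomials on the reference triangle -/

/-- The bubble function of the reference triangle. -/
noncomputable def bubble (x : Pt) : ℝ := x 0 * x 1 * (1 - x 0 - x 1)

@[fun_prop]
lemma continuous_bubble : Continuous bubble := by unfold bubble; fun_prop

lemma bubble_nonneg {x : Pt} (hx : x ∈ refTri) : 0 ≤ bubble x :=
  mul_nonneg (mul_nonneg hx.1 hx.2.1) (by linarith [hx.2.2])

/-- A nonnegative continuous integrand with zero integral vanishes on the open triangle, where the
bubble is positive; so `p` vanishes there. -/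
lemma eq_zero_of_integral_bubble {p : MvPolynomial (Fin 2) ℝ}
    (h : ∫ x in refTri, bubble x * (pval p x * pval p x) = 0) : p = 0 := by
  have hc : Continuous fun x => bubble x * (pval p x * pval p x) := by fun_prop
  rw [setIntegral_eq_zero_iff_of_nonneg_ae] at h
  rotate_left
  · exact (ae_restrict_iff' isClosed_refTri.measurableSet).2
      (.of_forall fun x hx => mul_nonneg (bubble_nonneg hx) (mul_self_nonneg _))
  · exact integrableOn_refTri hc
  let U : Set Pt := {x | 0 < x 0 ∧ 0 < x 1 ∧ x 0 + x 1 < 1}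
  have hU : IsOpen U := by
    have h : ∀ i : Fin 2, Continuous fun x : Pt => x i := fun i => by fun_prop
    exact (isOpen_lt continuous_const (h 0)).inter ((isOpen_lt continuous_const (h 1)).inter
      (isOpen_lt ((h 0).add (h 1)) continuous_const))
  have hUs : U ⊆ refTri := fun x hx => ⟨hx.1.le, hx.2.1.le, hx.2.2.le⟩
  have h2 := Measure.eqOn_open_of_ae_eq (ae_restrict_of_ae_restrict_of_subset hUs h) hU
    hc.continuousOn continuousOn_const
  -- The square `(0, 1/2)²` lies in the open triangle and is a product of infinite sets.
  refine MvPolynomial.funext_set (fun _ => Set.Ioo (0 : ℝ) (1 / 2))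
    (fun _ => Set.Ioo_infinite (by norm_num)) fun y hy => ?_
  have h0 := hy 0 trivial
  have h1 := hy 1 trivial
  simp only [Set.mem_Ioo] at h0 h1
  have h3 := h2 (x := WithLp.toLp 2 y)
    (show _ ∧ _ ∧ _ from ⟨by simpa using h0.1, by simpa using h1.1, by
      have : y 0 + y 1 < 1 := by linarith
      simpa using this⟩)
  simp only [bubble, Pi.zero_apply] at h3
  have hb : y 0 * y 1 * (1 - y 0 - y 1) ≠ 0 := by
    have : 0 < 1 - y 0 - y 1 := by linarith
    have := h0.1
    have := h1.1
    positivity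
  rcases mul_eq_zero.1 h3 with h4 | h4
  · exact absurd h4 hb
  · simpa [pval] using h4

/-- Integration of products of polynomials against a continuous weight. -/
noncomputable def weightForm (k : ℕ) (w : Pt → ℝ) (hw : Continuous w) : P k →ₗ[ℝ] P k →ₗ[ℝ] ℝ :=
  LinearMap.mk₂ ℝ (fun p q => ∫ x in refTri, w x * (pval p x * pval q x))
    (fun p q r => by
      rw [← integral_add (integrableOn_refTri (by fun_prop)) (integrableOn_refTri (by fun_prop))]
      congr 1; ext x; simp; ring)
    (fun a p r => by
      rw [smul_eq_mul, ← integral_const_mul]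
      congr 1; ext x; simp [pval]; ring)
    (fun p q r => by
      rw [← integral_add (integrableOn_refTri (by fun_prop)) (integrableOn_refTri (by fun_prop))]
      congr 1; ext x; simp; ring)
    (fun a p r => by
      rw [smul_eq_mul, ← integral_const_mul]
      congr 1; ext x; simp [pval]; ring)

instance (k : ℕ) : FiniteDimensional ℝ (P k) := by unfold P; infer_instance

/-- The final constant depends on `k` only through this one. The bubble lies below all three
barycentric coordinates, so one bound serves all edges. -/
lemma exists_bubble_bound (k : ℕ) : ∃ C : ℝ, 0 < C ∧ ∀ p ∈ P k,
    ∫ x in refTri, pval p x ^ 2 ≤ C * ∫ x in refTri, bubble x * pval p x ^ 2 := by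
  obtain ⟨C, hC, h⟩ := exists_le_of_posDef (weightForm k bubble (by fun_prop))
    (weightForm k (fun _ => 1) (by fun_prop))
    (fun p q => by simp [weightForm, mul_comm])
    (fun p => setIntegral_nonneg isClosed_refTri.measurableSet fun x hx =>
      mul_nonneg (bubble_nonneg hx) (mul_self_nonneg _))
    (fun p hp => by
      ext1
      exact eq_zero_of_integral_bubble hp)
  refine ⟨C, hC, fun p hp => ?_⟩
  simpa [weightForm, sq] using h ⟨p, hp⟩

lemma eq_zero_of_integral_refTri {p : MvPolynomial (Fin 2) ℝ}
    (h : ∫ x in refTri, pval p x ^ 2 ≤ 0) : p = 0 := by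
  refine eq_zero_of_integral_bubble (le_antisymm ?_ ?_)
  · refine le_trans ?_ h
    refine setIntegral_mono_on (integrableOn_refTri (by fun_prop))
      (integrableOn_refTri (by fun_prop)) isClosed_refTri.measurableSet fun x hx => ?_
    obtain ⟨h0, h1, h2⟩ := hx
    rw [sq]
    refine mul_le_of_le_one_left (mul_self_nonneg _) ?_
    unfold bubble
    have a1 : x 0 * x 1 ≤ 1 := by nlinarith
    nlinarith [mul_nonneg h0 h1]
  · exact setIntegral_nonneg isClosed_refTri.measurableSet fun x hx =>
      mul_nonneg (bubble_nonneg hx) (mul_self_nonneg _)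

/-- The triangle is contained in the unit square, where Fubini applies. Used to bound an extension
from an edge by its values on the edge. -/
lemma integral_refTri_coord_le {g : ℝ → ℝ} (hg : Continuous g) (hn : ∀ s, 0 ≤ g s) (j : Fin 2) :
    ∫ x in refTri, g (x j) ≤ ∫ s in (0 : ℝ)..1, g s := by
  let Q : Set (Fin 2 → ℝ) := Set.Icc 0 1
  have e : MeasurePreserving (MeasurableEquiv.toLp 2 (Fin 2 → ℝ)).symm volume volume :=
    EuclideanSpace.volume_preserving_symm_measurableEquiv_toLp (Fin 2)
  have h1 : ∫ x in refTri, g (x j) ≤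
      ∫ x in (MeasurableEquiv.toLp 2 (Fin 2 → ℝ)).symm ⁻¹' Q, g (x j) := by
    refine setIntegral_mono_set ?_ (.of_forall fun x => hn _) (LE.le.eventuallyLE ?_)
    · have hc : Continuous fun x : Fin 2 → ℝ => g (x j) := by fun_prop
      exact (e.integrableOn_comp_preimage (MeasurableEquiv.measurableEmbedding _)).2
        (hc.continuousOn.integrableOn_compact isCompact_Icc)
    · intro x hx
      obtain ⟨a, b, c⟩ := hx
      have a' : x 0 ≤ 1 := by linarith
      have b' : x 1 ≤ 1 := by linarith
      refine ⟨fun i => ?_, fun i => ?_⟩ <;> fin_cases i <;> assumption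
  refine h1.trans_eq ?_
  have h2 := e.setIntegral_preimage_emb (MeasurableEquiv.measurableEmbedding _)
    (fun y : Fin 2 → ℝ => g (y j)) Q
  refine Eq.trans h2 ?_
  have h3 := (volume_preserving_finTwoArrow ℝ).setIntegral_preimage_emb
    (MeasurableEquiv.measurableEmbedding _)
    (fun y : ℝ × ℝ => g (if j = 0 then y.1 else y.2)) (Set.Icc 0 1 ×ˢ Set.Icc 0 1)
  have h4 : (MeasurableEquiv.finTwoArrow : (Fin 2 → ℝ) ≃ᵐ ℝ × ℝ) ⁻¹'
      (Set.Icc 0 1 ×ˢ Set.Icc 0 1) = Q := by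
    ext y
    simp [Q, Set.mem_Icc, Pi.le_def, Fin.forall_fin_two, MeasurableEquiv.finTwoArrow]
  rw [h4] at h3
  have h5 : ∀ y : Fin 2 → ℝ, (if j = 0 then (MeasurableEquiv.finTwoArrow y : ℝ × ℝ).1
      else (MeasurableEquiv.finTwoArrow y : ℝ × ℝ).2) = y j := by
    intro y; fin_cases j <;> simp [MeasurableEquiv.finTwoArrow]
  simp only [h5] at h3
  rw [h3, Measure.volume_eq_prod, intervalIntegral.integral_of_le zero_le_one,
    ← integral_Icc_eq_integral_Ioc]
  by_cases hj : j = 0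
  · have := setIntegral_prod_mul (μ := volume) (ν := volume) g (fun _ => (1 : ℝ))
      (Set.Icc (0 : ℝ) 1) (Set.Icc (0 : ℝ) 1)
    simpa [hj] using this
  · have := setIntegral_prod_mul (μ := volume) (ν := volume) (fun _ => (1 : ℝ)) g
      (Set.Icc (0 : ℝ) 1) (Set.Icc (0 : ℝ) 1)
    simpa [hj] using this

/-! ### Edge integrals -/

lemma edgeSet_mk (a b : Pt) : edgeSet s(a, b) = segment ℝ a b := by
  have : {x | x ∈ s(a, b)} = ({a, b} : Set Pt) := by ext; simp
  rw [edgeSet, this, convexHull_pair]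

lemma lineMap_mem_edgeSet (a b : Pt) {s : ℝ} (hs : s ∈ Set.Icc (0 : ℝ) 1) :
    AffineMap.lineMap a b s ∈ edgeSet s(a, b) := by
  rw [edgeSet_mk, segment_eq_image_lineMap]
  exact ⟨s, hs, rfl⟩

lemma edgeIntegral_mk (f : Pt → ℝ) (a b : Pt) :
    edgeIntegral f s(a, b) = dist a b * ∫ s in (0 : ℝ)..1, f (AffineMap.lineMap a b s) := rfl

lemma edgeLength_mk (a b : Pt) : edgeLength s(a, b) = dist a b := rfl

lemma edgeIntegral_congr {f g : Pt → ℝ} {e : Sym2 Pt} (h : ∀ x ∈ edgeSet e, f x = g x) :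
    edgeIntegral f e = edgeIntegral g e := by
  induction e using Sym2.ind with
  | _ a b =>
    rw [edgeIntegral_mk, edgeIntegral_mk]
    congr 1
    refine intervalIntegral.integral_congr fun s hs => ?_
    rw [Set.uIcc_of_le zero_le_one] at hs
    exact h _ (lineMap_mem_edgeSet a b hs)

lemma edgeIntegral_const_mul (r : ℝ) (f : Pt → ℝ) (e : Sym2 Pt) :
    edgeIntegral (fun x => r * f x) e = r * edgeIntegral f e := by
  induction e using Sym2.ind with
  | _ a b => rw [edgeIntegral_mk, edgeIntegral_mk, intervalIntegral.integral_const_mul]; ring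

lemma edgeIntegral_const (r : ℝ) (e : Sym2 Pt) :
    edgeIntegral (fun _ => r) e = edgeLength e * r := by
  induction e using Sym2.ind with
  | _ a b => simp [edgeIntegral_mk, edgeLength_mk]

lemma edgeIntegral_nonneg {f : Pt → ℝ} (h : ∀ x, 0 ≤ f x) (e : Sym2 Pt) :
    0 ≤ edgeIntegral f e := by
  induction e using Sym2.ind with
  | _ a b =>
    exact mul_nonneg dist_nonneg
      (intervalIntegral.integral_nonneg zero_le_one fun s _ => h _)

lemma edgeIntegral_add {f g : Pt → ℝ} (hf : Continuous f) (hg : Continuous g) (e : Sym2 Pt) :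
    edgeIntegral (fun x => f x + g x) e = edgeIntegral f e + edgeIntegral g e := by
  induction e using Sym2.ind with
  | _ a b =>
    have hl : Continuous fun s : ℝ => (AffineMap.lineMap a b s : Pt) := AffineMap.lineMap_continuous
    have := intervalIntegral.integral_add (μ := volume)
      ((hf.comp hl).intervalIntegrable 0 1) ((hg.comp hl).intervalIntegrable 0 1)
    simp only [Function.comp_apply] at this
    rw [edgeIntegral_mk, edgeIntegral_mk, edgeIntegral_mk, this]
    ring

lemma edgeLength_nonneg (e : Sym2 Pt) : 0 ≤ edgeLength e := by
  induction e using Sym2.ind with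
  | _ a b => exact dist_nonneg (x := a) (y := b)

end SDG

namespace SDG

open MvPolynomial MeasureTheory

/-! ### The dual basis of matrices of a triangle -/

/-- Rotation by a right angle. -/
def perp (n : Fin 2 → ℝ) : Fin 2 → ℝ := ![-n 1, n 0]

lemma frob_self_nonneg (X : Matrix (Fin 2) (Fin 2) ℝ) : 0 ≤ frob X X :=
  Finset.sum_nonneg fun _ _ => Finset.sum_nonneg fun _ _ => mul_self_nonneg _

lemma frob_sq_le (X Y : Matrix (Fin 2) (Fin 2) ℝ) : frob X Y ^ 2 ≤ frob X X * frob Y Y := by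
  have := Finset.sum_mul_sq_le_sq_mul_sq (Finset.univ : Finset (Fin 2 × Fin 2))
    (fun p => X p.1 p.2) (fun p => Y p.1 p.2)
  simpa [frob, Fintype.sum_prod_type, sq] using this

lemma frob_sum_left {ι : Type*} (s : Finset ι) (f : ι → ℝ) (X : ι → Matrix (Fin 2) (Fin 2) ℝ)
    (Y : Matrix (Fin 2) (Fin 2) ℝ) : frob (∑ m ∈ s, f m • X m) Y = ∑ m ∈ s, f m * frob (X m) Y := by
  simp only [frob, Fin.sum_univ_two, Matrix.sum_apply, Matrix.smul_apply, smul_eq_mul,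
    Finset.sum_mul, ← Finset.sum_add_distrib]
  exact Finset.sum_congr rfl fun m _ => by ring

/-- With `Y = ∑ f_m X_m`, apply Cauchy–Schwarz to `Y : Y = ∑ f_m (X_m : Y)`, then to each `X_m : Y`,
and cancel one factor `Y : Y`. -/
lemma frob_sum_self_le (f : Fin 4 → ℝ) (X : Fin 4 → Matrix (Fin 2) (Fin 2) ℝ) {K : ℝ}
    (hK : ∀ m, frob (X m) (X m) ≤ K) :
    frob (∑ m, f m • X m) (∑ m, f m • X m) ≤ 4 * K * ∑ m, f m ^ 2 := by
  set Y := ∑ m, f m • X m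
  have h1 : frob Y Y = ∑ m, f m * frob (X m) Y := frob_sum_left _ _ _ _
  have h2 : (∑ m, f m * frob (X m) Y) ^ 2 ≤ (∑ m, f m ^ 2) * ∑ m, frob (X m) Y ^ 2 :=
    Finset.sum_mul_sq_le_sq_mul_sq _ _ _
  have h3 : ∑ m, frob (X m) Y ^ 2 ≤ ∑ _m : Fin 4, K * frob Y Y := Finset.sum_le_sum fun m _ =>
    (frob_sq_le _ _).trans (mul_le_mul_of_nonneg_right (hK m) (frob_self_nonneg _))
  have hf : 0 ≤ ∑ m, f m ^ 2 := Finset.sum_nonneg fun _ _ => sq_nonneg _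
  have hK0 : 0 ≤ K := (frob_self_nonneg _).trans (hK 0)
  simp only [Finset.sum_const, Finset.card_univ, Fintype.card_fin, nsmul_eq_mul] at h3
  rw [← h1] at h2
  have h4 : frob Y Y ^ 2 ≤ (4 * K * ∑ m, f m ^ 2) * frob Y Y := by
    refine h2.trans ((mul_le_mul_of_nonneg_left h3 hf).trans_eq ?_)
    push_cast; ring
  rcases (frob_self_nonneg Y).eq_or_lt with h0 | h0
  · rw [← h0]; positivity
  · rw [sq] at h4
    exact le_of_mul_le_mul_right h4 h0

lemma frob_vecMulVec_self (a b : Fin 2 → ℝ) :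
    frob (Matrix.vecMulVec a b) (Matrix.vecMulVec a b) = (a ⬝ᵥ a) * (b ⬝ᵥ b) := by
  simp only [frob, Fin.sum_univ_two, Matrix.vecMulVec_apply, dotProduct]; ring

lemma dot_sq_le (a b : Fin 2 → ℝ) : (a ⬝ᵥ b) ^ 2 ≤ (a ⬝ᵥ a) * (b ⬝ᵥ b) := by
  simp only [dotProduct, Fin.sum_univ_two]
  nlinarith [sq_nonneg (a 0 * b 1 - a 1 * b 0)]

/-- The functionals dual to the matrices of a triangle: the two components of the normal trace on
the side, and the tangential components of the normal traces on the two other edges. -/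
def dualFun (n₀ n₁ n₂ : Fin 2 → ℝ) (X : Matrix (Fin 2) (Fin 2) ℝ) : Fin 4 → ℝ :=
  ![(X *ᵥ n₀) 0, (X *ᵥ n₀) 1, perp n₁ ⬝ᵥ (X *ᵥ n₁), perp n₂ ⬝ᵥ (X *ᵥ n₂)]

lemma sum_dualFun_sq_le {n₀ n₁ n₂ : Fin 2 → ℝ} (h₀ : n₀ ⬝ᵥ n₀ = 1) (h₁ : n₁ ⬝ᵥ n₁ = 1)
    (h₂ : n₂ ⬝ᵥ n₂ = 1) (X : Matrix (Fin 2) (Fin 2) ℝ) :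
    ∑ m, dualFun n₀ n₁ n₂ X m ^ 2 ≤ 3 * frob X X := by
  have key : ∀ n : Fin 2 → ℝ, n ⬝ᵥ n = 1 → (X *ᵥ n) 0 ^ 2 + (X *ᵥ n) 1 ^ 2 ≤ frob X X := by
    intro n hn
    have a0 := dot_sq_le (X 0) n
    have a1 := dot_sq_le (X 1) n
    simp only [hn, mul_one] at a0 a1
    refine (add_le_add a0 a1).trans_eq ?_
    simp [frob, dotProduct, Fin.sum_univ_two]
  have key2 : ∀ n : Fin 2 → ℝ, n ⬝ᵥ n = 1 → (perp n ⬝ᵥ (X *ᵥ n)) ^ 2 ≤ frob X X := by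
    intro n hn
    refine (dot_sq_le _ _).trans ?_
    have : perp n ⬝ᵥ perp n = 1 := by
      rw [← hn]; simp only [perp, dotProduct, Fin.sum_univ_two, Matrix.cons_val_zero,
        Matrix.cons_val_one]; ring
    rw [this, one_mul]
    refine le_trans (le_of_eq ?_) (key n hn)
    simp only [dotProduct, Fin.sum_univ_two, sq]
  have a := key n₀ h₀
  have b := key2 n₁ h₁
  have c := key2 n₂ h₂
  simp only [dualFun, Fin.sum_univ_four, Matrix.cons_val]
  linarith

/-- The shape constraints on a triangle with edge vectors `A`, `B` from its first vertex, and unit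
normals `n₀`, `n₁`, `n₂` on the side opposite to that vertex, on `A`, and on `B`. -/
structure Shape (n₀ n₁ n₂ A B : Fin 2 → ℝ) (h κ : ℝ) : Prop where
  h_pos : 0 < h
  κ_pos : 0 < κ
  unit₀ : n₀ ⬝ᵥ n₀ = 1
  unit₁ : n₁ ⬝ᵥ n₁ = 1
  unit₂ : n₂ ⬝ᵥ n₂ = 1
  orth₀ : n₀ ⬝ᵥ (B - A) = 0
  orth₁ : n₁ ⬝ᵥ A = 0
  orth₂ : n₂ ⬝ᵥ B = 0
  len₁ : A ⬝ᵥ A ≤ h ^ 2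
  len₂ : B ⬝ᵥ B ≤ h ^ 2
  len₀ : (B - A) ⬝ᵥ (B - A) ≤ h ^ 2
  height₁ : κ * h ≤ |n₁ ⬝ᵥ B|
  height₂ : κ * h ≤ |n₂ ⬝ᵥ A|

namespace Shape

variable {n₀ n₁ n₂ A B : Fin 2 → ℝ} {h κ : ℝ}

lemma ne₁ (hS : Shape n₀ n₁ n₂ A B h κ) : n₁ ⬝ᵥ B ≠ 0 :=
  abs_pos.1 (lt_of_lt_of_le (mul_pos hS.κ_pos hS.h_pos) hS.height₁)

lemma ne₂ (hS : Shape n₀ n₁ n₂ A B h κ) : n₂ ⬝ᵥ A ≠ 0 :=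
  abs_pos.1 (lt_of_lt_of_le (mul_pos hS.κ_pos hS.h_pos) hS.height₂)

/-- The family is explicit. A matrix `a ⊗ (B - A)` annihilates `n₀`, and `perp n₂ ⬝ perp B = n₂ ⬝ B
= 0`, so `perp B ⊗ (B - A)` is seen only by the third functional; likewise `perp A ⊗ (B - A)` only
by the fourth. -/
lemma exists_matrix_family (hS : Shape n₀ n₁ n₂ A B h κ) :
    ∃ Λ : Fin 4 → Matrix (Fin 2) (Fin 2) ℝ,
      (∀ f : Fin 4 → ℝ, dualFun n₀ n₁ n₂ (∑ m, f m • Λ m) = f) ∧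
      ∀ m, frob (Λ m) (Λ m) ≤ 12 * (1 + 2 * (κ ^ 4)⁻¹) := by
  have hq : ∀ r : ℝ, κ * h ≤ |r| → (r ^ 4)⁻¹ * h ^ 4 ≤ (κ ^ 4)⁻¹ := by
    intro r hr
    have hκ := hS.κ_pos
    have hh := hS.h_pos
    have hr0 : 0 < |r| := lt_of_lt_of_le (mul_pos hκ hh) hr
    have h4 : (κ * h) ^ 4 ≤ r ^ 4 := by
      rw [← Even.pow_abs (by decide : Even 4) r]
      exact pow_le_pow_left₀ (by positivity) hr 4
    have hr4 : 0 < r ^ 4 := lt_of_lt_of_le (by positivity) h4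
    rw [inv_mul_le_iff₀ hr4, ← div_eq_mul_inv, le_div_iff₀ (by positivity)]
    linarith [mul_pow κ h 4]
  have hperp : ∀ u : Fin 2 → ℝ, perp u ⬝ᵥ perp u = u ⬝ᵥ u := by
    intro u
    simp only [perp, dotProduct, Fin.sum_univ_two, Matrix.cons_val_zero, Matrix.cons_val_one]; ring
  obtain ⟨p1, hp1⟩ : ∃ p, p = ((n₁ ⬝ᵥ B) ^ 2)⁻¹ := ⟨_, rfl⟩
  obtain ⟨p2, hp2⟩ : ∃ p, p = ((n₂ ⬝ᵥ A) ^ 2)⁻¹ := ⟨_, rfl⟩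
  -- The nonzero functionals have the values `(n₁ ⬝ B)²` and `-(n₂ ⬝ A)²`, which explains `p1` and
  -- the sign in `-p2`. Edges of length at most `h` and heights at least `κ h` give the squared norm
  -- at most `κ⁻⁴`.
  let M₁ := p1 • Matrix.vecMulVec (perp B) (B - A)
  let M₂ := (-p2) • Matrix.vecMulVec (perp A) (B - A)
  let E : Fin 2 → Matrix (Fin 2) (Fin 2) ℝ := fun i =>
    Matrix.vecMulVec (Pi.single i 1) n₀
  have hfs : ∀ (r : ℝ) (X : Matrix (Fin 2) (Fin 2) ℝ), frob (r • X) (r • X) = r ^ 2 * frob X X := by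
    intro r X
    simp only [frob, Fin.sum_univ_two, Matrix.smul_apply, smul_eq_mul]; ring
  have hM₁ : frob M₁ M₁ ≤ (κ ^ 4)⁻¹ := by
    refine le_trans ?_ (hq _ hS.height₁)
    rw [hfs, frob_vecMulVec_self, hperp]
    have e1 : p1 ^ 2 = ((n₁ ⬝ᵥ B) ^ 4)⁻¹ := by rw [hp1, ← inv_pow]; ring
    rw [e1]
    refine mul_le_mul_of_nonneg_left ?_ (by positivity)
    rw [show h ^ 4 = h ^ 2 * h ^ 2 by ring]
    exact mul_le_mul hS.len₂ hS.len₀ (by simp [dotProduct, Fin.sum_univ_two]; nlinarith)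
      (by positivity)
  have hM₂ : frob M₂ M₂ ≤ (κ ^ 4)⁻¹ := by
    refine le_trans ?_ (hq _ hS.height₂)
    rw [hfs, frob_vecMulVec_self, hperp]
    have e1 : (-p2) ^ 2 = ((n₂ ⬝ᵥ A) ^ 4)⁻¹ := by rw [neg_sq, hp2, ← inv_pow]; ring
    rw [e1]
    refine mul_le_mul_of_nonneg_left ?_ (by positivity)
    rw [show h ^ 4 = h ^ 2 * h ^ 2 by ring]
    exact mul_le_mul hS.len₁ hS.len₀ (by simp [dotProduct, Fin.sum_univ_two]; nlinarith)
      (by positivity)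
  have hE : ∀ i, frob (E i) (E i) = 1 := by
    intro i
    rw [frob_vecMulVec_self, hS.unit₀]
    simp
  -- `E i` has the right trace on the side; subtracting multiples of `M₁` and `M₂` removes its
  -- values under the last two functionals. The fourth slot is padding to fit `frob_sum_self_le`.
  let N : Fin 2 → Matrix (Fin 2) (Fin 2) ℝ := fun i =>
    ∑ m, (![1, -(perp n₁ i * (n₀ ⬝ᵥ n₁)), -(perp n₂ i * (n₀ ⬝ᵥ n₂)), 0] : Fin 4 → ℝ) m •
      (![E i, M₁, M₂, 0] : Fin 4 → Matrix (Fin 2) (Fin 2) ℝ) m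
  have hκ4 : 0 < (κ ^ 4)⁻¹ := by have := hS.κ_pos; positivity
  have hunit : ∀ n : Fin 2 → ℝ, n ⬝ᵥ n = 1 → ∀ i, (perp n i * (n₀ ⬝ᵥ n)) ^ 2 ≤ 1 := by
    intro n hn i
    have h1 := dot_sq_le n₀ n
    rw [hS.unit₀, hn, one_mul] at h1
    have h2 : perp n i ^ 2 ≤ 1 := by
      rw [← hn]
      fin_cases i <;> simp [perp, dotProduct, Fin.sum_univ_two] <;> nlinarith
    rw [mul_pow]
    exact mul_le_one₀ h2 (sq_nonneg _) h1
  have hN : ∀ i, frob (N i) (N i) ≤ 12 * (1 + 2 * (κ ^ 4)⁻¹) := by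
    intro i
    refine (frob_sum_self_le (K := 1 + 2 * (κ ^ 4)⁻¹) _ _ ?_).trans ?_
    · intro m
      fin_cases m
      · show frob (E i) (E i) ≤ _
        rw [hE]; linarith
      · show frob M₁ M₁ ≤ _
        linarith
      · show frob M₂ M₂ ≤ _
        linarith
      · show frob 0 0 ≤ _
        simp only [frob, Matrix.zero_apply, mul_zero, Finset.sum_const_zero]; linarith
    · have a1 := hunit n₁ hS.unit₁ i
      have a2 := hunit n₂ hS.unit₂ i
      have : ∑ m, (![1, -(perp n₁ i * (n₀ ⬝ᵥ n₁)), -(perp n₂ i * (n₀ ⬝ᵥ n₂)), 0] : Fin 4 → ℝ) m ^ 2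
          ≤ 3 := by
        simp only [Fin.sum_univ_four, Matrix.cons_val]
        nlinarith
      nlinarith
  refine ⟨![N 0, N 1, M₁, M₂], fun f => ?_, fun m => ?_⟩
  · have b1 : p1 * (n₁ ⬝ᵥ B) ^ 2 = 1 := hp1 ▸ inv_mul_cancel₀ (pow_ne_zero 2 hS.ne₁)
    have b2 : p2 * (n₂ ⬝ᵥ A) ^ 2 = 1 := hp2 ▸ inv_mul_cancel₀ (pow_ne_zero 2 hS.ne₂)
    obtain ⟨-, -, u0, u1, u2, o0, o1, o2, -, -, -, -, -⟩ := hS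
    -- With the entries in closed form, duality becomes polynomial identities modulo the unit,
    -- orthogonality and normalization relations.
    have hX : ∀ i j, (∑ m, f m • (![N 0, N 1, M₁, M₂] : Fin 4 → Matrix (Fin 2) (Fin 2) ℝ) m) i j =
        ![f 0, f 1] i * n₀ j
        + (f 2 - (perp n₁ ⬝ᵥ ![f 0, f 1]) * (n₀ ⬝ᵥ n₁)) * p1 * (perp B i * (B - A) j)
        - (f 3 - (perp n₂ ⬝ᵥ ![f 0, f 1]) * (n₀ ⬝ᵥ n₂)) * p2 * (perp A i * (B - A) j) := by
      intro i j
      simp only [Fin.sum_univ_four, Matrix.add_apply, Matrix.smul_apply, smul_eq_mul,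
        Matrix.cons_val, N, M₁, M₂, E, Matrix.vecMulVec_apply, Matrix.zero_apply, dotProduct,
        Fin.sum_univ_two, Pi.sub_apply]
      fin_cases i <;> simp [perp] <;> ring
    set X := ∑ m, f m • (![N 0, N 1, M₁, M₂] : Fin 4 → Matrix (Fin 2) (Fin 2) ℝ) m
    clear_value X
    clear hp1 hp2 hN hM₁ hM₂ hE hfs hunit hκ4 hq hperp
    simp only [dotProduct, Fin.sum_univ_two, Pi.sub_apply] at u0 u1 u2 o0 o1 o2 b1 b2 hX
    have r0 : ∀ i, (X *ᵥ n₀) i = ![f 0, f 1] i := by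
      intro i
      simp only [Matrix.mulVec, dotProduct, Fin.sum_univ_two, hX]
      linear_combination (![f 0, f 1] i) * u0 +
        ((f 2 - (perp n₁ 0 * ![f 0, f 1] 0 + perp n₁ 1 * ![f 0, f 1] 1) *
          (n₀ 0 * n₁ 0 + n₀ 1 * n₁ 1)) * p1 * perp B i
        - (f 3 - (perp n₂ 0 * ![f 0, f 1] 0 + perp n₂ 1 * ![f 0, f 1] 1) *
          (n₀ 0 * n₂ 0 + n₀ 1 * n₂ 1)) * p2 * perp A i) * o0
    have r2 : perp n₁ ⬝ᵥ (X *ᵥ n₁) = f 2 := by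
      simp only [Matrix.mulVec, dotProduct, Fin.sum_univ_two, hX]
      simp only [perp, Matrix.cons_val_zero, Matrix.cons_val_one]
      linear_combination (f 2 - (-n₁ 1 * f 0 + n₁ 0 * f 1) * (n₀ 0 * n₁ 0 + n₀ 1 * n₁ 1)) * b1
        + (-(f 2 - (-n₁ 1 * f 0 + n₁ 0 * f 1) * (n₀ 0 * n₁ 0 + n₀ 1 * n₁ 1)) * p1 *
            (n₁ 0 * B 0 + n₁ 1 * B 1)
          - (f 3 - (-n₂ 1 * f 0 + n₂ 0 * f 1) * (n₀ 0 * n₂ 0 + n₀ 1 * n₂ 1)) * p2 *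
            (n₁ 0 * (B 0 - A 0) + n₁ 1 * (B 1 - A 1))) * o1
    have r3 : perp n₂ ⬝ᵥ (X *ᵥ n₂) = f 3 := by
      simp only [Matrix.mulVec, dotProduct, Fin.sum_univ_two, hX]
      simp only [perp, Matrix.cons_val_zero, Matrix.cons_val_one]
      linear_combination (f 3 - (-n₂ 1 * f 0 + n₂ 0 * f 1) * (n₀ 0 * n₂ 0 + n₀ 1 * n₂ 1)) * b2
        + ((f 2 - (-n₁ 1 * f 0 + n₁ 0 * f 1) * (n₀ 0 * n₁ 0 + n₀ 1 * n₁ 1)) * p1 *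
            (n₂ 0 * (B 0 - A 0) + n₂ 1 * (B 1 - A 1))
          - (f 3 - (-n₂ 1 * f 0 + n₂ 0 * f 1) * (n₀ 0 * n₂ 0 + n₀ 1 * n₂ 1)) * p2 *
            (n₂ 0 * A 0 + n₂ 1 * A 1)) * o2
    ext m
    fin_cases m
    · exact r0 0
    · exact r0 1
    · exact r2
    · exact r3
  · fin_cases m
    · exact hN 0
    · exact hN 1
    · show frob M₁ M₁ ≤ _
      linarith
    · show frob M₂ M₂ ≤ _
      linarith

/-- Duality makes the family a basis, so `H = ∑ f_m Λ_m` with `f` the functionals of `H` and `∑ f_m²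
≤ 3 H : H`. Cauchy–Schwarz in `H : H = ∑ f_m (Λ_m : H)` gives the last bound, by which the numbers
`Λ_m : ∇v` control `∇v`. -/
lemma exists_dual (hS : Shape n₀ n₁ n₂ A B h κ) :
    ∃ Λ : Fin 4 → Matrix (Fin 2) (Fin 2) ℝ,
      (∀ f : Fin 4 → ℝ, dualFun n₀ n₁ n₂ (∑ m, f m • Λ m) = f) ∧
      (∀ m, frob (Λ m) (Λ m) ≤ 12 * (1 + 2 * (κ ^ 4)⁻¹)) ∧
      ∀ H, frob H H ≤ 3 * ∑ m, frob (Λ m) H ^ 2 := by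
  obtain ⟨Λ, h1, h2⟩ := hS.exists_matrix_family
  refine ⟨Λ, h1, h2, fun H => ?_⟩
  let T : (Fin 4 → ℝ) →ₗ[ℝ] Matrix (Fin 2) (Fin 2) ℝ := Fintype.linearCombination ℝ Λ
  have hT : ∀ f, T f = ∑ m, f m • Λ m := fun f => by simp [T, Fintype.linearCombination_apply]
  have hinj : Function.Injective T := fun f g hfg => by
    rw [← h1 f, ← h1 g, ← hT, ← hT, hfg]
  have hsurj : Function.Surjective T := by
    refine (LinearMap.injective_iff_surjective_of_finrank_eq_finrank ?_).1 hinj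
    simp [Module.finrank_matrix]
  obtain ⟨f, hf⟩ := hsurj H
  have e1 : frob H H = ∑ m, f m * frob (Λ m) H := by
    conv_lhs => rw [← hf, hT]
    rw [frob_sum_left, ← hT, hf]
  have e2 : ∑ m, f m ^ 2 ≤ 3 * frob H H := by
    have := sum_dualFun_sq_le hS.unit₀ hS.unit₁ hS.unit₂ H
    rwa [← hf, hT, h1, ← hT, hf] at this
  have e3 : (∑ m, f m * frob (Λ m) H) ^ 2 ≤ (∑ m, f m ^ 2) * ∑ m, frob (Λ m) H ^ 2 :=
    Finset.sum_mul_sq_le_sq_mul_sq _ _ _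
  have e4 : 0 ≤ ∑ m, frob (Λ m) H ^ 2 := Finset.sum_nonneg fun _ _ => sq_nonneg _
  rw [← e1] at e3
  rcases (frob_self_nonneg H).eq_or_lt with h0 | h0
  · rw [← h0]; positivity
  · refine le_of_mul_le_mul_right ?_ h0
    nlinarith

end Shape

/-! ### Integration over a triangle -/

/-- The affine map from the reference triangle. -/
noncomputable def refMap (p A B : Pt) (x : Pt) : Pt := p + x 0 • A + x 1 • B

/-- The determinant of two plane vectors. -/
def det₂ (A B : Fin 2 → ℝ) : ℝ := A 0 * B 1 - A 1 * B 0

lemma convexHull_eq_image_refTri (p q r : Pt) :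
    convexHull ℝ {p, q, r} = refMap p (q - p) (r - p) '' refTri := by
  apply Set.Subset.antisymm
  · refine convexHull_min ?_ ?_
    · rintro x (rfl | rfl | rfl)
      · exact ⟨0, by simp [refTri], by simp [refMap]⟩
      · exact ⟨!₂[1, 0], by simp [refTri], by simp [refMap]⟩
      · exact ⟨!₂[0, 1], by simp [refTri], by simp [refMap]⟩
    · rintro _ ⟨x, hx, rfl⟩ _ ⟨y, hy, rfl⟩ a b ha hb hab
      obtain ⟨x0, x1, x2⟩ := hx
      obtain ⟨y0, y1, y2⟩ := hy
      refine ⟨a • x + b • y, ⟨?_, ?_, ?_⟩, ?_⟩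
      · simp; positivity
      · simp; positivity
      · simp; nlinarith
      · ext i
        simp [refMap]
        linear_combination (- p i) * hab
  · rintro _ ⟨x, ⟨x0, x1, x2⟩, rfl⟩
    have := (convex_convexHull ℝ ({p, q, r} : Set Pt)).sum_mem (t := Finset.univ)
      (w := ![1 - x 0 - x 1, x 0, x 1]) (z := ![p, q, r])
      (fun i _ => by fin_cases i <;> simp <;> linarith) (by simp [Fin.sum_univ_three]; ring)
      (fun i _ => subset_convexHull ℝ _ (by fin_cases i <;> simp))
    convert this using 1
    ext i
    simp [refMap, Fin.sum_univ_three]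
    ring

lemma integral_convexHull (p q r : Pt) (hD : det₂ (q - p).ofLp (r - p).ofLp ≠ 0) (f : Pt → ℝ) :
    ∫ x in convexHull ℝ {p, q, r}, f x =
      |det₂ (q - p).ofLp (r - p).ofLp| * ∫ x in refTri, f (refMap p (q - p) (r - p) x) := by
  set A := q - p
  set B := r - p
  let N : Matrix (Fin 2) (Fin 2) ℝ := !![A 0, B 0; A 1, B 1]
  let b := (EuclideanSpace.basisFun (Fin 2) ℝ).toBasis
  let L : Pt →L[ℝ] Pt := LinearMap.toContinuousLinearMap (Matrix.toLin b b N)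
  have hdet : L.det = det₂ A.ofLp B.ofLp := by
    have : LinearMap.det (Matrix.toLin b b N) = N.det := LinearMap.det_toLin b N
    rw [ContinuousLinearMap.det]
    simp only [L, LinearMap.coe_toContinuousLinearMap, this]
    simp [N, Matrix.det_fin_two, det₂]; ring
  have hL : ∀ x, L x = x 0 • A + x 1 • B := by
    intro x
    have h1 : L x = Matrix.toLin b b N x := rfl
    rw [h1, Matrix.toLin_apply]
    ext i
    fin_cases i <;> simp [b, N, Matrix.mulVec, dotProduct, Fin.sum_univ_two] <;> ring
  have hf : ∀ x, refMap p A B x = p + L x := fun x => by rw [hL, refMap, add_assoc]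
  rw [convexHull_eq_image_refTri, integral_image_eq_integral_abs_det_fderiv_smul volume
    isClosed_refTri.measurableSet (f' := fun _ => L), ← integral_const_mul]
  · simp only [hdet, smul_eq_mul, A, B]
  · intro x _
    rw [show refMap p (q - p) (r - p) = fun x => p + L x from funext hf]
    exact (L.hasFDerivAt.const_add p).hasFDerivWithinAt
  · intro x _ y _ hxy
    have e : ∀ i, x 0 * A i + x 1 * B i = y 0 * A i + y 1 * B i := by
      intro i
      have := congrArg (fun z : Pt => z i) hxy
      simp [refMap] at this
      have h' : x 0 * A i + x 1 * B i = y 0 * A i + y 1 * B i := by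
        simp only [A, B, PiLp.sub_apply]; linarith
      exact h'
    have e0 := e 0
    have e1 := e 1
    have d : det₂ A.ofLp B.ofLp ≠ 0 := hD
    simp only [det₂] at d
    ext i
    fin_cases i
    · refine mul_right_cancel₀ d ?_
      simp only [Fin.zero_eta]
      linear_combination B 1 * e0 - B 0 * e1
    · refine mul_right_cancel₀ d ?_
      simp only [Fin.mk_one]
      linear_combination A 0 * e1 - A 1 * e0

end SDG

namespace SDG

open MeasureTheory Filter Topology

namespace MeshData

variable {M : MeshData} {Ω : Set Pt}

/-! ### Barycentric coordinates -/

/-- The vertices of a triangle as an affine basis of the plane. -/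
noncomputable def IsMeshOf.basis (hM : M.IsMeshOf Ω) (τ : M.Tri) : AffineBasis (Fin 3) ℝ Pt :=
  ⟨![M.vc τ, M.va τ, M.vb τ], hM.nondegenerate τ, by
    rw [(hM.nondegenerate τ).affineSpan_eq_top_iff_card_eq_finrank_add_one]
    simp⟩

variable (hM : M.IsMeshOf Ω)
include hM

namespace IsMeshOf

@[simp] lemma basis_zero (τ : M.Tri) : hM.basis τ 0 = M.vc τ := rfl
@[simp] lemma basis_one (τ : M.Tri) : hM.basis τ 1 = M.va τ := rfl
@[simp] lemma basis_two (τ : M.Tri) : hM.basis τ 2 = M.vb τ := rfl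

lemma range_basis (τ : M.Tri) : Set.range (hM.basis τ) = M.triVerts τ := by
  ext x
  simp only [Set.mem_range, Fin.exists_fin_succ, triVerts, Set.mem_insert_iff,
    Set.mem_singleton_iff]
  simp [eq_comm]

lemma triSet_eq (τ : M.Tri) : M.triSet τ = {x | ∀ i, 0 ≤ (hM.basis τ).coord i x} := by
  rw [triSet, ← hM.range_basis, AffineBasis.convexHull_eq_nonneg_coord]

lemma interior_triSet_eq (τ : M.Tri) :
    interior (M.triSet τ) = {x | ∀ i, 0 < (hM.basis τ).coord i x} := by
  rw [triSet, ← hM.range_basis, AffineBasis.interior_convexHull]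

lemma basis_mem (τ : M.Tri) (i : Fin 3) : hM.basis τ i ∈ M.triVerts τ :=
  hM.range_basis τ ▸ Set.mem_range_self i

lemma va_ne_vb (τ : M.Tri) : M.va τ ≠ M.vb τ := fun h =>
  absurd ((hM.basis τ).ind.injective (a₁ := 1) (a₂ := 2) h) (by decide)

lemma vc_ne_va (τ : M.Tri) : M.vc τ ≠ M.va τ := fun h =>
  absurd ((hM.basis τ).ind.injective (a₁ := 0) (a₂ := 1) h) (by decide)

lemma vc_ne_vb (τ : M.Tri) : M.vc τ ≠ M.vb τ := fun h =>
  absurd ((hM.basis τ).ind.injective (a₁ := 0) (a₂ := 2) h) (by decide)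

lemma dot_sub_eq_sum (τ : M.Tri) (n : Fin 2 → ℝ) (x y : Pt) :
    n ⬝ᵥ (x - y).ofLp = ∑ i, (hM.basis τ).coord i x * (n ⬝ᵥ (hM.basis τ i - y).ofLp) := by
  have h1 := (hM.basis τ).linear_combination_coord_eq_self x
  have h2 := (hM.basis τ).sum_coord_apply_eq_one x
  simp only [Fin.sum_univ_three] at h1 h2 ⊢
  have e : ∀ j, x j = (hM.basis τ).coord 0 x * hM.basis τ 0 j + (hM.basis τ).coord 1 x *
      hM.basis τ 1 j + (hM.basis τ).coord 2 x * hM.basis τ 2 j := by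
    intro j
    conv_lhs => rw [← h1]
    simp
  simp only [dotProduct, Fin.sum_univ_two, PiLp.sub_apply]
  rw [e 0, e 1]
  linear_combination (n 0 * y 0 + n 1 * y 1) * h2

/-- A vector orthogonal to both edge vectors is orthogonal to the whole plane, hence zero. If the
determinant vanished, `perp` of the first edge vector would be such a vector. -/
lemma det_ne_zero (τ : M.Tri) : det₂ (M.va τ - M.vc τ).ofLp (M.vb τ - M.vc τ).ofLp ≠ 0 := by
  intro h0
  have key : ∀ n : Fin 2 → ℝ, n ⬝ᵥ (M.va τ - M.vc τ).ofLp = 0 → n ⬝ᵥ (M.vb τ - M.vc τ).ofLp = 0 →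
      n = 0 := by
    intro n h1 h2
    have h3 := hM.dot_sub_eq_sum τ n (M.vc τ + WithLp.toLp 2 n) (M.vc τ)
    simp only [Fin.sum_univ_three, basis_zero, basis_one, basis_two, h1, h2, sub_self] at h3
    have h4 : n 0 * n 0 + n 1 * n 1 = 0 := by
      simpa [dotProduct, Fin.sum_univ_two] using h3
    ext i
    fin_cases i
    · simp; nlinarith [mul_self_nonneg (n 0), mul_self_nonneg (n 1)]
    · simp; nlinarith [mul_self_nonneg (n 0), mul_self_nonneg (n 1)]
  set A := (M.va τ - M.vc τ).ofLp with hA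
  have h1 := key (perp A) (by simp [perp, dotProduct, Fin.sum_univ_two]; ring) (by
    simp only [det₂] at h0
    simp only [perp, dotProduct, Fin.sum_univ_two, Matrix.cons_val_zero, Matrix.cons_val_one]
    linarith)
  refine hM.vc_ne_va τ ?_
  have a0 := congrFun h1 1
  have a1 := congrFun h1 0
  simp [perp, hA] at a0 a1
  ext i
  fin_cases i <;> simp <;> linarith

/-- Both vertex sets have three elements, so they agree; distinct indices would make the nonempty
interior disjoint from itself. -/
lemma ext_of_triVerts_subset {τ τ' : M.Tri} (h : M.triVerts τ ⊆ M.triVerts τ') : τ = τ' := by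
  have hc : ∀ τ : M.Tri, (M.triVerts τ).ncard = 3 := by
    intro τ
    rw [← hM.range_basis, ← Set.image_univ,
      Set.ncard_image_of_injective _ (hM.basis τ).ind.injective]
    simp [Set.ncard_univ]
  have hfin : (M.triVerts τ').Finite := by
    rw [← hM.range_basis]; exact Set.finite_range _
  have h1 := Set.eq_of_subset_of_ncard_le h (by rw [hc, hc]) hfin
  by_contra hne
  have h2 := hM.disjoint τ τ' hne
  rw [triSet, triSet, ← h1, disjoint_self, Set.bot_eq_empty, ← Set.not_nonempty_iff_eq_empty] at h2
  refine h2 ⟨Finset.univ.centroid ℝ (hM.basis τ), ?_⟩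
  rw [← hM.range_basis]
  exact (hM.basis τ).centroid_mem_interior_convexHull

/-- Conformity puts `x` in the hull of the common vertices, and the coordinate of a vertex that is
not common vanishes on that hull. -/
lemma mem_triVerts_of_coord_ne {τ τ' : M.Tri} {x : Pt} (h : x ∈ M.triSet τ) (h' : x ∈ M.triSet τ')
    {i : Fin 3} (hi : (hM.basis τ).coord i x ≠ 0) : hM.basis τ i ∈ M.triVerts τ' := by
  by_contra hc
  have h1 := hM.conforming τ τ' ⟨h, h'⟩
  refine hi ((convexHull_min (t := (hM.basis τ).coord i ⁻¹' {0}) ?_ ?_) h1)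
  · rintro y ⟨hy, hy'⟩
    rw [← hM.range_basis] at hy
    obtain ⟨j, rfl⟩ := hy
    have : i ≠ j := fun hij => hc (hij ▸ hy')
    exact (hM.basis τ).coord_apply_ne this
  · exact (convex_singleton (0 : ℝ)).affine_preimage _

/-! ### Orientation of the edges -/

/-- The affine function `n ⬝ (x - q)` vanishes at two vertices, so it is a multiple `η` of the
coordinate of the third vertex, number `i`; the sign of `η` decides whether `n` points outwards. -/
lemma edge_frame {τ : M.Tri} {q r : Pt} (he : s(q, r) ∈ M.triEdges τ) :
    ∃ (i : Fin 3) (η : ℝ), η ≠ 0 ∧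
      (∀ x, M.normal s(q, r) ⬝ᵥ (x - q).ofLp = (hM.basis τ).coord i x * η) ∧
      (M.sgn τ s(q, r) = 1 ∧ η < 0 ∨ M.sgn τ s(q, r) = -1 ∧ 0 < η) ∧
      ∀ j, j ≠ i → 0 < (hM.basis τ).coord j (midpoint ℝ q r) := by
  have hn := hM.normal_unit τ _ he
  have ho := hM.normal_orth τ _ he
  set n := M.normal s(q, r) with hndef
  obtain ⟨i, j, l, hcov, hij, hil, hjl, hqr⟩ : ∃ i j l : Fin 3, (∀ m, m = i ∨ m = j ∨ m = l) ∧
      i ≠ j ∧ i ≠ l ∧ j ≠ l ∧ (q = hM.basis τ j ∧ r = hM.basis τ l) := by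
    simp only [triEdges, Finset.mem_insert, Finset.mem_singleton, Sym2.eq_iff] at he
    rcases he with (⟨h1, h2⟩ | ⟨h1, h2⟩) | (⟨h1, h2⟩ | ⟨h1, h2⟩) | (⟨h1, h2⟩ | ⟨h1, h2⟩)
    · exact ⟨0, 1, 2, by decide, by decide, by decide, by decide, h1, h2⟩
    · exact ⟨0, 2, 1, by decide, by decide, by decide, by decide, h1, h2⟩
    · exact ⟨2, 0, 1, by decide, by decide, by decide, by decide, h1, h2⟩
    · exact ⟨2, 1, 0, by decide, by decide, by decide, by decide, h1, h2⟩
    · exact ⟨1, 0, 2, by decide, by decide, by decide, by decide, h1, h2⟩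
    · exact ⟨1, 2, 0, by decide, by decide, by decide, by decide, h1, h2⟩
  obtain ⟨hq, hr⟩ := hqr
  have hsum : ∀ f : Fin 3 → ℝ, ∑ m, f m = f i + f j + f l := by
    intro f
    have : (Finset.univ : Finset (Fin 3)) = {i, j, l} := by
      ext m; simpa using hcov m
    rw [this, Finset.sum_insert (by simp [hij, hil]), Finset.sum_insert (by simp [hjl]),
      Finset.sum_singleton, add_assoc]
  have hqq : n ⬝ᵥ (q - q).ofLp = 0 := by simp
  have hrq : n ⬝ᵥ (r - q).ofLp = 0 := ho r (by simp) q (by simp)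
  have hx : ∀ x, n ⬝ᵥ (x - q).ofLp = (hM.basis τ).coord i x * (n ⬝ᵥ (hM.basis τ i - q).ofLp) := by
    intro x
    rw [hM.dot_sub_eq_sum τ n x q, hsum, ← hq, ← hr, hqq, hrq]
    ring
  have hη : n ⬝ᵥ (hM.basis τ i - q).ofLp ≠ 0 := by
    intro h0
    have := hx (q + WithLp.toLp 2 n)
    rw [h0, mul_zero] at this
    simp [hn] at this
  refine ⟨i, _, hη, hx, ?_, ?_⟩
  · have hout : M.IsOutward τ s(q, r) ↔ n ⬝ᵥ (hM.basis τ i - q).ofLp ≤ 0 := by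
      constructor
      · intro h
        exact h _ (hM.basis_mem τ i) q (by simp)
      · intro h x hx' y hy
        have hyq := ho q (by simp) y hy
        have : M.normal s(q, r) ⬝ᵥ (x - y).ofLp = n ⬝ᵥ (x - q).ofLp + n ⬝ᵥ (q - y).ofLp := by
          rw [← dotProduct_add, ← WithLp.ofLp_add, sub_add_sub_cancel]
        rw [this, hyq, add_zero, hx x]
        refine mul_nonpos_of_nonneg_of_nonpos ?_ h
        have : x ∈ M.triSet τ := subset_convexHull ℝ _ hx'
        rw [hM.triSet_eq] at this
        exact this i
    by_cases h : M.IsOutward τ s(q, r)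
    · left
      exact ⟨by simp [sgn, h], lt_of_le_of_ne (hout.1 h) hη⟩
    · right
      exact ⟨by simp [sgn, h], not_le.1 fun h' => h (hout.2 h')⟩
  · intro m hm
    have h1 : (hM.basis τ).coord m (midpoint ℝ q r) =
        midpoint ℝ ((hM.basis τ).coord m q) ((hM.basis τ).coord m r) :=
      AffineMap.map_midpoint _ _ _
    rw [h1, hq, hr, midpoint_eq_smul_add]
    rcases hcov m with rfl | rfl | rfl
    · exact absurd rfl hm
    · simp [AffineBasis.coord_apply_ne, hjl]
    · simp [AffineBasis.coord_apply_ne, hjl.symm]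

omit hM in
lemma sgn_cases (τ : M.Tri) (e : Sym2 Pt) : M.sgn τ e = 1 ∨ M.sgn τ e = -1 := by
  unfold sgn
  split_ifs <;> simp

/-- With equal signs both triangles lie on the same side of the edge, and a small step from its
midpoint along `η n` enters both interiors. -/
lemma sgn_eq_neg {τ τ' : M.Tri} (hne : τ ≠ τ') {e : Sym2 Pt} (he : e ∈ M.triEdges τ)
    (he' : e ∈ M.triEdges τ') : M.sgn τ' e = - M.sgn τ e := by
  induction e using Sym2.ind with
  | _ q r =>
  obtain ⟨i, η, hη, hx, hs, hm⟩ := hM.edge_frame he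
  obtain ⟨i', η', hη', hx', hs', hm'⟩ := hM.edge_frame he'
  by_contra hc
  have hpos : 0 < η * η' := by
    rcases hs with ⟨h1, h2⟩ | ⟨h1, h2⟩ <;> rcases hs' with ⟨h3, h4⟩ | ⟨h3, h4⟩
    · exact mul_pos_of_neg_of_neg h2 h4
    · exact absurd (by rw [h1, h3]) hc
    · exact absurd (by rw [h1, h3, neg_neg]) hc
    · exact mul_pos h2 h4
  have hn := hM.normal_unit τ _ he
  set n := M.normal s(q, r)
  -- Scaling by `η` makes coordinate `i` of this point in `τ` equal to `ε`.
  let x : ℝ → Pt := fun ε => midpoint ℝ q r + ε • (η • WithLp.toLp 2 n)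
  have hxc : Continuous x := by fun_prop
  have hx0 : x 0 = midpoint ℝ q r := by simp [x]
  have hmid : n ⬝ᵥ (midpoint ℝ q r - q).ofLp = 0 := by
    have := hM.normal_orth τ _ he r (by simp) q (by simp)
    rw [midpoint_sub_left]
    rw [WithLp.ofLp_smul, dotProduct_smul, this, smul_zero]
  have hnx : ∀ ε, n ⬝ᵥ (x ε - q).ofLp = ε * η := by
    intro ε
    have : x ε - q = (midpoint ℝ q r - q) + ε • (η • WithLp.toLp 2 n) :=
      add_sub_right_comm _ _ _
    rw [this, WithLp.ofLp_add, dotProduct_add, hmid]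
    simp [hn]
  have ev : ∀ᶠ ε in 𝓝[>] (0 : ℝ), x ε ∈ interior (M.triSet τ) ∧ x ε ∈ interior (M.triSet τ') := by
    have hcoord : ∀ (σ : M.Tri) (j : Fin 3), Continuous fun ε => (hM.basis σ).coord j (x ε) :=
      fun σ j => ((hM.basis σ).coord j).continuous_of_finiteDimensional.comp hxc
    have gen : ∀ (σ : M.Tri) (i : Fin 3), (∀ ε > 0, 0 < (hM.basis σ).coord i (x ε)) →
        (∀ j, j ≠ i → 0 < (hM.basis σ).coord j (midpoint ℝ q r)) →
        ∀ᶠ ε in 𝓝[>] (0 : ℝ), x ε ∈ interior (M.triSet σ) := by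
      intro σ i h1 h2
      rw [hM.interior_triSet_eq]
      simp only [Set.mem_ofPred_eq]
      refine eventually_all.2 fun j => ?_
      by_cases hji : j = i
      · subst hji
        exact eventually_nhdsWithin_of_forall fun ε hε => h1 ε hε
      · refine nhdsWithin_le_nhds ?_
        have h3 := h2 j hji
        rw [← hx0] at h3
        exact (hcoord σ j).continuousAt.eventually (lt_mem_nhds h3)
    refine (gen τ i ?_ hm).and (gen τ' i' ?_ hm')
    · intro ε hε
      have h1 := hx (x ε)
      rw [hnx] at h1
      rw [← mul_right_cancel₀ hη h1]
      exact hε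
    · intro ε hε
      have h1 := hx' (x ε)
      rw [hnx] at h1
      have h2 : (hM.basis τ').coord i' (x ε) * (η' * η') = ε * (η * η') := by
        rw [← mul_assoc, ← h1]; ring
      have h3 : 0 < η' * η' := mul_self_pos.2 hη'
      have h4 : 0 < ε * (η * η') := mul_pos hε hpos
      rw [← h2] at h4
      exact pos_of_mul_pos_left h4 h3.le
  obtain ⟨ε, h1, h2⟩ := ev.exists
  exact Set.disjoint_left.1 (hM.disjoint τ τ' hne) h1 h2

omit hM in
lemma mem_adj {τ : M.Tri} {e : Sym2 Pt} : τ ∈ M.adj e ↔ e ∈ M.triEdges τ := by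
  simp [adj]

/-- Three triangles at an edge would need three pairwise opposite signs. -/
lemma card_adj_le_two (e : Sym2 Pt) : (M.adj e).card ≤ 2 := by
  by_contra! h
  obtain ⟨a, b, c, ha, hb, hc, hab, hac, hbc⟩ := Finset.two_lt_card_iff.1 h
  rw [mem_adj] at ha hb hc
  have h1 := hM.sgn_eq_neg hab ha hb
  have h2 := hM.sgn_eq_neg hac ha hc
  have h3 := hM.sgn_eq_neg hbc hb hc
  rcases sgn_cases a e with h | h <;> rw [h] at h1 h2 <;> rw [h1, h2] at h3 <;> norm_num at h3

/-- The flux of the position vector through the boundary of a triangle is positive. -/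
lemma flux_edge {τ : M.Tri} {p q r : Pt} (he : s(q, r) ∈ M.triEdges τ)
    (hv : M.triVerts τ = {p, q, r}) {D : ℝ} (hD : det₂ (q - p).ofLp (r - p).ofLp = D) (hD0 : D ≠ 0)
    {y : Pt} (hy : y ∈ s(q, r)) :
    M.sgn τ s(q, r) * (edgeLength s(q, r) * (M.normal s(q, r) ⬝ᵥ y.ofLp)) =
      |D| / D * det₂ q.ofLp r.ofLp := by
  have hn := hM.normal_unit τ _ he
  have ho := hM.normal_orth τ _ he
  set n := M.normal s(q, r) with hndef
  have hrq := ho r (by simp) q (by simp)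
  have hyq : n ⬝ᵥ y.ofLp = n ⬝ᵥ q.ofLp := by
    have := ho y hy q (by simp)
    rw [WithLp.ofLp_sub, dotProduct_sub] at this
    linarith
  rw [hyq]
  have hout : M.IsOutward τ s(q, r) ↔ n ⬝ᵥ (p - q).ofLp ≤ 0 := by
    constructor
    · intro h
      exact h p (by simp [hv]) q (by simp)
    · intro h x hx y hy
      rw [hv] at hx
      have hy' := ho q (by simp) y hy
      have hq' : M.normal s(q, r) ⬝ᵥ (x - y).ofLp = n ⬝ᵥ (x - q).ofLp + n ⬝ᵥ (q - y).ofLp := by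
        rw [← dotProduct_add, ← WithLp.ofLp_add, sub_add_sub_cancel]
      rw [hq', hy', add_zero]
      rcases hx with rfl | rfl | rfl
      · exact h
      · simp
      · exact hrq.le
  have hlen : edgeLength s(q, r) = √((q 0 - r 0) ^ 2 + (q 1 - r 1) ^ 2) := by
    rw [edgeLength_mk, EuclideanSpace.dist_eq, Fin.sum_univ_two, Real.dist_eq, Real.dist_eq,
      sq_abs, sq_abs]
  simp only [dotProduct, Fin.sum_univ_two, PiLp.sub_apply, det₂] at hn hrq hout hD ⊢
  -- `r - q = s • perp n`, so `|s|` is the length of the edge; the position of `p` relative to the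
  -- edge fixes the sign of `s` against that of `D`.
  set s := n 0 * (r 1 - q 1) - n 1 * (r 0 - q 0) with hs
  have hs2 : (q 0 - r 0) ^ 2 + (q 1 - r 1) ^ 2 = s ^ 2 := by
    rw [hs]
    linear_combination (-(q 0 - r 0) ^ 2 - (q 1 - r 1) ^ 2) * hn +
      (n 0 * (r 0 - q 0) + n 1 * (r 1 - q 1)) * hrq
  have hsn0 : s * n 0 = r 1 - q 1 := by
    rw [hs]; linear_combination (r 1 - q 1) * hn - n 1 * hrq
  have hsn1 : s * n 1 = -(r 0 - q 0) := by
    rw [hs]; linear_combination -(r 0 - q 0) * hn + n 0 * hrq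
  have hsD : s * (n 0 * (p 0 - q 0) + n 1 * (p 1 - q 1)) = -D := by
    rw [← hD]
    linear_combination (p 0 - q 0) * hsn0 + (p 1 - q 1) * hsn1
  have hlen' : M.sgn τ s(q, r) * edgeLength s(q, r) = |D| / D * s := by
    rw [hlen, hs2, Real.sqrt_sq_eq_abs]
    have hs0 : s ≠ 0 := by
      rintro h0
      rw [h0, zero_mul] at hsD
      exact hD0 (by linarith)
    set z := n 0 * (p 0 - q 0) + n 1 * (p 1 - q 1) with hz
    unfold sgn
    have hD2 : D = -(s * z) := by linarith
    rcases lt_or_gt_of_ne hD0 with hDn | hDp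
    · rw [abs_of_neg hDn]
      rcases lt_or_gt_of_ne hs0 with h1 | h1
      · have : z ≤ 0 := by nlinarith
        rw [if_pos (hout.2 this), abs_of_neg h1]
        field_simp
      · have : ¬ z ≤ 0 := by intro h; nlinarith
        rw [if_neg (fun h => this (hout.1 h)), abs_of_pos h1]
        field_simp
    · rw [abs_of_pos hDp]
      rcases lt_or_gt_of_ne hs0 with h1 | h1
      · have : ¬ z ≤ 0 := by intro h; nlinarith
        rw [if_neg (fun h => this (hout.1 h)), abs_of_neg h1]
        field_simp
      · have : z ≤ 0 := by nlinarith
        rw [if_pos (hout.2 this), abs_of_pos h1]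
        field_simp
  rw [← mul_assoc, hlen', mul_assoc]
  congr 1
  linear_combination q 0 * hsn0 + q 1 * hsn1

lemma edges_ne (τ : M.Tri) : s(M.va τ, M.vb τ) ≠ s(M.vc τ, M.va τ) ∧
    s(M.va τ, M.vb τ) ≠ s(M.vc τ, M.vb τ) ∧ s(M.vc τ, M.va τ) ≠ s(M.vc τ, M.vb τ) := by
  have h1 := hM.va_ne_vb τ
  have h2 := hM.vc_ne_va τ
  have h3 := hM.vc_ne_vb τ
  refine ⟨fun h => ?_, fun h => ?_, fun h => ?_⟩ <;>
    rcases Sym2.eq_iff.1 h with ⟨a, b⟩ | ⟨a, b⟩ <;> simp_all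

lemma sum_triEdges (τ : M.Tri) (f : Sym2 Pt → ℝ) : ∑ e ∈ M.triEdges τ, f e =
    f s(M.va τ, M.vb τ) + f s(M.vc τ, M.va τ) + f s(M.vc τ, M.vb τ) := by
  obtain ⟨h1, h2, h3⟩ := hM.edges_ne τ
  rw [triEdges, Finset.sum_insert (by simp [h1, h2]), Finset.sum_insert (by simp [h3]),
    Finset.sum_singleton, add_assoc]

/-- The three edge determinants add up to `D`, so the flux is `|D|`, twice the area. The choice of
endpoint in `e.out.1` is immaterial, since `n ⬝ y` is constant on an edge. -/
lemma flux_pos (τ : M.Tri) : 0 < ∑ e ∈ M.triEdges τ,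
    M.sgn τ e * (edgeLength e * (M.normal e ⬝ᵥ e.out.1.ofLp)) := by
  have hD0 := hM.det_ne_zero τ
  have hout : ∀ q r : Pt, (s(q, r) : Sym2 Pt).out.1 ∈ s(q, r) := fun q r => Sym2.out_fst_mem _
  set D := det₂ (M.va τ - M.vc τ).ofLp (M.vb τ - M.vc τ).ofLp with hD
  rw [hM.sum_triEdges]
  rw [hM.flux_edge (p := M.vc τ) (D := D) (by simp [triEdges]) (by rfl) hD.symm hD0 (hout _ _),
    hM.flux_edge (p := M.vb τ) (D := D) (by simp [triEdges]) (by
      ext; simp [triVerts]; tauto) (by simp only [hD, det₂, PiLp.sub_apply]; ring) hD0 (hout _ _),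
    -- The last edge is read from `vb` to `vc`, so that all three follow the same orientation and
    -- share the same `D`.
    Sym2.eq_swap,
    hM.flux_edge (p := M.va τ) (q := M.vb τ) (r := M.vc τ) (D := D)
      (by rw [Sym2.eq_swap]; simp [triEdges]) (by
      ext; simp [triVerts]; tauto) (by simp only [hD, det₂, PiLp.sub_apply]; ring) hD0 (hout _ _),
    ← mul_add, ← mul_add]
  have : det₂ (M.va τ).ofLp (M.vb τ).ofLp + det₂ (M.vc τ).ofLp (M.va τ).ofLp +
      det₂ (M.vb τ).ofLp (M.vc τ).ofLp = D := by
    simp only [hD, det₂, PiLp.sub_apply]; ring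
  rw [this, div_mul_cancel₀ _ hD0]
  exact abs_pos.2 hD0

end IsMeshOf

end MeshData

end SDG

namespace SDG

open MeasureTheory Filter Topology

namespace MeshData

variable {M : MeshData} {Ω : Set Pt} (hM : M.IsMeshOf Ω) {ρ c : ℝ} (hR : M.IsRegular ρ c)

namespace IsMeshOf

/-! ### Consequences of regularity -/

lemma isCompact_triSet (τ : M.Tri) : IsCompact (M.triSet τ) :=
  Set.Finite.isCompact_convexHull ℝ (by unfold triVerts; exact Set.toFinite _)

lemma isBounded_cellSet (S : Fin M.numCells) : Bornology.IsBounded (M.cellSet S) :=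
  (isCompact_iUnion fun _ => isCompact_triSet _).isBounded

lemma triSet_subset_cellSet (τ : M.Tri) : M.triSet τ ⊆ M.cellSet τ.1 :=
  Set.subset_iUnion (fun i : Fin (M.numVert τ.1) => M.triSet ⟨τ.1, i⟩) τ.2

lemma mem_cellSet_of_mem_triVerts {τ : M.Tri} {x : Pt} (hx : x ∈ M.triVerts τ) :
    x ∈ M.cellSet τ.1 :=
  triSet_subset_cellSet τ (subset_convexHull ℝ _ hx)

lemma dist_le_diam {τ : M.Tri} {x y : Pt} (hx : x ∈ M.triVerts τ) (hy : y ∈ M.triVerts τ) :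
    dist x y ≤ Metric.diam (M.cellSet τ.1) :=
  Metric.dist_le_diam_of_mem (isBounded_cellSet _) (mem_cellSet_of_mem_triVerts hx)
    (mem_cellSet_of_mem_triVerts hy)

include hM

lemma diam_pos (τ : M.Tri) : 0 < Metric.diam (M.cellSet τ.1) :=
  lt_of_lt_of_le (dist_pos.2 (hM.va_ne_vb τ))
    (dist_le_diam (by simp [triVerts]) (by simp [triVerts]))

lemma exists_tri (S : Fin M.numCells) : ∃ τ : M.Tri, τ.1 = S :=
  ⟨⟨S, ⟨0, by have := hM.three_le S; omega⟩⟩, rfl⟩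

include hR

/-- The cell contains a ball about `ν`. If `ν` is a vertex of `τ`, interior points of `τ` near `ν`
lie in a triangle of the cell, which by conformity is `τ`. This separates dual from primal edges. -/
lemma cell_eq_of_ν_mem (hρ : 0 < ρ) {S : Fin M.numCells} {τ : M.Tri} (h : M.ν S ∈ M.triVerts τ) :
    τ.1 = S := by
  have hball : Metric.ball (M.ν S) (ρ * Metric.diam (M.cellSet S)) ⊆ M.cellSet S := by
    intro y hy
    obtain ⟨σ, rfl⟩ := hM.exists_tri S
    exact (hR.star _ y hy).mem
      ⟨M.vc σ, mem_cellSet_of_mem_triVerts (by simp [triVerts])⟩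
  have hpos : 0 < ρ * Metric.diam (M.cellSet S) := by
    obtain ⟨σ, rfl⟩ := hM.exists_tri S
    exact mul_pos hρ (hM.diam_pos σ)
  have hg : Finset.univ.centroid ℝ (hM.basis τ) ∈ interior (M.triSet τ) := by
    rw [triSet, ← hM.range_basis]
    exact (hM.basis τ).centroid_mem_interior_convexHull
  set g := Finset.univ.centroid ℝ (hM.basis τ)
  rw [hM.interior_triSet_eq] at hg
  have hν : M.ν S ∈ M.triSet τ := subset_convexHull ℝ _ h
  rw [hM.triSet_eq] at hν
  have hcont : Continuous fun ε : ℝ => (AffineMap.lineMap (M.ν S) g ε : Pt) :=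
    AffineMap.lineMap_continuous
  have ev : ∀ᶠ ε in 𝓝[>] (0 : ℝ), AffineMap.lineMap (M.ν S) g ε ∈
      Metric.ball (M.ν S) (ρ * Metric.diam (M.cellSet S)) := by
    refine nhdsWithin_le_nhds (hcont.continuousAt.eventually ?_)
    beta_reduce
    rw [AffineMap.lineMap_apply_zero]
    exact Metric.ball_mem_nhds _ hpos
  have ev2 : ∀ᶠ ε in 𝓝[>] (0 : ℝ), ε ∈ Set.Ioo (0 : ℝ) 1 := Ioo_mem_nhdsGT one_pos
  obtain ⟨ε, h1, h2⟩ := (ev.and ev2).exists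
  have h3 : ∀ i, 0 < (hM.basis τ).coord i (AffineMap.lineMap (M.ν S) g ε) := by
    intro i
    rw [AffineMap.apply_lineMap, AffineMap.lineMap_apply_ring']
    have := hg i
    have := hν i
    nlinarith [h2.1, h2.2]
  obtain ⟨j, hj⟩ := Set.mem_iUnion.1 (hball h1)
  have h4 : AffineMap.lineMap (M.ν S) g ε ∈ M.triSet τ := by
    rw [hM.triSet_eq]; exact fun i => (h3 i).le
  have h5 : M.triVerts τ ⊆ M.triVerts ⟨S, j⟩ := by
    rw [← hM.range_basis]
    rintro _ ⟨i, rfl⟩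
    exact hM.mem_triVerts_of_coord_ne h4 hj (h3 i).ne'
  rw [hM.ext_of_triVerts_subset h5]

lemma dual_ne_primal (hρ : 0 < ρ) (τ τ' : M.Tri) (p : Pt) :
    s(M.vc τ, p) ≠ s(M.va τ', M.vb τ') := by
  intro h
  have h1 : M.vc τ = M.va τ' ∨ M.vc τ = M.vb τ' := by
    rcases Sym2.eq_iff.1 h with ⟨a, -⟩ | ⟨a, -⟩
    exacts [.inl a, .inr a]
  have h2 : τ'.1 = τ.1 := hM.cell_eq_of_ν_mem hR hρ (τ := τ') (S := τ.1) (by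
    show M.vc τ ∈ _
    rcases h1 with h1 | h1 <;> simp [h1, triVerts])
  have h3 : M.vc τ' = M.vc τ := by simp [vc, h2]
  rcases h1 with h1 | h1
  · exact hM.vc_ne_va τ' (h3.trans h1)
  · exact hM.vc_ne_vb τ' (h3.trans h1)

lemma eq_of_mem_Fu (hρ : 0 < ρ) {e : Sym2 Pt} (he : e ∈ M.Fu) {τ : M.Tri} (hτ : τ ∈ M.adj e) :
    e = s(M.va τ, M.vb τ) := by
  simp only [Fu, Finset.mem_image, Finset.mem_univ, true_and] at he
  obtain ⟨τ', rfl⟩ := he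
  rw [mem_adj] at hτ
  simp only [triEdges, Finset.mem_insert, Finset.mem_singleton] at hτ
  rcases hτ with h | h | h
  · exact h
  · exact absurd h.symm (hM.dual_ne_primal hR hρ _ _ _)
  · exact absurd h.symm (hM.dual_ne_primal hR hρ _ _ _)

lemma eq_of_mem_Fp (hρ : 0 < ρ) {e : Sym2 Pt} (he : e ∈ M.Fp) {τ : M.Tri} (hτ : τ ∈ M.adj e) :
    e = s(M.vc τ, M.va τ) ∨ e = s(M.vc τ, M.vb τ) := by
  simp only [Fp, Finset.mem_image, Finset.mem_univ, true_and] at he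
  obtain ⟨τ', rfl⟩ := he
  rw [mem_adj] at hτ
  simp only [triEdges, Finset.mem_insert, Finset.mem_singleton] at hτ
  rcases hτ with h | h | h
  · exact absurd h (hM.dual_ne_primal hR hρ _ _ _)
  · exact .inl h
  · exact .inr h

omit hR

omit hM in
lemma vb_edge_mem_Fp (τ : M.Tri) : s(M.vc τ, M.vb τ) ∈ M.Fp := by
  simp only [Fp, Finset.mem_image, Finset.mem_univ, true_and]
  exact ⟨⟨τ.1, finRotate _ τ.2⟩, rfl⟩

omit hM in
lemma va_edge_mem_Fp (τ : M.Tri) : s(M.vc τ, M.va τ) ∈ M.Fp := by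
  simp only [Fp, Finset.mem_image, Finset.mem_univ, true_and]
  exact ⟨τ, rfl⟩

omit hM in
lemma side_mem_Fu (τ : M.Tri) : s(M.va τ, M.vb τ) ∈ M.Fu := by
  simp only [Fu, Finset.mem_image, Finset.mem_univ, true_and]
  exact ⟨τ, rfl⟩

/-- A dual edge belongs to exactly two triangles, on its two sides. -/
lemma adj_eq_pair {e : Sym2 Pt} (he : e ∈ M.Fp) : ∃ τ τ' : M.Tri, τ ≠ τ' ∧
    M.sgn τ' e = - M.sgn τ e ∧ ∀ σ, σ ∈ M.adj e ↔ σ = τ ∨ σ = τ' := by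
  simp only [Fp, Finset.mem_image, Finset.mem_univ, true_and] at he
  obtain ⟨τ, rfl⟩ := he
  -- The neighbour across the dual edge is the cyclic predecessor in the cell.
  let τ' : M.Tri := ⟨τ.1, (finRotate _).symm τ.2⟩
  have hvb : M.vb τ' = M.va τ := by
    show M.vertex τ.1 (finRotate _ ((finRotate _).symm τ.2)) = M.vertex τ.1 τ.2
    rw [Equiv.apply_symm_apply]
  have hvc : M.vc τ' = M.vc τ := rfl
  have hne : τ ≠ τ' := by
    intro h
    refine hM.va_ne_vb τ' ?_
    rw [hvb, ← h]
  have h1 : τ ∈ M.adj s(M.vc τ, M.va τ) := by simp [mem_adj, triEdges]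
  have h2 : τ' ∈ M.adj s(M.vc τ, M.va τ) := by simp [mem_adj, triEdges, hvb, hvc]
  have hs := hM.sgn_eq_neg hne (mem_adj.1 h1) (mem_adj.1 h2)
  refine ⟨τ, τ', hne, hs, fun σ => ⟨fun hσ => ?_, ?_⟩⟩
  · by_contra! hc
    have a := hM.sgn_eq_neg hc.1.symm (mem_adj.1 h1) (mem_adj.1 hσ)
    have b := hM.sgn_eq_neg hc.2.symm (mem_adj.1 h2) (mem_adj.1 hσ)
    rw [a, hs] at b
    rcases sgn_cases τ s(M.vc τ, M.va τ) with h | h <;> rw [h] at b <;> norm_num at b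
  · rintro (rfl | rfl) <;> assumption

/-- This is what makes single-valued quantities on dual edges have zero jump: dual edges are never
on the boundary. -/
lemma sum_sgn_eq_zero {e : Sym2 Pt} (he : e ∈ M.Fp) : ∑ τ ∈ M.adj e, M.sgn τ e = 0 := by
  classical
  obtain ⟨τ, τ', hne, hs, h⟩ := hM.adj_eq_pair he
  have : M.adj e = {τ, τ'} := by ext σ; simpa using h σ
  rw [this, Finset.sum_pair hne, hs, add_neg_cancel]

include hR

/-- The distance from the interior point of a cell to the line of a side. -/
lemma height_side (τ : M.Tri) : ρ * Metric.diam (M.cellSet τ.1) ≤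
    |M.normal s(M.va τ, M.vb τ) ⬝ᵥ (M.va τ - M.vc τ).ofLp| := by
  by_contra! hlt
  have he : s(M.va τ, M.vb τ) ∈ M.triEdges τ := by simp [triEdges]
  have hn := hM.normal_unit τ _ he
  have ho := hM.normal_orth τ _ he
  set n := M.normal s(M.va τ, M.vb τ)
  set δ := n ⬝ᵥ (M.va τ - M.vc τ).ofLp with hδ
  have hba := ho (M.vb τ) (by simp) (M.va τ) (by simp)
  have hx : ∀ x, n ⬝ᵥ (x - M.va τ).ofLp = (hM.basis τ).coord 0 x * -δ := by
    intro x
    have h1 : n ⬝ᵥ (M.vc τ - M.va τ).ofLp = -δ := by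
      rw [hδ, ← dotProduct_neg, ← WithLp.ofLp_neg, neg_sub]
    rw [hM.dot_sub_eq_sum τ n x (M.va τ), Fin.sum_univ_three, basis_zero, basis_one, basis_two,
      hba, h1]
    simp
  have hδ0 : δ ≠ 0 := by
    intro h0
    have := hx (M.va τ + WithLp.toLp 2 n)
    rw [h0] at this
    simp [hn] at this
  obtain ⟨s, hs1, hs2⟩ := exists_between hlt
  have hs0 : 0 < s := (abs_nonneg _).trans_lt hs1
  -- A point of the ball just beyond the line of the side: its distance `s` from `ν` lies between
  -- `|δ|` and `ρ h_S`.
  let y : Pt := M.vc τ + (s / |δ| * δ) • WithLp.toLp 2 n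
  have hnorm : ‖(WithLp.toLp 2 n : Pt)‖ = 1 := by
    rw [EuclideanSpace.norm_eq, Real.sqrt_eq_one]
    simpa [dotProduct, sq] using hn
  have hδ1 : 0 < |δ| := abs_pos.2 hδ0
  have hy : y ∈ Metric.ball (M.vc τ) (ρ * Metric.diam (M.cellSet τ.1)) := by
    rw [mem_ball_iff_norm]
    simp only [y, add_sub_cancel_left, norm_smul, hnorm, mul_one, Real.norm_eq_abs, abs_mul,
      abs_div, abs_abs]
    rw [div_mul_cancel₀ _ hδ1.ne', abs_of_pos hs0]
    exact hs2
  have hstar := hR.star τ.1 y hy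
  have hy0 : (hM.basis τ).coord 0 y < 0 := by
    have h1 := hx y
    have h2 : n ⬝ᵥ (y - M.va τ).ofLp = s / |δ| * δ - δ := by
      have : y - M.va τ = (s / |δ| * δ) • WithLp.toLp 2 n - (M.va τ - M.vc τ) := by
        simp only [y]; abel
      rw [this, WithLp.ofLp_sub, dotProduct_sub]
      simp [hn, hδ]
    rw [h2] at h1
    have h3 : s / |δ| - 1 = - (hM.basis τ).coord 0 y :=
      mul_right_cancel₀ hδ0 (by linarith)
    have h4 : 1 < s / |δ| := (one_lt_div hδ1).2 hs1
    linarith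
  set m := midpoint ℝ (M.va τ) (M.vb τ) with hm
  have hcm : ∀ i, (hM.basis τ).coord i m = midpoint ℝ ((hM.basis τ).coord i (hM.basis τ 1))
      ((hM.basis τ).coord i (hM.basis τ 2)) := fun i => AffineMap.map_midpoint _ _ _
  have hm0 : (hM.basis τ).coord 0 m = 0 := by
    rw [hcm, AffineBasis.coord_apply_ne _ (by decide), AffineBasis.coord_apply_ne _ (by decide)]
    simp
  have hm1 : (hM.basis τ).coord 1 m = 2⁻¹ := by
    rw [hcm, AffineBasis.coord_apply_eq, AffineBasis.coord_apply_ne _ (by decide),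
      midpoint_eq_smul_add]
    simp
  have hm2 : (hM.basis τ).coord 2 m = 2⁻¹ := by
    rw [hcm, AffineBasis.coord_apply_eq, AffineBasis.coord_apply_ne _ (by decide),
      midpoint_eq_smul_add]
    simp
  have hmτ : m ∈ M.triSet τ := by
    rw [hM.triSet_eq]
    intro i
    fin_cases i
    · exact hm0.ge
    · show 0 ≤ (hM.basis τ).coord 1 m
      rw [hm1]; norm_num
    · show 0 ≤ (hM.basis τ).coord 2 m
      rw [hm2]; norm_num
  have hmS := triSet_subset_cellSet τ hmτ
  -- The segment from the midpoint `m` of the side to `y` stays in the cell but leaves `τ` at once,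
  -- so it runs in `R`; as `R` is closed, it contains `m`.
  let R : Set Pt := ⋃ i ∈ {i : Fin (M.numVert τ.1) | i ≠ τ.2}, M.triSet ⟨τ.1, i⟩
  have hRc : IsClosed R :=
    (Set.toFinite _).isClosed_biUnion fun i _ => (isCompact_triSet _).isClosed
  have hline : ∀ ε ∈ Set.Ioc (0 : ℝ) 1, AffineMap.lineMap m y ε ∈ R := by
    intro ε hε
    have h1 : AffineMap.lineMap m y ε ∈ M.cellSet τ.1 := by
      have := starConvex_iff_segment_subset.1 hstar hmS
      refine this ?_
      rw [segment_symm, segment_eq_image_lineMap]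
      exact ⟨ε, ⟨hε.1.le, hε.2⟩, rfl⟩
    obtain ⟨i, hi⟩ := Set.mem_iUnion.1 h1
    refine Set.mem_biUnion (x := i) ?_ hi
    rintro rfl
    rw [show (⟨τ.1, τ.2⟩ : M.Tri) = τ from rfl, hM.triSet_eq] at hi
    have h2 := hi 0
    rw [AffineMap.apply_lineMap, AffineMap.lineMap_apply_ring', hm0] at h2
    nlinarith [hε.1]
  have hmR : m ∈ R := by
    have hcont : Continuous fun ε : ℝ => (AffineMap.lineMap m y ε : Pt) :=
      AffineMap.lineMap_continuous
    have ht : Tendsto (fun ε : ℝ => (AffineMap.lineMap m y ε : Pt)) (𝓝[>] 0) (𝓝 m) := by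
      have := hcont.tendsto 0
      rw [AffineMap.lineMap_apply_zero] at this
      exact this.mono_left nhdsWithin_le_nhds
    refine hRc.mem_of_tendsto ht ?_
    filter_upwards [Ioc_mem_nhdsGT (one_pos : (0 : ℝ) < 1)] with ε hε using hline ε hε
  obtain ⟨i, hi, hmi⟩ := Set.mem_iUnion₂.1 hmR
  -- Another triangle of the cell contains `m`, hence has both endpoints of the side as vertices; it
  -- also has `ν`, so it is `τ`, a contradiction.
  have ha : M.va τ ∈ M.triVerts ⟨τ.1, i⟩ :=
    hM.mem_triVerts_of_coord_ne hmτ hmi (i := 1) (by rw [hm1]; norm_num)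
  have hb : M.vb τ ∈ M.triVerts ⟨τ.1, i⟩ :=
    hM.mem_triVerts_of_coord_ne hmτ hmi (i := 2) (by rw [hm2]; norm_num)
  have hsub : M.triVerts τ ⊆ M.triVerts ⟨τ.1, i⟩ := by
    rintro x (rfl | rfl | rfl)
    · exact Or.inl rfl
    · exact ha
    · exact hb
  have := hM.ext_of_triVerts_subset hsub
  exact hi (eq_of_heq (Sigma.mk.inj_iff.1 (this : (⟨τ.1, τ.2⟩ : M.Tri) = ⟨τ.1, i⟩)).2).symm

omit hM hR in
lemma dot_self_eq_dist_sq (x y : Pt) : (x - y).ofLp ⬝ᵥ (x - y).ofLp = dist x y ^ 2 := by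
  rw [EuclideanSpace.dist_eq, Real.sq_sqrt (Finset.sum_nonneg fun _ _ => sq_nonneg _)]
  simp [dotProduct, Fin.sum_univ_two, Real.dist_eq, sq_abs, ← sq]

omit hM hR in
-- `u` is a multiple of `perp n`: height times base is twice the area.
lemma sq_dot_mul_dot {n u w : Fin 2 → ℝ} (hn : n ⬝ᵥ n = 1) (hu : n ⬝ᵥ u = 0) :
    (n ⬝ᵥ w) ^ 2 * (u ⬝ᵥ u) = det₂ u w ^ 2 := by
  simp only [dotProduct, Fin.sum_univ_two, det₂] at *
  have e0 : u 0 = -(n 0 * u 1 - n 1 * u 0) * n 1 := by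
    linear_combination -u 0 * hn + n 0 * hu
  have e1 : u 1 = (n 0 * u 1 - n 1 * u 0) * n 0 := by
    linear_combination -u 1 * hn + n 1 * hu
  generalize n 0 * u 1 - n 1 * u 0 = s at e0 e1
  rw [e0, e1]
  linear_combination s ^ 2 * (n 0 * w 0 + n 1 * w 1) ^ 2 * hn

/-- The triangles of a regular mesh satisfy the shape constraints. -/
lemma shape (hρ : 0 < ρ) (hc : 0 < c) (τ : M.Tri) :
    Shape (M.normal s(M.va τ, M.vb τ)) (M.normal s(M.vc τ, M.va τ)) (M.normal s(M.vc τ, M.vb τ))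
      (M.va τ - M.vc τ).ofLp (M.vb τ - M.vc τ).ofLp (Metric.diam (M.cellSet τ.1)) (ρ * c) := by
  have hh := hM.diam_pos τ
  have he0 : s(M.va τ, M.vb τ) ∈ M.triEdges τ := by simp [triEdges]
  have he1 : s(M.vc τ, M.va τ) ∈ M.triEdges τ := by simp [triEdges]
  have he2 : s(M.vc τ, M.vb τ) ∈ M.triEdges τ := by simp [triEdges]
  have u0 := hM.normal_unit τ _ he0
  have u1 := hM.normal_unit τ _ he1
  have u2 := hM.normal_unit τ _ he2
  have hBA : (M.vb τ - M.vc τ).ofLp - (M.va τ - M.vc τ).ofLp = (M.vb τ - M.va τ).ofLp := by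
    rw [← WithLp.ofLp_sub, sub_sub_sub_cancel_right]
  have o0 := hM.normal_orth τ _ he0 (M.vb τ) (by simp) (M.va τ) (by simp)
  have o1 := hM.normal_orth τ _ he1 (M.va τ) (by simp) (M.vc τ) (by simp)
  have o2 := hM.normal_orth τ _ he2 (M.vb τ) (by simp) (M.vc τ) (by simp)
  have hH := hM.height_side hR τ
  have hside := hR.side τ
  have l0 : dist (M.vb τ) (M.va τ) ≤ Metric.diam (M.cellSet τ.1) :=
    dist_le_diam (by simp [triVerts]) (by simp [triVerts])
  have l1 : dist (M.va τ) (M.vc τ) ≤ Metric.diam (M.cellSet τ.1) :=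
    dist_le_diam (by simp [triVerts]) (by simp [triVerts])
  have l2 : dist (M.vb τ) (M.vc τ) ≤ Metric.diam (M.cellSet τ.1) :=
    dist_le_diam (by simp [triVerts]) (by simp [triVerts])
  rw [dist_comm] at hside
  set h := Metric.diam (M.cellSet τ.1)
  have d0 := sq_dot_mul_dot u0 o0 (w := (M.va τ - M.vc τ).ofLp)
  have d1 := sq_dot_mul_dot u1 o1 (w := (M.vb τ - M.vc τ).ofLp)
  have d2 := sq_dot_mul_dot u2 o2 (w := (M.va τ - M.vc τ).ofLp)
  rw [dot_self_eq_dist_sq] at d0 d1 d2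
  -- Twice the area is at least height `ρ h` times side `c h`. Dividing by a dual edge of length at
  -- most `h` bounds the other two heights below by `ρ c h`.
  have hD : (ρ * h) ^ 2 * (c * h) ^ 2 ≤ det₂ (M.vb τ - M.va τ).ofLp (M.va τ - M.vc τ).ofLp ^ 2 := by
    rw [← d0]
    refine mul_le_mul ?_ (pow_le_pow_left₀ (by positivity) hside 2) (by positivity) (by positivity)
    rw [← sq_abs (_ ⬝ᵥ _)]
    exact pow_le_pow_left₀ (by positivity) hH 2
  have hdet1 : det₂ (M.vb τ - M.va τ).ofLp (M.va τ - M.vc τ).ofLp =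
      -det₂ (M.va τ - M.vc τ).ofLp (M.vb τ - M.vc τ).ofLp := by
    simp only [det₂, PiLp.sub_apply]; ring
  have hdet2 : det₂ (M.vb τ - M.va τ).ofLp (M.va τ - M.vc τ).ofLp =
      det₂ (M.vb τ - M.vc τ).ofLp (M.va τ - M.vc τ).ofLp := by
    simp only [det₂, PiLp.sub_apply]; ring
  have fin : ∀ t l : ℝ, 0 ≤ l → l ≤ h →
      det₂ (M.vb τ - M.va τ).ofLp (M.va τ - M.vc τ).ofLp ^ 2 = t ^ 2 * l ^ 2 →
      ρ * c * h ≤ |t| := by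
    intro t l hl0 hl ht
    rw [ht] at hD
    have h1 : t ^ 2 * l ^ 2 ≤ t ^ 2 * h ^ 2 :=
      mul_le_mul_of_nonneg_left (pow_le_pow_left₀ hl0 hl 2) (sq_nonneg _)
    have h2 : (ρ * c * h) ^ 2 * h ^ 2 ≤ t ^ 2 * h ^ 2 := by
      refine le_trans (le_of_eq ?_) (hD.trans h1); ring
    have h3 := le_of_mul_le_mul_right h2 (by positivity)
    exact (le_abs_self _).trans (sq_le_sq.1 h3)
  exact
    { h_pos := hh
      κ_pos := mul_pos hρ hc
      unit₀ := u0
      unit₁ := u1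
      unit₂ := u2
      orth₀ := by rw [hBA]; exact o0
      orth₁ := o1
      orth₂ := o2
      len₁ := by rw [dot_self_eq_dist_sq]; exact pow_le_pow_left₀ dist_nonneg l1 2
      len₂ := by rw [dot_self_eq_dist_sq]; exact pow_le_pow_left₀ dist_nonneg l2 2
      len₀ := by rw [hBA, dot_self_eq_dist_sq]; exact pow_le_pow_left₀ dist_nonneg l0 2
      height₁ := fin _ _ dist_nonneg l1 (by rw [d1, hdet1, neg_sq])
      height₂ := fin _ _ dist_nonneg l2 (by rw [d2, hdet2]) }

end IsMeshOf

end MeshData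

end SDG

namespace SDG

open MvPolynomial MeasureTheory

lemma pval_grad (p : Fin 2 → MvPolynomial (Fin 2) ℝ) (x : Pt) (i j : Fin 2) :
    mval (grad p) x i j = pval (pderiv j (p i)) x := rfl

lemma continuous_frob_mval (p q : Matrix (Fin 2) (Fin 2) (MvPolynomial (Fin 2) ℝ)) :
    Continuous fun x => frob (mval p x) (mval q x) := by
  simp only [frob, mval, Matrix.of_apply]
  fun_prop

/-- The polynomial whose values are those of an affine function. -/
noncomputable def affineMapPoly (f : Pt →ᵃ[ℝ] ℝ) : MvPolynomial (Fin 2) ℝ :=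
  affinePoly (f 0) fun j => f.linear (EuclideanSpace.single j 1)

lemma pval_affineMapPoly (f : Pt →ᵃ[ℝ] ℝ) (x : Pt) : pval (affineMapPoly f) x = f x := by
  have h1 : f x = f.linear x + f 0 := by simpa using f.map_vadd 0 x
  have h2 : x = x 0 • EuclideanSpace.single 0 (1 : ℝ) + x 1 • EuclideanSpace.single 1 (1 : ℝ) := by
    ext i; fin_cases i <;> simp
  rw [affineMapPoly, pval_affinePoly, h1]
  conv_rhs => rw [h2]
  simp only [dotProduct, Fin.sum_univ_two, map_add, map_smul, smul_eq_mul]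
  ring

namespace MeshData

variable {M : MeshData} {Ω : Set Pt} (hM : M.IsMeshOf Ω)

/-! ### Pullback to the reference triangle -/

/-- The affine map from the reference triangle to a triangle of the mesh. -/
noncomputable def param (M : MeshData) (τ : M.Tri) (x : Pt) : Pt :=
  refMap (M.vc τ) (M.va τ - M.vc τ) (M.vb τ - M.vc τ) x

/-- The Jacobian of `param`. -/
noncomputable def jac (M : MeshData) (τ : M.Tri) : ℝ :=
  |det₂ (M.va τ - M.vc τ).ofLp (M.vb τ - M.vc τ).ofLp|

/-- The pullback of a polynomial to the reference triangle. -/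
noncomputable def pullback (M : MeshData) (τ : M.Tri) (p : MvPolynomial (Fin 2) ℝ) :
    MvPolynomial (Fin 2) ℝ :=
  bind₁ (fun i => affinePoly (M.vc τ i) ![(M.va τ - M.vc τ) i, (M.vb τ - M.vc τ) i]) p

lemma pval_pullback (τ : M.Tri) (p : MvPolynomial (Fin 2) ℝ) (x : Pt) :
    pval (M.pullback τ p) x = pval p (M.param τ x) := by
  refine pval_bind₁ _ _ _ _ fun i => ?_
  rw [pval_affinePoly]
  simp [param, refMap, dotProduct, Fin.sum_univ_two]
  ring

lemma pullback_mem {k : ℕ} {p : MvPolynomial (Fin 2) ℝ} (hp : p ∈ P k) (τ : M.Tri) :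
    M.pullback τ p ∈ P k := bind₁_mem hp fun _ => affinePoly_mem _ _

namespace IsMeshOf

lemma integrableOn_triSet {f : Pt → ℝ} (hf : Continuous f) (τ : M.Tri) :
    IntegrableOn f (M.triSet τ) :=
  hf.continuousOn.integrableOn_compact (isCompact_triSet τ)

include hM

lemma jac_pos (τ : M.Tri) : 0 < M.jac τ := abs_pos.2 (hM.det_ne_zero τ)

lemma integral_triSet (τ : M.Tri) (f : Pt → ℝ) :
    ∫ x in M.triSet τ, f x = M.jac τ * ∫ x in refTri, f (M.param τ x) :=
  integral_convexHull _ _ _ (hM.det_ne_zero τ) f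

lemma coord_param (τ : M.Tri) (x : Pt) : (hM.basis τ).coord 0 (M.param τ x) = 1 - x 0 - x 1 ∧
    (hM.basis τ).coord 1 (M.param τ x) = x 0 ∧ (hM.basis τ).coord 2 (M.param τ x) = x 1 := by
  have key : ∀ f : Pt →ᵃ[ℝ] ℝ, f (M.param τ x) = f (M.vc τ) + x 0 * (f (M.va τ) - f (M.vc τ)) +
      x 1 * (f (M.vb τ) - f (M.vc τ)) := by
    intro f
    have h1 : M.param τ x = (x 0 • (M.va τ - M.vc τ) + x 1 • (M.vb τ - M.vc τ)) +ᵥ M.vc τ := by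
      simp only [param, refMap, vadd_eq_add]; abel
    have h2 : ∀ p q : Pt, f.linear (p - q) = f p - f q := fun p q => f.linearMap_vsub p q
    rw [h1, f.map_vadd, map_add, map_smul, map_smul, h2, h2]
    simp only [smul_eq_mul, vadd_eq_add]; ring
  have hb : ∀ i j, (hM.basis τ).coord i (hM.basis τ j) = if i = j then 1 else 0 :=
    fun i j => AffineBasis.coord_apply _ i j
  have h0 := fun i => hb i 0
  have h1 := fun i => hb i 1
  have h2 := fun i => hb i 2
  simp only [basis_zero, basis_one, basis_two] at h0 h1 h2
  refine ⟨?_, ?_, ?_⟩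
  · rw [key, h0, h1, h2]; simp; ring
  · rw [key, h0, h1, h2]; simp
  · rw [key, h0, h1, h2]; simp

lemma param_surjective (τ : M.Tri) : Function.Surjective (M.param τ) := by
  intro y
  refine ⟨!₂[(hM.basis τ).coord 1 y, (hM.basis τ).coord 2 y], ?_⟩
  refine (hM.basis τ).ext_elem fun i => ?_
  obtain ⟨h0, h1, h2⟩ := hM.coord_param τ !₂[(hM.basis τ).coord 1 y, (hM.basis τ).coord 2 y]
  have hs := (hM.basis τ).sum_coord_apply_eq_one y
  rw [Fin.sum_univ_three] at hs
  fin_cases i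
  · refine h0.trans ?_
    simp
    linarith
  · exact h1
  · exact h2

lemma eq_zero_of_integral_triSet {τ : M.Tri} {p : MvPolynomial (Fin 2) ℝ}
    (h : ∫ x in M.triSet τ, pval p x ^ 2 ≤ 0) : p = 0 := by
  rw [hM.integral_triSet] at h
  simp only [← pval_pullback] at h
  have h1 := eq_zero_of_integral_refTri (nonpos_of_mul_nonpos_right h (hM.jac_pos τ))
  refine MvPolynomial.funext fun y => ?_
  obtain ⟨x, hx⟩ := hM.param_surjective τ (WithLp.toLp 2 y)
  have h2 := pval_pullback τ p x
  rw [h1, hx, pval_zero] at h2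
  simpa [pval] using h2.symm

/-! ### Definiteness of the norm of `v` -/

/-- A discrete divergence theorem for `u² x`. Since `u` has no jumps and vanishes at edges with one
triangle, `u²` has no jumps either; summing by edges gives `∑ u_τ² · flux_τ = 0`, and all fluxes are
positive. No path to the boundary is needed. -/
lemma eq_zero_of_sum_sgn {u : M.Tri → ℝ}
    (hu : ∀ τ, ∀ e ∈ M.triEdges τ, ∑ σ ∈ M.adj e, M.sgn σ e * u σ = 0) : u = 0 := by
  classical
  have hsq : ∀ τ, ∀ e ∈ M.triEdges τ, ∑ σ ∈ M.adj e, M.sgn σ e * u σ ^ 2 = 0 := by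
    intro τ e he
    have h0 := hu τ e he
    have hc := hM.card_adj_le_two e
    have hpos : 0 < (M.adj e).card := Finset.card_pos.2 ⟨τ, mem_adj.2 he⟩
    have h12 : (M.adj e).card = 1 ∨ (M.adj e).card = 2 := by omega
    have hs : ∀ σ, M.sgn σ e ≠ 0 := fun σ => by
      rcases sgn_cases σ e with h | h <;> rw [h] <;> norm_num
    rcases h12 with h | h
    · obtain ⟨σ, hσ⟩ := Finset.card_eq_one.1 h
      rw [hσ, Finset.sum_singleton] at h0 ⊢
      rcases mul_eq_zero.1 h0 with h | h
      · exact absurd h (hs σ)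
      · rw [h]; ring
    · obtain ⟨σ, σ', hne, hσ⟩ := Finset.card_eq_two.1 h
      have h1 := hM.sgn_eq_neg hne (mem_adj.1 (by rw [hσ]; simp)) (mem_adj.1 (by rw [hσ]; simp))
      rw [hσ, Finset.sum_pair hne, h1] at h0 ⊢
      have h2 : M.sgn σ e * (u σ - u σ') = 0 := by linarith
      rcases mul_eq_zero.1 h2 with h | h
      · exact absurd h (hs σ)
      · rw [sub_eq_zero.1 h]; ring
  let g : Sym2 Pt → ℝ := fun e => edgeLength e * (M.normal e ⬝ᵥ e.out.1.ofLp)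
  have hsum : ∑ τ, u τ ^ 2 * ∑ e ∈ M.triEdges τ, M.sgn τ e * g e = 0 := by
    simp only [Finset.mul_sum]
    rw [Finset.sum_comm' (t' := Finset.univ.biUnion M.triEdges) (s' := fun e => M.adj e)]
    · refine Finset.sum_eq_zero fun e he => ?_
      obtain ⟨τ, -, hτ⟩ := Finset.mem_biUnion.1 he
      have := hsq τ e hτ
      calc ∑ σ ∈ M.adj e, u σ ^ 2 * (M.sgn σ e * g e)
          = (∑ σ ∈ M.adj e, M.sgn σ e * u σ ^ 2) * g e := by
            rw [Finset.sum_mul]; exact Finset.sum_congr rfl fun σ _ => by ring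
        _ = 0 := by rw [this, zero_mul]
    · intro τ e
      simp only [Finset.mem_univ, true_and, mem_adj, Finset.mem_biUnion]
      exact ⟨fun h => ⟨h, τ, h⟩, fun h => h.1⟩
  have hterm := (Finset.sum_eq_zero_iff_of_nonneg fun τ _ =>
    mul_nonneg (sq_nonneg (u τ)) (hM.flux_pos τ).le).1 hsum
  ext τ
  rcases mul_eq_zero.1 (hterm τ (Finset.mem_univ _)) with h | h
  · simpa using h
  · exact absurd h (hM.flux_pos τ).ne'

lemma edgeLength_pos {τ : M.Tri} {e : Sym2 Pt} (he : e ∈ M.triEdges τ) : 0 < edgeLength e := by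
  simp only [triEdges, Finset.mem_insert, Finset.mem_singleton] at he
  rcases he with rfl | rfl | rfl
  · exact dist_pos.2 (hM.va_ne_vb τ)
  · exact dist_pos.2 (hM.vc_ne_va τ)
  · exact dist_pos.2 (hM.vc_ne_vb τ)

omit hM in
lemma exists_tri_of_mem_Fu {e : Sym2 Pt} (he : e ∈ M.Fu) : ∃ τ, e ∈ M.triEdges τ := by
  simp only [Fu, Finset.mem_image, Finset.mem_univ, true_and] at he
  obtain ⟨τ, rfl⟩ := he
  exact ⟨τ, by simp [triEdges]⟩

omit hM in
lemma exists_tri_of_mem_Fp {e : Sym2 Pt} (he : e ∈ M.Fp) : ∃ τ, e ∈ M.triEdges τ := by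
  simp only [Fp, Finset.mem_image, Finset.mem_univ, true_and] at he
  obtain ⟨τ, rfl⟩ := he
  exact ⟨τ, by simp [triEdges]⟩

end IsMeshOf

/-- The gradient part of the squared norm of `v`. -/
noncomputable def gradPart (M : MeshData) (v : M.VField) : ℝ :=
  ∑ τ, ∫ x in M.triSet τ, frob (mval (grad (v τ)) x) (mval (grad (v τ)) x)

/-- The contribution of a primal edge to the squared norm of `v`. -/
noncomputable def primalTerm (M : MeshData) (v : M.VField) (e : Sym2 Pt) : ℝ :=
  (edgeLength e)⁻¹ * edgeIntegral (fun x => M.jump v e x ⬝ᵥ M.jump v e x) e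

/-- The contribution of a dual edge to the squared norm of `v`. -/
noncomputable def dualTerm (M : MeshData) (v : M.VField) (e : Sym2 Pt) : ℝ :=
  (edgeLength e)⁻¹ * edgeIntegral (fun x => M.jumpTan v e x ⬝ᵥ M.jumpTan v e x) e

lemma normZ2_eq (v : M.VField) : M.normZ2 v =
    √(M.gradPart v + (∑ e ∈ M.Fu, M.primalTerm v e) + ∑ e ∈ M.Fp, M.dualTerm v e) := rfl

lemma dot_self_nonneg (a : Fin 2 → ℝ) : 0 ≤ a ⬝ᵥ a :=
  Finset.sum_nonneg fun _ _ => mul_self_nonneg _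

lemma eq_zero_of_dot_self {a : Fin 2 → ℝ} (h : a ⬝ᵥ a = 0) : a = 0 := by
  simp only [dotProduct, Fin.sum_univ_two] at h
  ext i
  fin_cases i <;> simp <;> nlinarith [mul_self_nonneg (a 0), mul_self_nonneg (a 1)]

lemma primalTerm_nonneg (v : M.VField) (e : Sym2 Pt) : 0 ≤ M.primalTerm v e :=
  mul_nonneg (inv_nonneg.2 (edgeLength_nonneg e))
    (edgeIntegral_nonneg (fun _ => dot_self_nonneg _) e)

lemma dualTerm_nonneg (v : M.VField) (e : Sym2 Pt) : 0 ≤ M.dualTerm v e :=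
  mul_nonneg (inv_nonneg.2 (edgeLength_nonneg e))
    (edgeIntegral_nonneg (fun _ => dot_self_nonneg _) e)

lemma integral_grad_nonneg (v : M.VField) (τ : M.Tri) :
    0 ≤ ∫ x in M.triSet τ, frob (mval (grad (v τ)) x) (mval (grad (v τ)) x) :=
  integral_nonneg fun _ => frob_self_nonneg _

lemma tangent_dot_self {e : Sym2 Pt} (h : M.normal e ⬝ᵥ M.normal e = 1) :
    M.tangent e ⬝ᵥ M.tangent e = 1 := by
  rw [← h]
  simp only [tangent, dotProduct, Fin.sum_univ_two, Matrix.cons_val_zero, Matrix.cons_val_one]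
  ring

/-- Expansion of a vector in the normal and the tangent of an edge. -/
lemma eq_normal_add_tangent {e : Sym2 Pt} (h : M.normal e ⬝ᵥ M.normal e = 1) (a : Fin 2 → ℝ)
    (i : Fin 2) :
    a i = (a ⬝ᵥ M.normal e) * M.normal e i + (a ⬝ᵥ M.tangent e) * M.tangent e i := by
  simp only [tangent, dotProduct, Fin.sum_univ_two, Matrix.cons_val_zero, Matrix.cons_val_one] at *
  fin_cases i
  · simp
    linear_combination -a 0 * h
  · simp
    linear_combination -a 1 * h

namespace IsMeshOf

include hM

/-- Zero norm makes `v` piecewise constant without primal jumps or tangential dual jumps. Membership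
in `U^h` removes the normal dual jumps, and `eq_zero_of_sum_sgn` applies to each component. -/
lemma normZ2_pos {k : ℕ} {v : M.VField} (hv : v ∈ M.U k) (h0 : v ≠ 0) : 0 < M.normZ2 v := by
  by_contra hcon
  have h1 : M.gradPart v + (∑ e ∈ M.Fu, M.primalTerm v e) + ∑ e ∈ M.Fp, M.dualTerm v e ≤ 0 := by
    by_contra h
    exact hcon (Real.sqrt_pos.2 (not_le.1 h))
  have hg : 0 ≤ M.gradPart v := Finset.sum_nonneg fun τ _ => integral_grad_nonneg v τ
  have hp : 0 ≤ ∑ e ∈ M.Fu, M.primalTerm v e := Finset.sum_nonneg fun e _ => primalTerm_nonneg v e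
  have hd : 0 ≤ ∑ e ∈ M.Fp, M.dualTerm v e := Finset.sum_nonneg fun e _ => dualTerm_nonneg v e
  have hg0 : M.gradPart v = 0 := by linarith
  have hp0 : ∑ e ∈ M.Fu, M.primalTerm v e = 0 := by linarith
  have hd0 : ∑ e ∈ M.Fp, M.dualTerm v e = 0 := by linarith
  have hg1 := (Finset.sum_eq_zero_iff_of_nonneg fun τ _ => integral_grad_nonneg v τ).1 hg0
  have hp1 := (Finset.sum_eq_zero_iff_of_nonneg fun e _ => primalTerm_nonneg v e).1 hp0
  have hd1 := (Finset.sum_eq_zero_iff_of_nonneg fun e _ => dualTerm_nonneg v e).1 hd0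
  have hder : ∀ τ i j, pderiv j (v τ i) = 0 := by
    intro τ i j
    refine hM.eq_zero_of_integral_triSet (τ := τ) ?_
    rw [← hg1 τ (Finset.mem_univ _)]
    refine setIntegral_mono (integrableOn_triSet (by fun_prop) τ)
      (integrableOn_triSet (continuous_frob_mval _ _) τ) fun x => ?_
    show pval (pderiv j (v τ i)) x ^ 2 ≤ frob (mval (grad (v τ)) x) (mval (grad (v τ)) x)
    rw [← pval_grad, sq]
    refine le_trans ?_ (Finset.single_le_sum (f := fun i => ∑ j, mval (grad (v τ)) x i j *
      mval (grad (v τ)) x i j) (fun i _ => Finset.sum_nonneg fun j _ => mul_self_nonneg _)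
      (Finset.mem_univ i))
    exact Finset.single_le_sum (f := fun j => mval (grad (v τ)) x i j * mval (grad (v τ)) x i j)
      (fun j _ => mul_self_nonneg _) (Finset.mem_univ j)
  have hconst : ∀ τ i, v τ i = C (coeff 0 (v τ i)) := fun τ i =>
    eq_C_of_pderiv_eq_zero (hder τ i)
  set a : M.Tri → Fin 2 → ℝ := fun τ i => coeff 0 (v τ i) with ha
  have hval : ∀ τ x, vval (v τ) x = a τ := by
    intro τ x
    ext i
    rw [vval, hconst, pval_C]
  have hju : ∀ e ∈ M.Fu, ∑ σ ∈ M.adj e, M.sgn σ e • a σ = 0 := by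
    intro e he
    obtain ⟨τ, hτ⟩ := exists_tri_of_mem_Fu he
    have hl := hM.edgeLength_pos hτ
    have h2 := hp1 e he
    simp only [primalTerm, jump, hval] at h2
    rw [edgeIntegral_const, inv_mul_cancel_left₀ hl.ne'] at h2
    exact eq_zero_of_dot_self h2
  have hjp : ∀ e ∈ M.Fp, ∑ σ ∈ M.adj e, M.sgn σ e • a σ = 0 := by
    intro e he
    obtain ⟨τ, hτ⟩ := exists_tri_of_mem_Fp he
    have hl := hM.edgeLength_pos hτ
    have hn := hM.normal_unit τ e hτ
    have h2 := hd1 e he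
    simp only [dualTerm, jumpTan, hval] at h2
    rw [edgeIntegral_const, inv_mul_cancel_left₀ hl.ne'] at h2
    have h3 := eq_zero_of_dot_self h2
    obtain ⟨z, hz⟩ : (edgeSet e).Nonempty := by
      induction e using Sym2.ind with
      | _ p q => exact ⟨p, edgeSet_mk p q ▸ left_mem_segment ℝ p q⟩
    have h4 : ∑ σ ∈ M.adj e, M.sgn σ e * (a σ ⬝ᵥ M.normal e) = 0 := by
      have : ∀ σ ∈ M.adj e, M.sgn σ e * (a σ ⬝ᵥ M.normal e) =
          M.sgn σ e * (a τ ⬝ᵥ M.normal e) := by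
        intro σ hσ
        have := hv.2 e he σ hσ τ (mem_adj.2 hτ) z hz
        rw [hval, hval] at this
        rw [this]
      rw [Finset.sum_congr rfl this, ← Finset.sum_mul, hM.sum_sgn_eq_zero he, zero_mul]
    ext i
    have h5 := congrFun h3 i
    simp only [Finset.sum_apply, Pi.smul_apply, smul_eq_mul, Pi.zero_apply] at h5 ⊢
    calc ∑ σ ∈ M.adj e, M.sgn σ e * a σ i
        = (∑ σ ∈ M.adj e, M.sgn σ e * (a σ ⬝ᵥ M.normal e)) * M.normal e i +
          ∑ σ ∈ M.adj e, M.sgn σ e * ((a σ ⬝ᵥ M.tangent e) * M.tangent e i) := by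
          rw [Finset.sum_mul, ← Finset.sum_add_distrib]
          refine Finset.sum_congr rfl fun σ _ => ?_
          rw [eq_normal_add_tangent hn (a σ) i]
          ring
      _ = 0 := by rw [h4, h5, zero_mul, add_zero]
  have hall : ∀ i, (fun τ => a τ i) = 0 := by
    intro i
    refine hM.eq_zero_of_sum_sgn fun τ e he => ?_
    have h2 : ∑ σ ∈ M.adj e, M.sgn σ e • a σ = 0 := by
      simp only [triEdges, Finset.mem_insert, Finset.mem_singleton] at he
      rcases he with rfl | rfl | rfl
      · exact hju _ (side_mem_Fu τ)
      · exact hjp _ (va_edge_mem_Fp τ)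
      · exact hjp _ (vb_edge_mem_Fp τ)
    simpa using congrFun h2 i
  refine h0 (funext fun τ => funext fun i => ?_)
  rw [hconst τ i]
  have : coeff 0 (v τ i) = 0 := congrFun (hall i) τ
  rw [this, C_0]
  rfl

end IsMeshOf

end MeshData

end SDG

namespace SDG

open MvPolynomial MeasureTheory

namespace MeshData

variable {M : MeshData} {Ω : Set Pt}

/-! ### Jumps as polynomials -/

/-- A component of the jump `[v]` as a polynomial. -/
noncomputable def jumpPoly (M : MeshData) (v : M.VField) (e : Sym2 Pt) (i : Fin 2) :
    MvPolynomial (Fin 2) ℝ := ∑ τ ∈ M.adj e, C (M.sgn τ e) * v τ i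

lemma pval_jumpPoly (v : M.VField) (e : Sym2 Pt) (i : Fin 2) (x : Pt) :
    pval (M.jumpPoly v e i) x = M.jump v e x i := by
  simp [jumpPoly, jump, vval]

/-- The tangential component of the jump `[v]` as a polynomial. -/
noncomputable def tanPoly (M : MeshData) (v : M.VField) (e : Sym2 Pt) : MvPolynomial (Fin 2) ℝ :=
  ∑ i, C (M.tangent e i) * M.jumpPoly v e i

lemma pval_tanPoly (v : M.VField) (e : Sym2 Pt) (x : Pt) :
    pval (M.tanPoly v e) x = ∑ τ ∈ M.adj e, M.sgn τ e * (vval (v τ) x ⬝ᵥ M.tangent e) := by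
  simp only [tanPoly, jumpPoly, pval_sum, pval_mul, pval_C]
  simp only [Fin.sum_univ_two, Finset.mul_sum, ← Finset.sum_add_distrib, dotProduct, vval]
  exact Finset.sum_congr rfl fun τ _ => by ring

lemma jumpTan_eq (v : M.VField) (e : Sym2 Pt) (x : Pt) :
    M.jumpTan v e x = pval (M.tanPoly v e) x • M.tangent e := by
  rw [pval_tanPoly, jumpTan, Finset.sum_smul]
  exact Finset.sum_congr rfl fun τ _ => by rw [smul_smul]

lemma jumpPoly_mem {k : ℕ} {v : M.VField} (hv : ∀ τ i, v τ i ∈ P k) (e : Sym2 Pt) (i : Fin 2) :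
    M.jumpPoly v e i ∈ P k :=
  (P k).sum_mem fun τ _ => C_mul_mem_P (hv τ i) _

lemma tanPoly_mem {k : ℕ} {v : M.VField} (hv : ∀ τ i, v τ i ∈ P k) (e : Sym2 Pt) :
    M.tanPoly v e ∈ P k :=
  (P k).sum_mem fun i _ => C_mul_mem_P (jumpPoly_mem hv e i) _

/-! ### The local degrees of freedom -/

/-- First endpoint of the edge of a degree of freedom. -/
noncomputable def fstPt (M : MeshData) (τ : M.Tri) : Fin 4 → Pt :=
  ![M.va τ, M.va τ, M.vc τ, M.vc τ]

/-- Second endpoint of the edge of a degree of freedom. -/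
noncomputable def sndPt (M : MeshData) (τ : M.Tri) : Fin 4 → Pt :=
  ![M.vb τ, M.vb τ, M.va τ, M.vb τ]

/-- The edge of a degree of freedom. -/
noncomputable def edgeOf (M : MeshData) (τ : M.Tri) (m : Fin 4) : Sym2 Pt :=
  s(M.fstPt τ m, M.sndPt τ m)

lemma edgeOf_mem (τ : M.Tri) (m : Fin 4) : M.edgeOf τ m ∈ M.triEdges τ := by
  fin_cases m <;> simp [edgeOf, fstPt, sndPt, triEdges]

/-- The jump that is prescribed by a degree of freedom. -/
noncomputable def jumpData (M : MeshData) (v : M.VField) (τ : M.Tri) :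
    Fin 4 → MvPolynomial (Fin 2) ℝ :=
  ![M.jumpPoly v s(M.va τ, M.vb τ) 0, M.jumpPoly v s(M.va τ, M.vb τ) 1,
    M.tanPoly v s(M.vc τ, M.va τ), M.tanPoly v s(M.vc τ, M.vb τ)]

lemma jumpData_mem {k : ℕ} {v : M.VField} (hv : ∀ τ i, v τ i ∈ P k) (τ : M.Tri) (m : Fin 4) :
    M.jumpData v τ m ∈ P k := by
  fin_cases m
  · exact jumpPoly_mem hv _ _
  · exact jumpPoly_mem hv _ _
  · exact tanPoly_mem hv _
  · exact tanPoly_mem hv _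

/-- The polynomials `Λ_m : ∇ v`. -/
noncomputable def testPoly (Λ : Fin 4 → Matrix (Fin 2) (Fin 2) ℝ)
    (p : Fin 2 → MvPolynomial (Fin 2) ℝ) (m : Fin 4) : MvPolynomial (Fin 2) ℝ :=
  ∑ i, ∑ j, C (Λ m i j) * pderiv j (p i)

lemma pval_testPoly (Λ : Fin 4 → Matrix (Fin 2) (Fin 2) ℝ) (p : Fin 2 → MvPolynomial (Fin 2) ℝ)
    (m : Fin 4) (x : Pt) : pval (testPoly Λ p m) x = frob (Λ m) (mval (grad p) x) := by
  simp [testPoly, frob, pval_grad]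

lemma affine_mul_testPoly_mem {k : ℕ} {Λ : Fin 4 → Matrix (Fin 2) (Fin 2) ℝ}
    {p : Fin 2 → MvPolynomial (Fin 2) ℝ} (hp : ∀ i, p i ∈ P k) {l : MvPolynomial (Fin 2) ℝ}
    (hl : l ∈ P 1) (m : Fin 4) : l * testPoly Λ p m ∈ P k := by
  simp only [testPoly, Finset.mul_sum]
  refine (P k).sum_mem fun i _ => (P k).sum_mem fun j _ => ?_
  rw [mul_left_comm]
  exact C_mul_mem_P (affine_mul_pderiv_mem hl (hp i) j) _

lemma testPoly_mem {k : ℕ} {Λ : Fin 4 → Matrix (Fin 2) (Fin 2) ℝ}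
    {p : Fin 2 → MvPolynomial (Fin 2) ℝ} (hp : ∀ i, p i ∈ P k) (m : Fin 4) :
    testPoly Λ p m ∈ P k := by
  have := affine_mul_testPoly_mem (Λ := Λ) hp (l := 1) (mem_P.2 (by simp)) m
  rwa [one_mul] at this

namespace IsMeshOf

variable (hM : M.IsMeshOf Ω)

/-- The barycentric coordinate that vanishes on the edge of a degree of freedom. -/
noncomputable def vanishPoly (τ : M.Tri) (m : Fin 4) : MvPolynomial (Fin 2) ℝ :=
  affineMapPoly ((hM.basis τ).coord ((![0, 0, 2, 1] : Fin 4 → Fin 3) m))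

lemma vanishPoly_mem (τ : M.Tri) (m : Fin 4) : hM.vanishPoly τ m ∈ P 1 := by
  unfold vanishPoly affineMapPoly
  exact affinePoly_mem _ _

/-- The extension of a polynomial from the edge of a degree of freedom to the triangle, constant
along one of the other edges. -/
noncomputable def extend (τ : M.Tri) (m : Fin 4) (p : MvPolynomial (Fin 2) ℝ) :
    MvPolynomial (Fin 2) ℝ :=
  -- The coordinate chosen is that of the second endpoint, which runs from 0 to 1 along the edge.
  bind₁ (fun i => C (M.fstPt τ m i) + C ((M.sndPt τ m - M.fstPt τ m) i) *
    affineMapPoly ((hM.basis τ).coord ((![2, 2, 1, 2] : Fin 4 → Fin 3) m))) p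

lemma extend_mem {k : ℕ} {p : MvPolynomial (Fin 2) ℝ} (hp : p ∈ P k) (τ : M.Tri) (m : Fin 4) :
    hM.extend τ m p ∈ P k :=
  bind₁_mem hp fun i => (P 1).add_mem (mem_P.2 (by simp)) (C_mul_mem_P (affinePoly_mem _ _) _)

lemma pval_extend (τ : M.Tri) (m : Fin 4) (p : MvPolynomial (Fin 2) ℝ) (x : Pt) :
    pval (hM.extend τ m p) x = pval p (AffineMap.lineMap (M.fstPt τ m) (M.sndPt τ m)
      ((hM.basis τ).coord ((![2, 2, 1, 2] : Fin 4 → Fin 3) m) x)) := by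
  refine pval_bind₁ _ _ _ _ fun i => ?_
  rw [pval_add, pval_mul, pval_C, pval_C, pval_affineMapPoly, AffineMap.lineMap_apply]
  simp
  ring

/-- In reference coordinates the extension depends on one variable only, as
`integral_refTri_coord_le` requires. -/
lemma pval_extend_param (τ : M.Tri) (m : Fin 4) (p : MvPolynomial (Fin 2) ℝ) (y : Pt) :
    pval (hM.extend τ m p) (M.param τ y) = pval p (AffineMap.lineMap (M.fstPt τ m) (M.sndPt τ m)
      (y ((![1, 1, 0, 1] : Fin 4 → Fin 2) m))) := by
  obtain ⟨-, h1, h2⟩ := hM.coord_param τ y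
  rw [pval_extend]
  congr 2
  fin_cases m
  exacts [h2, h2, h1, h2]

lemma coord_lineMap (τ : M.Tri) (m : Fin 4) (t : ℝ) :
    (hM.basis τ).coord ((![2, 2, 1, 2] : Fin 4 → Fin 3) m)
      (AffineMap.lineMap (M.fstPt τ m) (M.sndPt τ m) t) = t ∧
    (hM.basis τ).coord ((![0, 0, 2, 1] : Fin 4 → Fin 3) m)
      (AffineMap.lineMap (M.fstPt τ m) (M.sndPt τ m) t) = 0 := by
  have hb : ∀ i j, (hM.basis τ).coord i (hM.basis τ j) = if i = j then 1 else 0 :=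
    fun i j => AffineBasis.coord_apply _ i j
  have h0 := fun i => hb i 0
  have h1 := fun i => hb i 1
  have h2 := fun i => hb i 2
  simp only [basis_zero, basis_one, basis_two] at h0 h1 h2
  rw [AffineMap.apply_lineMap, AffineMap.apply_lineMap, AffineMap.lineMap_apply_ring',
    AffineMap.lineMap_apply_ring']
  fin_cases m <;> simp [fstPt, sndPt, h0, h1, h2]

lemma pval_on_edge (τ : M.Tri) (m : Fin 4) (p : MvPolynomial (Fin 2) ℝ) {x : Pt}
    (hx : x ∈ edgeSet (M.edgeOf τ m)) :
    pval (hM.extend τ m p) x = pval p x ∧ pval (hM.vanishPoly τ m) x = 0 := by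
  rw [edgeOf, edgeSet_mk, segment_eq_image_lineMap] at hx
  obtain ⟨t, -, rfl⟩ := hx
  obtain ⟨h1, h2⟩ := hM.coord_lineMap τ m t
  rw [pval_extend, h1, vanishPoly, pval_affineMapPoly, h2]
  exact ⟨rfl, rfl⟩

lemma pval_vanishPoly_param (τ : M.Tri) (m : Fin 4) {y : Pt} (hy : y ∈ refTri) :
    bubble y ≤ pval (hM.vanishPoly τ m) (M.param τ y) ∧
      0 ≤ pval (hM.vanishPoly τ m) (M.param τ y) ∧
      pval (hM.vanishPoly τ m) (M.param τ y) ≤ 1 := by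
  obtain ⟨h0, h1, h2⟩ := hM.coord_param τ y
  obtain ⟨a, b, c⟩ := hy
  have hc : 0 ≤ 1 - y 0 - y 1 := by linarith
  have hab := mul_nonneg a b
  have hbub : bubble y ≤ 1 - y 0 - y 1 ∧ bubble y ≤ y 1 ∧ bubble y ≤ y 0 := by
    unfold bubble
    refine ⟨?_, ?_, ?_⟩
    · exact mul_le_of_le_one_left hc (by nlinarith)
    · nlinarith [mul_nonneg b hc, mul_nonneg hab b, mul_nonneg hab a]
    · nlinarith [mul_nonneg a hc, mul_nonneg hab b, mul_nonneg hab a]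
  rw [vanishPoly, pval_affineMapPoly]
  fin_cases m
  · exact ⟨hbub.1.trans_eq h0.symm, hc.trans_eq h0.symm, h0.trans_le (by linarith)⟩
  · exact ⟨hbub.1.trans_eq h0.symm, hc.trans_eq h0.symm, h0.trans_le (by linarith)⟩
  · exact ⟨hbub.2.1.trans_eq h2.symm, b.trans_eq h2.symm, h2.trans_le (by linarith)⟩
  · exact ⟨hbub.2.2.trans_eq h1.symm, a.trans_eq h1.symm, h1.trans_le (by linarith)⟩

/-! ### Local estimates -/

/-- The Jacobian cancels, so the reference constant is unchanged by transport; then the bubble is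
replaced by the larger `λ_m`. -/
lemma integral_mul_vanishPoly_ge {k : ℕ} {K : ℝ} (hK : 0 < K) (hb : ∀ p ∈ P k,
      ∫ x in refTri, pval p x ^ 2 ≤ K * ∫ x in refTri, bubble x * pval p x ^ 2)
    (τ : M.Tri) (m : Fin 4) {q : MvPolynomial (Fin 2) ℝ} (hq : q ∈ P k) :
    ∫ x in M.triSet τ, pval q x ^ 2 ≤
      K * ∫ x in M.triSet τ, pval (hM.vanishPoly τ m) x * pval q x ^ 2 := by
  rw [hM.integral_triSet, hM.integral_triSet, mul_left_comm]
  refine mul_le_mul_of_nonneg_left ?_ (hM.jac_pos τ).le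
  have h1 := hb _ (pullback_mem hq τ)
  simp only [pval_pullback] at h1
  refine h1.trans (mul_le_mul_of_nonneg_left ?_ hK.le)
  have hc : Continuous (M.param τ) := by unfold param refMap; fun_prop
  refine setIntegral_mono_on (integrableOn_refTri (by fun_prop)) (integrableOn_refTri (by fun_prop))
    isClosed_refTri.measurableSet fun y hy => ?_
  exact mul_le_mul_of_nonneg_right (hM.pval_vanishPoly_param τ m hy).1 (sq_nonneg _)

lemma integral_extend_sq_le (τ : M.Tri) (m : Fin 4) (p : MvPolynomial (Fin 2) ℝ) :
    ∫ x in M.triSet τ, pval (hM.extend τ m p) x ^ 2 ≤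
      M.jac τ * ((edgeLength (M.edgeOf τ m))⁻¹ *
        edgeIntegral (fun x => pval p x ^ 2) (M.edgeOf τ m)) := by
  rw [hM.integral_triSet]
  refine mul_le_mul_of_nonneg_left ?_ (hM.jac_pos τ).le
  simp only [pval_extend_param]
  have hl : 0 < dist (M.fstPt τ m) (M.sndPt τ m) := hM.edgeLength_pos (edgeOf_mem τ m)
  rw [edgeOf, edgeIntegral_mk, edgeLength_mk, inv_mul_cancel_left₀ hl.ne']
  have hc : Continuous fun s : ℝ => (AffineMap.lineMap (M.fstPt τ m) (M.sndPt τ m) s : Pt) :=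
    AffineMap.lineMap_continuous
  exact integral_refTri_coord_le
    (g := fun s => pval p (AffineMap.lineMap (M.fstPt τ m) (M.sndPt τ m) s) ^ 2)
    (((continuous_pval p).comp hc).pow 2) (fun _ => sq_nonneg _) _

include hM in
-- The Jacobian is at most `h²`, and every edge is at least as long as some height, hence at least
-- `κ h`.
lemma jac_le {ρ c : ℝ} (hR : M.IsRegular ρ c) (hρ : 0 < ρ) (hc : 0 < c) (τ : M.Tri) (m : Fin 4) :
    M.jac τ ≤ ((ρ * c) ^ 2)⁻¹ * edgeLength (M.edgeOf τ m) ^ 2 := by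
  have hS := hM.shape hR hρ hc τ
  have hh := hS.h_pos
  have hκ := hS.κ_pos
  set h := Metric.diam (M.cellSet τ.1)
  set κ := ρ * c
  set A := (M.va τ - M.vc τ).ofLp with hA
  set B := (M.vb τ - M.vc τ).ofLp with hB
  have hsq : ∀ t : ℝ, κ * h ≤ |t| → (κ * h) ^ 2 ≤ t ^ 2 := fun t ht => by
    rw [← sq_abs t]; exact pow_le_pow_left₀ (by positivity) ht 2
  have h1 := hsq _ hS.height₁
  have h2 := hsq _ hS.height₂
  have hA2 : (κ * h) ^ 2 ≤ A ⬝ᵥ A := by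
    have := dot_sq_le (M.normal s(M.vc τ, M.vb τ)) A
    rw [hS.unit₂, one_mul] at this
    exact h2.trans this
  have hB2 : (κ * h) ^ 2 ≤ B ⬝ᵥ B := by
    have := dot_sq_le (M.normal s(M.vc τ, M.va τ)) B
    rw [hS.unit₁, one_mul] at this
    exact h1.trans this
  have hBA2 : (κ * h) ^ 2 ≤ (B - A) ⬝ᵥ (B - A) := by
    have := dot_sq_le (M.normal s(M.vc τ, M.va τ)) (B - A)
    rw [hS.unit₁, one_mul, dotProduct_sub, hS.orth₁, sub_zero] at this
    exact h1.trans this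
  have hBA : B - A = (M.vb τ - M.va τ).ofLp := by
    rw [hA, hB, ← WithLp.ofLp_sub, sub_sub_sub_cancel_right]
  have hlen : (κ * h) ^ 2 ≤ edgeLength (M.edgeOf τ m) ^ 2 := by
    rw [hBA, dot_self_eq_dist_sq, dist_comm] at hBA2
    rw [hA, dot_self_eq_dist_sq, dist_comm] at hA2
    rw [hB, dot_self_eq_dist_sq, dist_comm] at hB2
    fin_cases m
    exacts [hBA2, hBA2, hA2, hB2]
  have hjac : M.jac τ ≤ h ^ 2 := by
    have hd := sq_dot_mul_dot hS.unit₁ hS.orth₁ (w := B)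
    have hb := dot_sq_le (M.normal s(M.vc τ, M.va τ)) B
    rw [hS.unit₁, one_mul] at hb
    have h3 : det₂ A B ^ 2 ≤ (h ^ 2) ^ 2 := by
      rw [← hd, sq (h ^ 2)]
      exact mul_le_mul (hb.trans hS.len₂) hS.len₁ (dot_self_nonneg _) (by positivity)
    exact abs_le_of_sq_le_sq h3 (by positivity)
  refine hjac.trans ?_
  rw [← div_eq_inv_mul, le_div_iff₀ (by positivity)]
  linarith [mul_pow κ h 2]

end IsMeshOf

/-! ### Summation of the local shares -/

/-- The share of a degree of freedom in the jump part of the squared norm of `v`. -/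
noncomputable def jumpShare (M : MeshData) (v : M.VField) (τ : M.Tri) (m : Fin 4) : ℝ :=
  (edgeLength (M.edgeOf τ m))⁻¹ *
    edgeIntegral (fun x => pval (M.jumpData v τ m) x ^ 2) (M.edgeOf τ m)

namespace IsMeshOf

variable (hM : M.IsMeshOf Ω)

include hM in
lemma sum_comp_le_two_mul {φ : M.Tri → Sym2 Pt} {F : Finset (Sym2 Pt)}
    (h1 : ∀ τ, φ τ ∈ M.triEdges τ) (h2 : ∀ τ, φ τ ∈ F) {g : Sym2 Pt → ℝ} (hg : ∀ e, 0 ≤ g e) :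
    ∑ τ, g (φ τ) ≤ 2 * ∑ e ∈ F, g e := by
  classical
  rw [← Finset.sum_fiberwise_of_maps_to (t := F) (g := φ) fun τ _ => h2 τ, Finset.mul_sum]
  refine Finset.sum_le_sum fun e _ => ?_
  have h3 : ∑ τ with φ τ = e, g (φ τ) = ((Finset.univ.filter fun τ => φ τ = e).card : ℝ) * g e := by
    rw [Finset.sum_congr rfl (fun τ hτ => by rw [(Finset.mem_filter.1 hτ).2]), Finset.sum_const,
      nsmul_eq_mul]
  rw [h3]
  refine mul_le_mul_of_nonneg_right ?_ (hg e)
  have h4 : (Finset.univ.filter fun τ => φ τ = e).card ≤ (M.adj e).card :=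
    Finset.card_le_card fun τ hτ => mem_adj.2 ((Finset.mem_filter.1 hτ).2 ▸ h1 τ)
  exact_mod_cast h4.trans (hM.card_adj_le_two e)

include hM in
-- Indices 0 and 1 together give the primal term, 2 and 3 one dual term each. With at most two
-- triangles per edge, each of the three sums costs a factor 2, and two of them are dual.
lemma sum_jumpShare_le (v : M.VField) : ∑ τ, ∑ m, M.jumpShare v τ m ≤
    4 * ((∑ e ∈ M.Fu, M.primalTerm v e) + ∑ e ∈ M.Fp, M.dualTerm v e) := by
  have hprim : ∀ τ, M.jumpShare v τ 0 + M.jumpShare v τ 1 =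
      M.primalTerm v s(M.va τ, M.vb τ) := by
    intro τ
    show (edgeLength s(M.va τ, M.vb τ))⁻¹ * edgeIntegral
        (fun x => pval (M.jumpPoly v s(M.va τ, M.vb τ) 0) x ^ 2) s(M.va τ, M.vb τ) +
      (edgeLength s(M.va τ, M.vb τ))⁻¹ * edgeIntegral
        (fun x => pval (M.jumpPoly v s(M.va τ, M.vb τ) 1) x ^ 2) s(M.va τ, M.vb τ) = _
    rw [← mul_add, ← edgeIntegral_add (by fun_prop) (by fun_prop), primalTerm]
    simp only [pval_jumpPoly, dotProduct, Fin.sum_univ_two, sq]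
  have hdual : ∀ (τ : M.Tri) (e : Sym2 Pt), e ∈ M.triEdges τ →
      (edgeLength e)⁻¹ * edgeIntegral (fun x => pval (M.tanPoly v e) x ^ 2) e =
        M.dualTerm v e := by
    intro τ e he
    simp only [dualTerm, jumpTan_eq, smul_dotProduct, dotProduct_smul,
      tangent_dot_self (hM.normal_unit τ e he), smul_eq_mul, mul_one, sq]
  have h2 : ∀ τ, M.jumpShare v τ 2 = M.dualTerm v s(M.vc τ, M.va τ) := fun τ =>
    hdual τ _ (edgeOf_mem τ 2)
  have h3 : ∀ τ, M.jumpShare v τ 3 = M.dualTerm v s(M.vc τ, M.vb τ) := fun τ =>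
    hdual τ _ (edgeOf_mem τ 3)
  simp only [Fin.sum_univ_four, hprim, h2, h3, Finset.sum_add_distrib]
  have b0 := hM.sum_comp_le_two_mul (φ := fun τ => s(M.va τ, M.vb τ)) (by simp [triEdges])
    side_mem_Fu (primalTerm_nonneg v)
  have b1 := hM.sum_comp_le_two_mul (φ := fun τ => s(M.vc τ, M.va τ)) (by simp [triEdges])
    va_edge_mem_Fp (dualTerm_nonneg v)
  have b2 := hM.sum_comp_le_two_mul (φ := fun τ => s(M.vc τ, M.vb τ)) (by simp [triEdges])
    vb_edge_mem_Fp (dualTerm_nonneg v)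
  have p0 : 0 ≤ ∑ e ∈ M.Fu, M.primalTerm v e := Finset.sum_nonneg fun e _ => primalTerm_nonneg v e
  linarith

/-! ### The test field -/

/-- The coefficients of the test field with respect to the dual matrices. -/
noncomputable def coefPoly (Λ : M.Tri → Fin 4 → Matrix (Fin 2) (Fin 2) ℝ) (θ : ℝ) (v : M.VField)
    (τ : M.Tri) (m : Fin 4) : MvPolynomial (Fin 2) ℝ :=
  C (-(edgeLength (M.edgeOf τ m))⁻¹) * hM.extend τ m (M.jumpData v τ m) +
    C θ * (hM.vanishPoly τ m * testPoly (Λ τ) (v τ) m)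

/-- The test field. -/
noncomputable def testField (Λ : M.Tri → Fin 4 → Matrix (Fin 2) (Fin 2) ℝ) (θ : ℝ)
    (v : M.VField) : M.MField := fun τ =>
  Matrix.of fun i j => ∑ m, C (Λ τ m i j) * hM.coefPoly Λ θ v τ m

variable {Λ : M.Tri → Fin 4 → Matrix (Fin 2) (Fin 2) ℝ} {θ : ℝ} {v : M.VField}

lemma coefPoly_mem {k : ℕ} (hv : ∀ τ i, v τ i ∈ P k) (τ : M.Tri) (m : Fin 4) :
    hM.coefPoly Λ θ v τ m ∈ P k := by
  have h1 := hM.extend_mem (jumpData_mem hv τ m) τ m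
  have h2 : hM.vanishPoly τ m * testPoly (Λ τ) (v τ) m ∈ P k :=
    affine_mul_testPoly_mem (hv τ) (hM.vanishPoly_mem τ m) m
  unfold coefPoly
  exact (P k).add_mem (C_mul_mem_P h1 _) (C_mul_mem_P h2 _)

lemma testField_mem {k : ℕ} (hv : ∀ τ i, v τ i ∈ P k) (τ : M.Tri) (i j : Fin 2) :
    hM.testField Λ θ v τ i j ∈ P k := by
  unfold testField
  rw [Matrix.of_apply]
  exact (P k).sum_mem fun m _ => C_mul_mem_P (hM.coefPoly_mem hv τ m) _

lemma mval_testField (τ : M.Tri) (x : Pt) :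
    mval (hM.testField Λ θ v τ) x = ∑ m, pval (hM.coefPoly Λ θ v τ m) x • Λ τ m := by
  ext i j
  simp [mval, testField, Matrix.sum_apply, mul_comm]

lemma pval_coefPoly_on_edge (τ : M.Tri) (m : Fin 4) {x : Pt} (hx : x ∈ edgeSet (M.edgeOf τ m)) :
    pval (hM.coefPoly Λ θ v τ m) x =
      -(edgeLength (M.edgeOf τ m))⁻¹ * pval (M.jumpData v τ m) x := by
  obtain ⟨h1, h2⟩ := hM.pval_on_edge τ m (M.jumpData v τ m) hx
  rw [coefPoly, pval_add, pval_mul, pval_mul, pval_mul, pval_C, h1, h2]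
  ring

/-! ### Traces of the test field, and its values in the form and the norm -/

/-- Duality of the matrices `Λ` of a triangle to the traces. -/
def IsDual (M : MeshData) (Λ : M.Tri → Fin 4 → Matrix (Fin 2) (Fin 2) ℝ) : Prop :=
  ∀ τ f, dualFun (M.normal s(M.va τ, M.vb τ)) (M.normal s(M.vc τ, M.va τ))
    (M.normal s(M.vc τ, M.vb τ)) (∑ m, f m • Λ τ m) = f

variable {ρ c : ℝ} (hR : M.IsRegular ρ c) (hρ : 0 < ρ) (hΛ : IsDual M Λ)

include hR hρ hΛ

/-- A primal edge is the side of every triangle that contains it, so indices 0 and 1 prescribe the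
full trace. The result does not involve `τ`: the trace is single-valued. -/
lemma testField_mulVec_normal {e : Sym2 Pt} (he : e ∈ M.Fu) {τ : M.Tri} (hτ : τ ∈ M.adj e) {x : Pt}
    (hx : x ∈ edgeSet e) : mval (hM.testField Λ θ v τ) x *ᵥ M.normal e =
      -(edgeLength e)⁻¹ • M.jump v e x := by
  have he' := hM.eq_of_mem_Fu hR hρ he hτ
  subst he'
  have h := hΛ τ fun m => pval (hM.coefPoly Λ θ v τ m) x
  rw [← mval_testField] at h
  have h0 := congrFun h 0
  have h1 := congrFun h 1
  rw [hM.pval_coefPoly_on_edge τ 0 hx] at h0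
  rw [hM.pval_coefPoly_on_edge τ 1 hx] at h1
  ext i
  rw [Pi.smul_apply, smul_eq_mul, ← pval_jumpPoly]
  fin_cases i
  · exact h0
  · exact h1

lemma tangent_dot_testField {e : Sym2 Pt} (he : e ∈ M.Fp) {τ : M.Tri} (hτ : τ ∈ M.adj e) {x : Pt}
    (hx : x ∈ edgeSet e) : M.tangent e ⬝ᵥ (mval (hM.testField Λ θ v τ) x *ᵥ M.normal e) =
      -(edgeLength e)⁻¹ * pval (M.tanPoly v e) x := by
  have h := hΛ τ fun m => pval (hM.coefPoly Λ θ v τ m) x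
  rw [← mval_testField] at h
  rcases hM.eq_of_mem_Fp hR hρ he hτ with rfl | rfl
  · have h2 := congrFun h 2
    rw [hM.pval_coefPoly_on_edge τ 2 hx] at h2
    exact h2
  · have h3 := congrFun h 3
    rw [hM.pval_coefPoly_on_edge τ 3 hx] at h3
    exact h3

/-- On a dual edge the test functions are multiples of the tangent, and the tangential part of the
trace is single-valued, so the signs cancel. -/
lemma testField_mem_WHat {k : ℕ} (hv : ∀ τ i, v τ i ∈ P k) :
    hM.testField Λ θ v ∈ M.WHat Ω k := by
  refine ⟨⟨fun τ i j => hM.testField_mem hv τ i j, ?_⟩, ?_⟩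
  · intro e he _ τ hτ τ' hτ' x hx
    rw [hM.testField_mulVec_normal hR hρ hΛ he hτ hx, hM.testField_mulVec_normal hR hρ hΛ he hτ' hx]
  · intro w hw e he
    have h0 : ∀ x ∈ edgeSet e, M.jumpNormal (hM.testField Λ θ v) e x ⬝ᵥ vval (w e) x = 0 := by
      intro x hx
      obtain ⟨τ₀, hτ₀⟩ := exists_tri_of_mem_Fp he
      have hn := hM.normal_unit τ₀ e hτ₀
      have hw0 := (hw e he).2 x hx
      have hwt : vval (w e) x = (vval (w e) x ⬝ᵥ M.tangent e) • M.tangent e := by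
        ext i
        have := eq_normal_add_tangent hn (vval (w e) x) i
        rw [hw0, zero_mul, zero_add] at this
        simpa using this
      rw [hwt, jumpNormal, sum_dotProduct]
      have : ∀ τ ∈ M.adj e, (M.sgn τ e • (mval (hM.testField Λ θ v τ) x *ᵥ M.normal e)) ⬝ᵥ
          ((vval (w e) x ⬝ᵥ M.tangent e) • M.tangent e) = M.sgn τ e *
            ((vval (w e) x ⬝ᵥ M.tangent e) * (-(edgeLength e)⁻¹ * pval (M.tanPoly v e) x)) := by
        intro τ hτ
        rw [← hM.tangent_dot_testField hR hρ hΛ he hτ hx, smul_dotProduct, dotProduct_smul,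
          dotProduct_comm (M.tangent e)]
        rfl
      rw [Finset.sum_congr rfl this, ← Finset.sum_mul, hM.sum_sgn_eq_zero he, zero_mul]
    rw [edgeIntegral_congr h0, edgeIntegral_const, mul_zero]

omit hΛ hR hρ in
omit hM in
lemma card_adj_ne_zero {τ : M.Tri} {e : Sym2 Pt} (he : e ∈ M.triEdges τ) :
    ((M.adj e).card : ℝ) ≠ 0 :=
  Nat.cast_ne_zero.2 (Finset.card_ne_zero.2 ⟨τ, mem_adj.2 he⟩)

lemma normalTrace_testField {e : Sym2 Pt} (he : e ∈ M.Fu) {x : Pt} (hx : x ∈ edgeSet e) :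
    M.normalTrace (hM.testField Λ θ v) e x = -(edgeLength e)⁻¹ • M.jump v e x := by
  obtain ⟨τ, hτ⟩ := exists_tri_of_mem_Fu he
  rw [normalTrace, Finset.sum_congr rfl fun σ hσ =>
    hM.testField_mulVec_normal hR hρ hΛ he hσ hx, Finset.sum_const, ← Nat.cast_smul_eq_nsmul ℝ,
    smul_smul, inv_mul_cancel₀ (card_adj_ne_zero hτ), one_smul]

lemma normalTrace_testField_tangent {e : Sym2 Pt} (he : e ∈ M.Fp) {x : Pt} (hx : x ∈ edgeSet e) :
    M.normalTrace (hM.testField Λ θ v) e x ⬝ᵥ M.tangent e =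
      -(edgeLength e)⁻¹ * pval (M.tanPoly v e) x := by
  obtain ⟨τ, hτ⟩ := exists_tri_of_mem_Fp he
  rw [normalTrace, smul_dotProduct, sum_dotProduct, Finset.sum_congr rfl fun σ hσ =>
    (dotProduct_comm _ _).trans (hM.tangent_dot_testField hR hρ hΛ he hσ hx), Finset.sum_const,
    ← Nat.cast_smul_eq_nsmul ℝ, smul_smul, inv_mul_cancel₀ (card_adj_ne_zero hτ), one_smul]

/-- The factor `-h_e⁻¹` in the traces cancels the minus signs in `B` and reproduces the weights of
`‖v‖²`. -/
lemma B_testField : M.B (hM.testField Λ θ v) v =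
    (∑ τ, ∫ x in M.triSet τ, frob (mval (hM.testField Λ θ v τ) x) (mval (grad (v τ)) x)) +
      (∑ e ∈ M.Fu, M.primalTerm v e) + ∑ e ∈ M.Fp, M.dualTerm v e := by
  have h1 : ∀ e ∈ M.Fu, edgeIntegral
      (fun x => M.jump v e x ⬝ᵥ M.normalTrace (hM.testField Λ θ v) e x) e =
        -M.primalTerm v e := by
    intro e he
    rw [primalTerm, ← neg_mul, ← edgeIntegral_const_mul]
    refine edgeIntegral_congr fun x hx => ?_
    rw [hM.normalTrace_testField hR hρ hΛ he hx, dotProduct_smul, smul_eq_mul]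
  have h2 : ∀ e ∈ M.Fp, edgeIntegral (fun x => M.jumpMixed (hM.testField Λ θ v) v e x) e =
      -M.dualTerm v e := by
    intro e he
    rw [dualTerm, ← neg_mul, ← edgeIntegral_const_mul]
    refine edgeIntegral_congr fun x hx => ?_
    obtain ⟨τ₀, hτ₀⟩ := exists_tri_of_mem_Fp he
    have hterm : ∀ τ ∈ M.adj e, M.sgn τ e * (((vval (v τ) x ⬝ᵥ M.tangent e) • M.tangent e) ⬝ᵥ
        (mval (hM.testField Λ θ v τ) x *ᵥ M.normal e)) =
        (M.sgn τ e * (vval (v τ) x ⬝ᵥ M.tangent e)) *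
          (-(edgeLength e)⁻¹ * pval (M.tanPoly v e) x) := by
      intro τ hτ
      rw [smul_dotProduct, hM.tangent_dot_testField hR hρ hΛ he hτ hx, smul_eq_mul]
      ring
    rw [jumpMixed, Finset.sum_congr rfl hterm, ← Finset.sum_mul, ← pval_tanPoly, jumpTan_eq,
      smul_dotProduct, dotProduct_smul, tangent_dot_self (hM.normal_unit τ₀ e hτ₀)]
    simp only [smul_eq_mul]
    ring
  rw [B, Finset.sum_congr rfl h1, Finset.sum_congr rfl h2, Finset.sum_neg_distrib,
    Finset.sum_neg_distrib]
  ring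

/-- Since `h_e (h_e⁻¹)² = h_e⁻¹`, the edge part of the norm of the test field is the jump part of
`‖v‖²`. -/
lemma normX'_testField : M.normX' (hM.testField Λ θ v) =
    √((∑ τ, ∫ x in M.triSet τ,
        frob (mval (hM.testField Λ θ v τ) x) (mval (hM.testField Λ θ v τ) x)) +
      (∑ e ∈ M.Fu, M.primalTerm v e) + ∑ e ∈ M.Fp, M.dualTerm v e) := by
  have hsq : ∀ l : ℝ, l ≠ 0 → ∀ a : ℝ, l * ((l⁻¹) ^ 2 * a) = l⁻¹ * a := by
    intro l hl a
    field_simp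
  have h1 : ∀ e ∈ M.Fu, edgeLength e * edgeIntegral (fun x =>
      M.normalTrace (hM.testField Λ θ v) e x ⬝ᵥ M.normalTrace (hM.testField Λ θ v) e x) e =
        M.primalTerm v e := by
    intro e he
    obtain ⟨τ, hτ⟩ := exists_tri_of_mem_Fu he
    have hl := (hM.edgeLength_pos hτ).ne'
    rw [primalTerm, ← hsq _ hl, ← edgeIntegral_const_mul (_ ^ 2)]
    congr 1
    refine edgeIntegral_congr fun x hx => ?_
    rw [hM.normalTrace_testField hR hρ hΛ he hx, dotProduct_smul, smul_dotProduct, smul_eq_mul,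
      smul_eq_mul]
    ring
  have h2 : ∀ e ∈ M.Fp, edgeLength e * edgeIntegral (fun x =>
      (M.normalTrace (hM.testField Λ θ v) e x ⬝ᵥ M.tangent e) ^ 2) e = M.dualTerm v e := by
    intro e he
    obtain ⟨τ, hτ⟩ := exists_tri_of_mem_Fp he
    have hl := (hM.edgeLength_pos hτ).ne'
    rw [dualTerm, ← hsq _ hl, ← edgeIntegral_const_mul (_ ^ 2)]
    congr 1
    refine edgeIntegral_congr fun x hx => ?_
    rw [hM.normalTrace_testField_tangent hR hρ hΛ he hx, jumpTan_eq,
      smul_dotProduct, dotProduct_smul, tangent_dot_self (hM.normal_unit τ e hτ)]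
    simp only [smul_eq_mul]
    ring
  rw [normX', Finset.sum_congr rfl h1, Finset.sum_congr rfl h2]

end IsMeshOf

end MeshData

end SDG

namespace SDG

open MvPolynomial MeasureTheory

namespace MeshData

namespace IsMeshOf

variable {M : MeshData} {Ω : Set Pt} (hM : M.IsMeshOf Ω)
  {Λ : M.Tri → Fin 4 → Matrix (Fin 2) (Fin 2) ℝ} {θ : ℝ} {v : M.VField} {ρ c : ℝ}

/-! ### The inf-sup estimate -/

/-- The part of the coefficients of the test field that carries the jumps. -/
noncomputable def liftPoly (v : M.VField) (τ : M.Tri) (m : Fin 4) : MvPolynomial (Fin 2) ℝ :=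
  C (-(edgeLength (M.edgeOf τ m))⁻¹) * hM.extend τ m (M.jumpData v τ m)

lemma pval_coefPoly (τ : M.Tri) (m : Fin 4) (x : Pt) : pval (hM.coefPoly Λ θ v τ m) x =
    pval (hM.liftPoly v τ m) x +
      θ * (pval (hM.vanishPoly τ m) x * pval (testPoly (Λ τ) (v τ) m) x) := by
  rw [coefPoly, pval_add, pval_mul (C θ), pval_mul (hM.vanishPoly τ m), pval_C, liftPoly]

/-- The weight `h_e⁻²` is compensated by the Jacobian, which `jac_le` bounds by `(ρ c)⁻² h_e²`. -/
lemma integral_liftPoly_sq_le (hR : M.IsRegular ρ c) (hρ : 0 < ρ) (hc : 0 < c) (τ : M.Tri)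
    (m : Fin 4) : ∫ x in M.triSet τ, pval (hM.liftPoly v τ m) x ^ 2 ≤
      ((ρ * c) ^ 2)⁻¹ * M.jumpShare v τ m := by
  have hl := hM.edgeLength_pos (edgeOf_mem τ m)
  have hj := hM.jac_le hR hρ hc τ m
  have he := hM.integral_extend_sq_le τ m (M.jumpData v τ m)
  have hs : 0 ≤ M.jumpShare v τ m :=
    mul_nonneg (inv_nonneg.2 hl.le) (edgeIntegral_nonneg (fun _ => sq_nonneg _) _)
  simp only [liftPoly, pval_mul, pval_C, mul_pow, neg_sq]
  rw [integral_const_mul]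
  set l := edgeLength (M.edgeOf τ m)
  have h1 := mul_le_mul_of_nonneg_left he (by positivity : 0 ≤ l⁻¹ ^ 2)
  refine h1.trans ?_
  rw [← mul_assoc]
  refine mul_le_mul_of_nonneg_right ?_ hs
  rw [inv_pow, inv_mul_le_iff₀ (by positivity), ← mul_pow]
  linarith

/-- With `q = Λ_m : ∇v` and `a` the lifted jump, the integrand is `∑ (a q + θ λ_m q²)`. The second
term yields `θ/K ∫ q²`; the first is bounded below by Young's inequality with parameter `δ`. -/
lemma integral_frob_testField_ge {k : ℕ} {K : ℝ} (hK : 0 < K) (hb : ∀ p ∈ P k,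
      ∫ x in refTri, pval p x ^ 2 ≤ K * ∫ x in refTri, bubble x * pval p x ^ 2)
    (hv : ∀ τ i, v τ i ∈ P k) (hθ : 0 ≤ θ) {δ : ℝ} (hδ : 0 < δ) (τ : M.Tri) :
    ∑ m, ((θ / K - 2 * δ) * (∫ x in M.triSet τ, pval (testPoly (Λ τ) (v τ) m) x ^ 2) -
        (8 * δ)⁻¹ * ∫ x in M.triSet τ, pval (hM.liftPoly v τ m) x ^ 2) ≤
      ∫ x in M.triSet τ, frob (mval (hM.testField Λ θ v τ) x) (mval (grad (v τ)) x) := by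
  have hfun : ∀ x, frob (mval (hM.testField Λ θ v τ) x) (mval (grad (v τ)) x) =
      ∑ m, (pval (hM.liftPoly v τ m) x * pval (testPoly (Λ τ) (v τ) m) x +
        θ * (pval (hM.vanishPoly τ m) x * pval (testPoly (Λ τ) (v τ) m) x ^ 2)) := by
    intro x
    rw [mval_testField, frob_sum_left]
    refine Finset.sum_congr rfl fun m _ => ?_
    rw [pval_coefPoly, ← pval_testPoly]
    ring
  simp only [hfun]
  rw [integral_finsetSum _ fun m _ => integrableOn_triSet (by fun_prop) τ]
  refine Finset.sum_le_sum fun m _ => ?_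
  rw [integral_add (integrableOn_triSet (by fun_prop) τ) (integrableOn_triSet (by fun_prop) τ),
    integral_const_mul]
  have hq := hM.integral_mul_vanishPoly_ge hK hb τ m (testPoly_mem (Λ := Λ τ) (hv τ) m)
  have h1 : θ / K * (∫ x in M.triSet τ, pval (testPoly (Λ τ) (v τ) m) x ^ 2) ≤
      θ * ∫ x in M.triSet τ,
        pval (hM.vanishPoly τ m) x * pval (testPoly (Λ τ) (v τ) m) x ^ 2 := by
    rw [div_mul_eq_mul_div, div_le_iff₀ hK, mul_assoc]
    exact mul_le_mul_of_nonneg_left (by linarith) hθ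
  have h2 : -(2 * δ) * (∫ x in M.triSet τ, pval (testPoly (Λ τ) (v τ) m) x ^ 2) +
      -(8 * δ)⁻¹ * (∫ x in M.triSet τ, pval (hM.liftPoly v τ m) x ^ 2) ≤
      ∫ x in M.triSet τ, pval (hM.liftPoly v τ m) x * pval (testPoly (Λ τ) (v τ) m) x := by
    rw [← integral_const_mul, ← integral_const_mul,
      ← integral_add (integrableOn_triSet (by fun_prop) τ) (integrableOn_triSet (by fun_prop) τ)]
    refine setIntegral_mono (integrableOn_triSet (by fun_prop) τ)
      (integrableOn_triSet (by fun_prop) τ) fun x => ?_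
    simp only
    generalize pval (testPoly (Λ τ) (v τ) m) x = q
    generalize pval (hM.liftPoly v τ m) x = a
    have h3 : 0 ≤ (8 * δ)⁻¹ * (a + 4 * δ * q) ^ 2 := by positivity
    have h4 : (8 * δ)⁻¹ * (a + 4 * δ * q) ^ 2 = (8 * δ)⁻¹ * a ^ 2 + a * q + 2 * δ * q ^ 2 := by
      field_simp; ring
    linarith
  linarith

/-- The factor 8 is 4 from `frob_sum_self_le` times 2 from splitting a square. The bound `0 ≤ λ_m ≤
1` holds only on the triangle, so the comparison is pointwise there. -/
lemma integral_frob_testField_self_le {K : ℝ} (hΛ : ∀ τ m, frob (Λ τ m) (Λ τ m) ≤ K) (τ : M.Tri) :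
    ∫ x in M.triSet τ, frob (mval (hM.testField Λ θ v τ) x) (mval (hM.testField Λ θ v τ) x) ≤
      8 * K * ∑ m, ((∫ x in M.triSet τ, pval (hM.liftPoly v τ m) x ^ 2) +
        θ ^ 2 * ∫ x in M.triSet τ, pval (testPoly (Λ τ) (v τ) m) x ^ 2) := by
  have hK : 0 ≤ K := (frob_self_nonneg _).trans (hΛ τ 0)
  have h1 : ∀ x ∈ M.triSet τ,
      frob (mval (hM.testField Λ θ v τ) x) (mval (hM.testField Λ θ v τ) x) ≤
      8 * K * ∑ m, (pval (hM.liftPoly v τ m) x ^ 2 +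
        θ ^ 2 * pval (testPoly (Λ τ) (v τ) m) x ^ 2) := by
    intro x hx
    rw [mval_testField]
    refine (frob_sum_self_le _ _ (hΛ τ)).trans ?_
    rw [show 8 * K = 4 * K * 2 by ring, mul_assoc (4 * K), Finset.mul_sum _ _ (2 : ℝ)]
    refine mul_le_mul_of_nonneg_left (Finset.sum_le_sum fun m _ => ?_) (by positivity)
    rw [pval_coefPoly]
    have hx' : x ∈ convexHull ℝ {M.vc τ, M.va τ, M.vb τ} := hx
    rw [convexHull_eq_image_refTri] at hx'
    obtain ⟨y, hy, rfl⟩ := hx'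
    obtain ⟨-, hb0, hb1⟩ := hM.pval_vanishPoly_param τ m hy
    rw [param] at hb0 hb1
    set x := refMap (M.vc τ) (M.va τ - M.vc τ) (M.vb τ - M.vc τ) y
    generalize pval (testPoly (Λ τ) (v τ) m) x = q
    generalize pval (hM.liftPoly v τ m) x = a
    generalize pval (hM.vanishPoly τ m) x = b at hb0 hb1
    have h2 : b ^ 2 ≤ 1 := pow_le_one₀ hb0 hb1
    have h3 : b ^ 2 * (θ * q) ^ 2 ≤ (θ * q) ^ 2 := mul_le_of_le_one_left (sq_nonneg _) h2
    nlinarith [sq_nonneg (a - θ * (b * q))]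
  refine (setIntegral_mono_on (integrableOn_triSet (continuous_frob_mval _ _) τ)
    (integrableOn_triSet (by fun_prop) τ) (isCompact_triSet τ).isClosed.measurableSet h1).trans_eq ?_
  rw [integral_const_mul, integral_finsetSum _ fun m _ => integrableOn_triSet (by fun_prop) τ]
  congr 1
  refine Finset.sum_congr rfl fun m _ => ?_
  rw [integral_add (integrableOn_triSet (by fun_prop) τ) (integrableOn_triSet (by fun_prop) τ),
    integral_const_mul]

lemma integral_grad_le (hΛ : ∀ τ H, frob H H ≤ 3 * ∑ m, frob (Λ τ m) H ^ 2) (τ : M.Tri) :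
    ∫ x in M.triSet τ, frob (mval (grad (v τ)) x) (mval (grad (v τ)) x) ≤
      3 * ∑ m, ∫ x in M.triSet τ, pval (testPoly (Λ τ) (v τ) m) x ^ 2 := by
  rw [← integral_finsetSum _ fun m _ => integrableOn_triSet (by fun_prop) τ, ← integral_const_mul]
  refine setIntegral_mono (integrableOn_triSet (continuous_frob_mval _ _) τ)
    (integrableOn_triSet (by fun_prop) τ) fun x => ?_
  simp only [pval_testPoly]
  exact hΛ τ _

lemma sum_integral_testPoly_le {K : ℝ} (hΛ : ∀ τ m, frob (Λ τ m) (Λ τ m) ≤ K) (τ : M.Tri) :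
    ∑ m, ∫ x in M.triSet τ, pval (testPoly (Λ τ) (v τ) m) x ^ 2 ≤
      4 * K * ∫ x in M.triSet τ, frob (mval (grad (v τ)) x) (mval (grad (v τ)) x) := by
  have h1 : ∀ m, ∫ x in M.triSet τ, pval (testPoly (Λ τ) (v τ) m) x ^ 2 ≤
      K * ∫ x in M.triSet τ, frob (mval (grad (v τ)) x) (mval (grad (v τ)) x) := by
    intro m
    rw [← integral_const_mul]
    refine setIntegral_mono (integrableOn_triSet (by fun_prop) τ)
      (integrableOn_triSet (continuous_const.mul (continuous_frob_mval _ _)) τ) fun x => ?_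
    simp only [pval_testPoly]
    exact (frob_sq_le _ _).trans (mul_le_mul_of_nonneg_right (hΛ τ m) (frob_self_nonneg _))
  refine (Finset.sum_le_sum fun m _ => h1 m).trans_eq ?_
  simp
  ring

end IsMeshOf

/-- For every `v` there is a test field that controls its norm. -/
lemma exists_testField (k : ℕ) {ρ c : ℝ} (hρ : 0 < ρ) (hc : 0 < c) :
    ∃ K : ℝ, 0 < K ∧ ∀ (Ω : Set Pt) (M : MeshData), M.IsMeshOf Ω → M.IsRegular ρ c →
      ∀ v ∈ M.U k, ∃ G ∈ M.WHat Ω k, M.normZ2 v ^ 2 ≤ 2 * M.B G v ∧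
        M.normX' G ≤ K * M.normZ2 v := by
  obtain ⟨Kb, hKb, hb⟩ := exists_bubble_bound k
  set κ := ρ * c with hκdef
  have hκ : 0 < κ := mul_pos hρ hc
  -- The constant of `integral_liftPoly_sq_le`: then Young's term is at most `1/8` of the shares,
  -- hence at most half the jump part after summation by `sum_jumpShare_le`.
  set δ := (κ ^ 2)⁻¹ with hδdef
  have hδ : 0 < δ := by positivity
  set KΛ := 12 * (1 + 2 * (κ ^ 4)⁻¹) with hKΛ
  have hKΛ0 : 0 < KΛ := by positivity
  -- Chosen so that `θ / Kb - 2 δ = 3/2`; by the factor 3 in `integral_grad_le` this leaves half of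
  -- the gradient part.
  set θ := Kb * (2 * δ + 3 / 2) with hθdef
  have hθ : 0 < θ := by positivity
  -- The product bounds the `L²` part of the test field; the summand 1 pays for its edge part.
  set K2 := 8 * KΛ * (4 * δ + 4 * θ ^ 2 * KΛ) + 1 with hK2
  have hK20 : 0 < K2 := by positivity
  refine ⟨√K2, Real.sqrt_pos.2 hK20, fun Ω M hM hR v hv => ?_⟩
  choose Λ hΛ1 hΛ2 hΛ3 using fun τ => (hM.shape hR hρ hc τ).exists_dual
  have hdual : IsMeshOf.IsDual M Λ := hΛ1
  refine ⟨hM.testField Λ θ v, hM.testField_mem_WHat hR hρ hdual hv.1, ?_, ?_⟩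
  all_goals
    have hg : 0 ≤ M.gradPart v := Finset.sum_nonneg fun τ _ => integral_grad_nonneg v τ
    have hp : 0 ≤ ∑ e ∈ M.Fu, M.primalTerm v e := Finset.sum_nonneg fun e _ => primalTerm_nonneg v e
    have hd : 0 ≤ ∑ e ∈ M.Fp, M.dualTerm v e := Finset.sum_nonneg fun e _ => dualTerm_nonneg v e
    have hJ := hM.sum_jumpShare_le v
    have hlift := fun τ m => hM.integral_liftPoly_sq_le (v := v) hR hρ hc τ m
  · rw [normZ2_eq, Real.sq_sqrt (by positivity), hM.B_testField hR hρ hdual]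
    have hloc : ∀ τ, 1 / 2 * (∫ x in M.triSet τ, frob (mval (grad (v τ)) x) (mval (grad (v τ)) x))
        - 1 / 8 * ∑ m, M.jumpShare v τ m ≤
        ∫ x in M.triSet τ, frob (mval (hM.testField Λ θ v τ) x) (mval (grad (v τ)) x) := by
      intro τ
      refine le_trans ?_ (hM.integral_frob_testField_ge hKb hb hv.1 hθ.le hδ τ)
      have h1 := IsMeshOf.integral_grad_le (v := v) hΛ3 τ
      have h2 : θ / Kb - 2 * δ = 3 / 2 := by rw [hθdef]; field_simp; ring
      rw [h2, Finset.sum_sub_distrib, ← Finset.mul_sum, ← Finset.mul_sum]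
      have h3 : (8 * δ)⁻¹ * ∑ m, ∫ x in M.triSet τ, pval (hM.liftPoly v τ m) x ^ 2 ≤
          1 / 8 * ∑ m, M.jumpShare v τ m := by
        have h4 : ∑ m, ∫ x in M.triSet τ, pval (hM.liftPoly v τ m) x ^ 2 ≤
            δ * ∑ m, M.jumpShare v τ m := by
          rw [Finset.mul_sum]
          exact Finset.sum_le_sum fun m _ => hlift τ m
        rw [inv_mul_le_iff₀ (by positivity)]
        linarith
      linarith
    have hsum := Finset.sum_le_sum fun τ (_ : τ ∈ Finset.univ) => hloc τ
    rw [Finset.sum_sub_distrib, ← Finset.mul_sum, ← Finset.mul_sum] at hsum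
    change 1 / 2 * M.gradPart v - _ ≤ _ at hsum
    linarith
  · rw [hM.normX'_testField hR hρ hdual, normZ2_eq, ← Real.sqrt_mul hK20.le]
    refine Real.sqrt_le_sqrt ?_
    have hloc : ∀ τ, ∫ x in M.triSet τ,
        frob (mval (hM.testField Λ θ v τ) x) (mval (hM.testField Λ θ v τ) x) ≤
        8 * KΛ * (δ * ∑ m, M.jumpShare v τ m + θ ^ 2 * (4 * KΛ *
          ∫ x in M.triSet τ, frob (mval (grad (v τ)) x) (mval (grad (v τ)) x))) := by
      intro τ
      refine (hM.integral_frob_testField_self_le hΛ2 τ).trans ?_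
      refine mul_le_mul_of_nonneg_left ?_ (by positivity)
      rw [Finset.sum_add_distrib, ← Finset.mul_sum]
      refine add_le_add ?_ (mul_le_mul_of_nonneg_left
        (IsMeshOf.sum_integral_testPoly_le hΛ2 τ) (sq_nonneg θ))
      rw [Finset.mul_sum]
      exact Finset.sum_le_sum fun m _ => hlift τ m
    have hsum := Finset.sum_le_sum fun τ (_ : τ ∈ Finset.univ) => hloc τ
    simp only [← Finset.mul_sum, Finset.sum_add_distrib] at hsum
    have hgr : (∑ τ, ∫ x in M.triSet τ, frob (mval (grad (v τ)) x) (mval (grad (v τ)) x)) =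
        M.gradPart v := rfl
    rw [hgr] at hsum
    set g := M.gradPart v
    set J := (∑ e ∈ M.Fu, M.primalTerm v e) + ∑ e ∈ M.Fp, M.dualTerm v e with hJdef
    have hJ0 : 0 ≤ J := add_nonneg hp hd
    have h1 : 8 * KΛ * (δ * ∑ τ, ∑ m, M.jumpShare v τ m + θ ^ 2 * (4 * KΛ * g)) ≤
        8 * KΛ * (δ * (4 * J) + θ ^ 2 * (4 * KΛ * g)) := by gcongr
    have h2 : 8 * KΛ * (δ * (4 * J) + θ ^ 2 * (4 * KΛ * g)) + J ≤ K2 * (g + J) := by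
      have a1 : 0 ≤ KΛ * δ * g := by positivity
      have a2 : 0 ≤ KΛ * (θ ^ 2 * KΛ) * J := by positivity
      rw [hK2]
      nlinarith
    have h3 : g + (∑ e ∈ M.Fu, M.primalTerm v e) + ∑ e ∈ M.Fp, M.dualTerm v e = g + J := by
      rw [hJdef]; ring
    rw [h3]
    linarith

/-! ### Nonvanishing of the test field and conclusion -/

lemma IsMeshOf.normX'_pos {M : MeshData} {Ω : Set Pt} (hM : M.IsMeshOf Ω) {G : M.MField}
    (hG : G ≠ 0) : 0 < M.normX' G := by
  have hterm : ∀ τ, 0 ≤ ∫ x in M.triSet τ, frob (mval (G τ) x) (mval (G τ) x) := fun τ =>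
    integral_nonneg fun _ => frob_self_nonneg _
  have h1 : 0 < ∑ τ, ∫ x in M.triSet τ, frob (mval (G τ) x) (mval (G τ) x) := by
    by_contra hcon
    have h0 := (Finset.sum_eq_zero_iff_of_nonneg fun τ _ => hterm τ).1
      (le_antisymm (not_lt.1 hcon) (Finset.sum_nonneg fun τ _ => hterm τ))
    refine hG (funext fun τ => Matrix.ext fun i j => ?_)
    refine hM.eq_zero_of_integral_triSet (τ := τ) ?_
    rw [← h0 τ (Finset.mem_univ _)]
    refine setIntegral_mono (IsMeshOf.integrableOn_triSet (by fun_prop) τ)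
      (IsMeshOf.integrableOn_triSet (continuous_frob_mval _ _) τ) fun x => ?_
    show mval (G τ) x i j ^ 2 ≤ frob (mval (G τ) x) (mval (G τ) x)
    rw [sq]
    refine le_trans ?_ (Finset.single_le_sum (f := fun i => ∑ j, mval (G τ) x i j *
      mval (G τ) x i j) (fun i _ => Finset.sum_nonneg fun j _ => mul_self_nonneg _)
      (Finset.mem_univ i))
    exact Finset.single_le_sum (f := fun j => mval (G τ) x i j * mval (G τ) x i j)
      (fun j _ => mul_self_nonneg _) (Finset.mem_univ j)
  refine Real.sqrt_pos.2 ?_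
  have h2 : 0 ≤ ∑ e ∈ M.Fu, edgeLength e *
      edgeIntegral (fun x => M.normalTrace G e x ⬝ᵥ M.normalTrace G e x) e :=
    Finset.sum_nonneg fun e _ => mul_nonneg (edgeLength_nonneg e)
      (edgeIntegral_nonneg (fun _ => dot_self_nonneg _) e)
  have h3 : 0 ≤ ∑ e ∈ M.Fp, edgeLength e *
      edgeIntegral (fun x => (M.normalTrace G e x ⬝ᵥ M.tangent e) ^ 2) e :=
    Finset.sum_nonneg fun e _ => mul_nonneg (edgeLength_nonneg e)
      (edgeIntegral_nonneg (fun _ => sq_nonneg _) e)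
  linarith

lemma B_zero {M : MeshData} (v : M.VField) : M.B 0 v = 0 := by
  have h0 : ∀ x, mval (0 : Matrix (Fin 2) (Fin 2) (MvPolynomial (Fin 2) ℝ)) x = 0 := by
    intro x; ext i j; simp [mval]
  simp [B, h0, frob, normalTrace, jumpMixed, edgeIntegral_const]

end MeshData

end SDG

theorem theorem3p1 (k : ℕ) (ρ c : ℝ) (hρ : 0 < ρ) (hc : 0 < c) :
    ∃ C : ℝ, 0 < C ∧
      ∀ (Ω : Set SDG.Pt), IsOpen Ω → IsConnected Ω → interior (closure Ω) = Ω →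
      ∀ M : SDG.MeshData, M.IsMeshOf Ω → M.IsRegular ρ c →
        (C : EReal) ≤
          ⨅ v ∈ {v : M.VField | v ∈ M.U k ∧ v ≠ 0},
            ⨆ G ∈ {G : M.MField | G ∈ M.WHat Ω k ∧ G ≠ 0},
              ((M.B G v / (M.normX' G * M.normZ2 v) : ℝ) : EReal) := by
  obtain ⟨K, hK, h⟩ := SDG.MeshData.exists_testField k hρ hc
  refine ⟨(2 * K)⁻¹, by positivity, fun Ω _ _ _ M hM hR => ?_⟩
  refine le_iInf₂ fun v hv => ?_
  obtain ⟨hvU, hv0⟩ := hv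
  obtain ⟨G, hG, hB, hX⟩ := h Ω M hM hR v hvU
  have hZ := hM.normZ2_pos hvU hv0
  -- A zero test field would give `‖v‖² ≤ 2 B(0, v) = 0`.
  have hG0 : G ≠ 0 := by
    rintro rfl
    rw [SDG.MeshData.B_zero] at hB
    nlinarith
  have hXpos := hM.normX'_pos hG0
  refine le_iSup₂_of_le G ⟨hG, hG0⟩ (EReal.coe_le_coe_iff.2 ?_)
  rw [le_div_iff₀ (mul_pos hXpos hZ), inv_mul_le_iff₀ (by positivity)]
  have h1 : M.normX' G * M.normZ2 v ≤ K * M.normZ2 v * M.normZ2 v :=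
    mul_le_mul_of_nonneg_right hX hZ.le
  nlinarith [mul_le_mul_of_nonneg_left hB hK.le]
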